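/- For real $m$ put $l=1+2m+\tfrac32m^2$ $(>0)$ and $\chi=\sqrt{1+2m-\tfrac12m^2}$ (principal complex square root). Consider, for $\lambda\in\mathbb C$ and functions $p,q$ of the real variable $\tau$ with values in the open unit disc, the system $$\begin{aligned}p''+2(1+m)i\,p'-\tfrac32l(p+q)&=\tfrac32\lambda(q-1)e^{-2i\tau}+l\,R_p,\\ q''-2(1+m)i\,q'-\tfrac32l(p+q)&=\tfrac32\lambda(p-1)e^{2i\tau}+l\,R_q,\end{aligned}\tag{15}$$ where $R_p=(1-p)^{-1/2}(1-q)^{-3/2}-1-\tfrac12p-\tfrac32q$ and $R_q=(1-p)^{-3/2}(1-q)^{-1/2}-1-\tfrac32p-\tfrac12q$ (principal powers), and, for real $\lambda$ and $k/a^3=l$ with $a>0$, the system $$\begin{aligned}x''-2my'-\tfrac32m^2x+\frac{kx}{(x^2+y^2)^{3/2}}&=\tfrac32\lambda x,\\ y''+2mx'-\tfrac32m^2y+\frac{ky}{(x^2+y^2)^{3/2}}&=-\tfrac32\lambda y.\end{aligned}\tag{13}$$ Assume $\sin\pi\chi\ne0$; this holds for the lunar value $m=0.080848933808312$. Write $p_0,q_0,p_0',q_0'$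 for the values of $p,q,p',q'$ at $\tau=0$. Then: 1. (Equivalence.) If $\lambda$ is real, $|p|<1$ and $x+iy=a(1-p)e^{i\tau}$, then $(p,\bar p)$ solves (15) if and only if $(x,y)$ solves (13). 2. (Energy integral.) Along every solution of (15) on an open interval, the following expression is constant: $$[p'-i(1-p)][q'+i(1-q)]-\tfrac32m^2(1-p)(1-q)-2l(1-p)^{-1/2}(1-q)^{-1/2}-\tfrac34\lambda\big[(1-p)^2e^{2i\tau}+(1-q)^2e^{-2i\tau}\big].$$ 3. (One periodicity condition is redundant.) There is $\varepsilon>0$ such that, if $|\lambda|<\varepsilon$ and $(p,q)$ solves (15) on an open interval containing $[0,2\pi]$ with $|p_0|,|q_0|,|p_0'|,|q_0'|<\varepsilon$, then any three of the four equations $p(2\pi)=p_0$, $q(2\pi)=q_0$, $p'(2\pi)=p'_0$, $q'(2\pi)=q'_0$ imply the fourth (when the fourth is the one for $p$ or the one for $q$, under the additional condition $m\ne-1$). 4. (Periodic solutions.) There are $\delta>0$ and, for each $(c,\lambda)\in\mathbb C^2$ with $|c|,|\lambda|<\delta$, a $2\pi$-periodic solution $(p,q)$ of (15) on $\mathbb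 R$ with $p_0-q_0=c$ such that, for all $\tau$, $p$ and $q$ are given by absolutely convergent series $$p(\tau)=\sum_{j,n\ge0}A_{jn}(\tau)\,c^j\lambda^n,\qquad q(\tau)=\sum_{j,n\ge0}B_{jn}(\tau)\,c^j\lambda^n,$$ with differentiable $2\pi$-periodic coefficients independent of $c$ and $\lambda$, and $p',q'$ are given by the absolutely convergent termwise differentiated series. For $c=\lambda=0$ this solution is $p=q=0$, and $p,q,p',q'\to0$ uniformly in $\tau$ as $(c,\lambda)\to(0,0)$. Moreover $c$ is the only arbitrary constant: there is $\varepsilon>0$ such that for $|\lambda|<\varepsilon$ every $2\pi$-periodic solution of (15) with $|p_0|,|q_0|,|p_0'|,|q_0'|<\varepsilon$ is the one of this family with $c=p_0-q_0$. 5. (Real motions.) If $\lambda$ and $\eta_0$ are real, $|\lambda|<\delta$, $2|\eta_0|<\delta$ and $c=-2i\eta_0$, then $q=\bar p$ in 4, and $x+iy=a(1-p)e^{i\tau}$ defines a $2\pi$-periodic solution of (13) with $y(0)=a\eta_0$. As $(\eta_0,\lambda)\to(0,0)$ (in particular for $\eta_0=0$, $\lambda\to0$), this solution and its derivative tend, uniformly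 in $\tau$, to the circular motion $x=a\cos\tau$, $y=a\sin\tau$ and its derivative. -/

import Mathlib

open Filter Topology

noncomputable section

/-- The constant `l = 1 + 2m + (3/2) m²`. -/
def hillL (m : ℝ) : ℝ := 1 + 2 * m + 3 / 2 * m ^ 2

/-- `χ = √(1 + 2m - m²/2)`, the principal complex square root. -/
def hillChi (m : ℝ) : ℂ := ((1 + 2 * m - m ^ 2 / 2 : ℝ) : ℂ) ^ (1 / 2 : ℂ)

/-- The terms of degree at least two in the expansion of `(1-p)^(-1/2) (1-q)^(-3/2)`. -/
def remP (p q : ℂ) : ℂ :=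
  (1 - p) ^ (-1 / 2 : ℂ) * (1 - q) ^ (-3 / 2 : ℂ) - 1 - 1 / 2 * p - 3 / 2 * q

/-- The terms of degree at least two in the expansion of `(1-p)^(-3/2) (1-q)^(-1/2)`. -/
def remQ (p q : ℂ) : ℂ :=
  (1 - p) ^ (-3 / 2 : ℂ) * (1 - q) ^ (-1 / 2 : ℂ) - 1 - 3 / 2 * p - 1 / 2 * q

/-- `(p, q)` solves, on the open set `I` of times, the complex system
`p'' + 2(1+m)i p' - (3/2) l (p+q) = (3/2) λ (q-1) e^(-2iτ) + l R_p`,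
`q'' - 2(1+m)i q' - (3/2) l (p+q) = (3/2) λ (p-1) e^(2iτ) + l R_q`,
with `|p| < 1` and `|q| < 1`. -/
structure IsComplexSolOn (m : ℝ) (lam : ℂ) (I : Set ℝ) (p q : ℝ → ℂ) : Prop where
  norm_p_lt : ∀ τ ∈ I, ‖p τ‖ < 1
  norm_q_lt : ∀ τ ∈ I, ‖q τ‖ < 1
  diff_p : ∀ τ ∈ I, DifferentiableAt ℝ p τ
  diff_q : ∀ τ ∈ I, DifferentiableAt ℝ q τ
  diff_p' : ∀ τ ∈ I, DifferentiableAt ℝ (deriv p) τ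
  diff_q' : ∀ τ ∈ I, DifferentiableAt ℝ (deriv q) τ
  eq_p : ∀ τ ∈ I,
    deriv (deriv p) τ + 2 * (1 + m) * Complex.I * deriv p τ - 3 / 2 * hillL m * (p τ + q τ)
      = 3 / 2 * lam * (q τ - 1) * Complex.exp (-2 * Complex.I * τ) + hillL m * remP (p τ) (q τ)
  eq_q : ∀ τ ∈ I,
    deriv (deriv q) τ - 2 * (1 + m) * Complex.I * deriv q τ - 3 / 2 * hillL m * (p τ + q τ)
      = 3 / 2 * lam * (p τ - 1) * Complex.exp (2 * Complex.I * τ) + hillL m * remQ (p τ) (q τ)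

/-- `(x, y)` is a collision-free solution, for all times, of the real system
`x'' - 2m y' - (3/2) m² x + k x (x²+y²)^(-3/2) = (3/2) λ x`,
`y'' + 2m x' - (3/2) m² y + k y (x²+y²)^(-3/2) = -(3/2) λ y`. -/
structure IsRealSol (m k lam : ℝ) (x y : ℝ → ℝ) : Prop where
  pos : ∀ τ, 0 < x τ ^ 2 + y τ ^ 2
  diff_x : Differentiable ℝ x
  diff_y : Differentiable ℝ y
  diff_x' : Differentiable ℝ (deriv x)
  diff_y' : Differentiable ℝ (deriv y)
  eq_x : ∀ τ, deriv (deriv x) τ - 2 * m * deriv y τ - 3 / 2 * m ^ 2 * x τ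
      + k * x τ / (x τ ^ 2 + y τ ^ 2) ^ (3 / 2 : ℝ) = 3 / 2 * lam * x τ
  eq_y : ∀ τ, deriv (deriv y) τ + 2 * m * deriv x τ - 3 / 2 * m ^ 2 * y τ
      + k * y τ / (x τ ^ 2 + y τ ^ 2) ^ (3 / 2 : ℝ) = -(3 / 2) * lam * y τ

/-- The energy expression of the complex system at the time `τ`. -/
def hillEnergy (m : ℝ) (lam : ℂ) (p q : ℝ → ℂ) (τ : ℝ) : ℂ :=
  (deriv p τ - Complex.I * (1 - p τ)) * (deriv q τ + Complex.I * (1 - q τ))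
    - 3 / 2 * m ^ 2 * (1 - p τ) * (1 - q τ)
    - 2 * hillL m * ((1 - p τ) ^ (-1 / 2 : ℂ) * (1 - q τ) ^ (-1 / 2 : ℂ))
    - 3 / 4 * lam * ((1 - p τ) ^ 2 * Complex.exp (2 * Complex.I * τ)
        + (1 - q τ) ^ 2 * Complex.exp (-2 * Complex.I * τ))

/-- The four initial values `p₀, q₀, p'₀, q'₀` have modulus less than `ε`. -/
def SmallInit (ε : ℝ) (p q : ℝ → ℂ) : Prop :=
  ‖p 0‖ < ε ∧ ‖q 0‖ < ε ∧ ‖deriv p 0‖ < ε ∧ ‖deriv q 0‖ < ε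

/-- `s = ∑ A (j, n) c^j λ^n`, the double series converging absolutely. -/
def HasAbsSeries (A : ℕ × ℕ → ℂ) (c lam s : ℂ) : Prop :=
  Summable (fun n : ℕ × ℕ => ‖A n * c ^ n.1 * lam ^ n.2‖) ∧
    HasSum (fun n : ℕ × ℕ => A n * c ^ n.1 * lam ^ n.2) s

/-- `x = a (1+ξ) cos τ - a η sin τ` with `p = -ξ - iη`, the real part of `a (1-p) e^(iτ)`. -/
def orbitX (a : ℝ) (p : ℝ → ℂ) (τ : ℝ) : ℝ :=
  a * (1 - (p τ).re) * Real.cos τ + a * (p τ).im * Real.sin τ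

/-- `y = a (1+ξ) sin τ + a η cos τ` with `p = -ξ - iη`, the imaginary part of
`a (1-p) e^(iτ)`. -/
def orbitY (a : ℝ) (p : ℝ → ℂ) (τ : ℝ) : ℝ :=
  a * (1 - (p τ).re) * Real.sin τ - a * (p τ).im * Real.cos τ

end

/-! In the complex variable `z = x + iy` the real system is one equation whose right side is a
multiple of `conj z`. Substituting `z = a(1-p)e^{iτ}` and dividing by `-a e^{iτ}` gives the equation
for `p` with `q = conj p`; the equation for `q` is its conjugate. The energy integral comes from
multiplying the two equations by `q' + i(1-q)` and `p' - i(1-p)` and adding.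

The periodic solutions come from a shooting argument at the equilibrium `p = q = 0`, `lam = 0`. The
plain periodicity equations are degenerate there: rotating the circular motion gives the kernel `p =
-q = const` of the linearised system, and conservation of energy makes one equation depend on the
others. Both defects are removed together: the value `p₀ - q₀ = c` is prescribed, and the condition
on `q'` is dropped. It is recovered from the energy, whose slope in `q'` is `p' - i(1-p)`, close to
`-i`. The resulting map of initial states has injective derivative (`linear_periodic_of_three`,
`linear_periodic_eq_zero`): `p + q` satisfies a forced oscillator equation of frequency `χ`, and
`sin πχ ≠ 0` excludes nonconstant periodic solutions of it. The inverse function theorem gives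
existence and local uniqueness (`exists_periodic_curves`).

Analyticity is obtained by treating the flow as a map into the Banach space of continuous curves on
`[-1, 7]`. The integral equation is analytic there (`exists_hillField_superposition`), its
linearisation is an invertible Volterra operator (`isUnit_one_sub_volterra`), and the implicit
function theorem makes the flow analytic (`exists_analytic_flow`). The family is then a double power
series with curves as coefficients. These are turned into periodic functions of time by continuous
linear functionals (`periodicState`), arranged so that the functional for `p'` is exactly the time
derivative of that for `p`. Periodicity and termwise differentiation thus hold for every
coefficient, without a separate study of the coefficients.

For real motions, `(conj q, conj p)` is again a solution, with the same `c` when `c` is imaginary,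
so uniqueness forces `q = conj p`. -/

noncomputable section
open scoped ContDiff

/-! ### Double power series of analytic functions of two variables -/

/-- The coefficient of `c ^ j * lam ^ n` in an analytic function of two variables with the power series `ps`. -/
def doubleCoeff {Z : Type*} [NormedAddCommGroup Z] [NormedSpace ℂ Z]
    (ps : FormalMultilinearSeries ℂ (ℂ × ℂ) Z) (n : ℕ × ℕ) : Z :=
  ∑ s ∈ Finset.powersetCard n.1 (Finset.univ : Finset (Fin (n.1 + n.2))),
    ps (n.1 + n.2) (s.piecewise (fun _ => (1, 0)) (fun _ => (0, 1)))

/-- Multilinearity: expand `(c, lam) = c • (1, 0) + lam • (0, 1)` in every slot and group the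
subsets of slots by cardinality. -/
theorem doubleCoeff_sum_antidiagonal {Z : Type*} [NormedAddCommGroup Z] [NormedSpace ℂ Z]
    (ps : FormalMultilinearSeries ℂ (ℂ × ℂ) Z) (c lam : ℂ) (k : ℕ) :
    ∑ n ∈ Finset.HasAntidiagonal.antidiagonal k, (c ^ n.1 * lam ^ n.2) • doubleCoeff ps n =
      ps k (fun _ => (c, lam)) := by
  have h1 : (fun _ : Fin k => (c, lam)) =
      (fun _ : Fin k => c • ((1 : ℂ), (0 : ℂ))) + (fun _ : Fin k => lam • ((0 : ℂ), (1 : ℂ))) := by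
    funext i; simp
  rw [h1]
  change _ = (ps k).toMultilinearMap _
  rw [MultilinearMap.map_add_univ]
  have h2 : ∀ s : Finset (Fin k), (ps k).toMultilinearMap
      (s.piecewise (fun _ : Fin k => c • ((1 : ℂ), (0 : ℂ))) (fun _ => lam • ((0 : ℂ), (1 : ℂ))))
      = (c ^ s.card * lam ^ (k - s.card)) •
        ps k (s.piecewise (fun _ => (1, 0)) (fun _ => (0, 1))) := by
    intro s
    have h3 : (s.piecewise (fun _ : Fin k => c • ((1 : ℂ), (0 : ℂ)))
        (fun _ => lam • ((0 : ℂ), (1 : ℂ)))) = fun i =>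
        (s.piecewise (fun _ => c) (fun _ => lam) i) •
          (s.piecewise (fun _ => ((1 : ℂ), (0 : ℂ))) (fun _ => (0, 1)) i) := by
      funext i
      by_cases hi : i ∈ s <;> simp [hi]
    rw [h3, MultilinearMap.map_smul_univ, Finset.prod_piecewise]
    simp [Finset.card_sdiff]
  simp_rw [h2]
  rw [← Finset.powerset_univ, Finset.sum_powerset, Finset.card_univ, Fintype.card_fin,
    Finset.Nat.sum_antidiagonal_eq_sum_range_succ_mk]
  refine Finset.sum_congr rfl fun j hj => ?_
  have hjk : j + (k - j) = k := by have := Finset.mem_range.1 hj; omega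
  simp only [doubleCoeff]
  rw [hjk, Finset.smul_sum]
  refine Finset.sum_congr rfl fun s hs => ?_
  rw [(Finset.mem_powersetCard.1 hs).2]

theorem norm_doubleCoeff_le {Z : Type*} [NormedAddCommGroup Z] [NormedSpace ℂ Z]
    (ps : FormalMultilinearSeries ℂ (ℂ × ℂ) Z) (n : ℕ × ℕ) :
    ‖doubleCoeff ps n‖ ≤ ((n.1 + n.2).choose n.1) * ‖ps (n.1 + n.2)‖ := by
  refine (norm_sum_le _ _).trans ?_
  refine (Finset.sum_le_card_nsmul _ _ ‖ps (n.1 + n.2)‖ fun s _ => ?_).trans ?_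
  · refine ((ps (n.1 + n.2)).le_opNorm _).trans ?_
    refine mul_le_of_le_one_right (norm_nonneg _) (Finset.prod_le_one (fun _ _ => norm_nonneg _) ?_)
    intro i _
    by_cases hi : i ∈ s <;> simp [hi]
  · simp [nsmul_eq_mul]

/-- An analytic function of two variables is the sum of an absolutely convergent double series. -/
theorem AnalyticAt.exists_double_series {Z : Type*} [NormedAddCommGroup Z] [NormedSpace ℂ Z]
    [CompleteSpace Z] {F : ℂ × ℂ → Z} (hF : AnalyticAt ℂ F 0) :
    ∃ (r : ℝ) (a : ℕ × ℕ → Z), 0 < r ∧ ∀ c lam : ℂ, ‖c‖ < r → ‖lam‖ < r →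
      Summable (fun n : ℕ × ℕ => ‖(c ^ n.1 * lam ^ n.2) • a n‖) ∧
      HasSum (fun n : ℕ × ℕ => (c ^ n.1 * lam ^ n.2) • a n) (F (c, lam)) := by
  obtain ⟨ps, R, hps⟩ := hF
  obtain ⟨ρ, hρ0, hρ⟩ := ENNReal.lt_iff_exists_nnreal_btwn.1 hps.r_pos
  have hρ0 : (0 : ℝ) < ρ := by exact_mod_cast hρ0
  -- The factor `1 / 2` gives `‖c‖ + ‖lam‖ ≤ ρ`. This sum is what matters: by the binomial theorem
  -- the norms of degree `k` add up to at most `‖ps k‖ (‖c‖ + ‖lam‖) ^ k`.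
  refine ⟨ρ / 2, doubleCoeff ps, by positivity, fun c lam hc hl => ?_⟩
  have hsum : Summable fun k => ‖ps k‖ * (‖c‖ + ‖lam‖) ^ k := by
    have h := ps.summable_norm_mul_pow (lt_of_lt_of_le hρ hps.r_le)
    refine h.of_nonneg_of_le (fun k => by positivity) fun k => ?_
    gcongr
    linarith
  have hs : Summable (fun n : ℕ × ℕ => ‖(c ^ n.1 * lam ^ n.2) • doubleCoeff ps n‖) := by
    rw [← (Finset.HasAntidiagonal.sigmaAntidiagonalEquivProd (A := ℕ)).summable_iff]
    refine (summable_sigma_of_nonneg (fun _ => norm_nonneg _)).2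
      ⟨fun k => (hasSum_fintype _).summable, ?_⟩
    refine hsum.of_nonneg_of_le (fun k => tsum_nonneg fun _ => norm_nonneg _) fun k => ?_
    change ∑' x : Finset.HasAntidiagonal.antidiagonal k,
      ‖(c ^ x.1.1 * lam ^ x.1.2) • doubleCoeff ps x.1‖ ≤ _
    rw [tsum_fintype, Finset.sum_coe_sort (Finset.HasAntidiagonal.antidiagonal k)
      (fun n => ‖(c ^ n.1 * lam ^ n.2) • doubleCoeff ps n‖), (Commute.all _ _).add_pow',
      Finset.mul_sum]
    refine Finset.sum_le_sum fun n hn => ?_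
    rw [norm_smul, norm_mul, norm_pow, norm_pow, nsmul_eq_mul]
    have := norm_doubleCoeff_le ps n
    rw [Finset.HasAntidiagonal.mem_antidiagonal.1 hn] at this
    calc _ ≤ ‖c‖ ^ n.1 * ‖lam‖ ^ n.2 * ((k.choose n.1) * ‖ps k‖) := by gcongr
      _ = _ := by ring
  refine ⟨hs, ?_⟩
  have h1 := hs.of_norm
  have hmem : ((c, lam) : ℂ × ℂ) ∈ Metric.eball (0 : ℂ × ℂ) R := by
    refine Metric.eball_subset_eball hρ.le ?_
    rw [Metric.eball_coe, mem_ball_zero_iff, Prod.norm_def]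
    exact max_lt (by simp; linarith) (by simp; linarith)
  have h2 := hps.hasSum hmem
  have h3 : HasSum (fun k => ∑ n ∈ Finset.HasAntidiagonal.antidiagonal k, (c ^ n.1 * lam ^ n.2) • doubleCoeff ps n)
      (∑' n : ℕ × ℕ, (c ^ n.1 * lam ^ n.2) • doubleCoeff ps n) := by
    have h4 := (Finset.HasAntidiagonal.sigmaAntidiagonalEquivProd (A := ℕ)).hasSum_iff.2 h1.hasSum
    refine h4.sigma fun k => ?_
    exact Finset.hasSum (Finset.HasAntidiagonal.antidiagonal k) (fun n => (c ^ n.1 * lam ^ n.2) • doubleCoeff ps n)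
  simp_rw [doubleCoeff_sum_antidiagonal] at h3
  rw [zero_add] at h2
  rw [h2.unique h3]
  exact h1.hasSum

/-! ### Continuous curves on a time interval and linear Volterra equations -/

/-- The compact time interval on which the flow is constructed; its interior contains `[0, 2π]`. -/
abbrev TimeIcc : Set ℝ := Set.Icc (-1) 7

theorem neg_one_le_seven : (-1 : ℝ) ≤ 7 := by norm_num

/-- The origin of time. -/
def timeZero : TimeIcc := ⟨0, by norm_num, by norm_num⟩

section Primitive

variable {G : Type*} [NormedAddCommGroup G]

/-- The constant extension to all times. -/
def extendTime (u : C(TimeIcc, G)) : ℝ → G := Set.IccExtend neg_one_le_seven u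

theorem extendTime_of_mem (u : C(TimeIcc, G)) {t : ℝ} (ht : t ∈ TimeIcc) :
    extendTime u t = u ⟨t, ht⟩ := Set.IccExtend_of_mem _ _ ht

theorem extendTime_coe (u : C(TimeIcc, G)) (t : TimeIcc) : extendTime u t = u t :=
  Set.IccExtend_val _ _ _

theorem continuous_extendTime (u : C(TimeIcc, G)) : Continuous (extendTime u) :=
  u.continuous.Icc_extend'

theorem norm_extendTime_le (u : C(TimeIcc, G)) (t : ℝ) : ‖extendTime u t‖ ≤ ‖u‖ :=
  u.norm_coe_le_norm _

variable [NormedSpace ℂ G] [CompleteSpace G]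

theorem hasDerivAt_integral_extendTime (u : C(TimeIcc, G)) (t : ℝ) :
    HasDerivAt (fun t => ∫ s in (0 : ℝ)..t, extendTime u s) (extendTime u t) t :=
  intervalIntegral.integral_hasDerivAt_right ((continuous_extendTime u).intervalIntegrable _ _)
    ((continuous_extendTime u).stronglyMeasurableAtFilter _ _) (continuous_extendTime u).continuousAt

theorem abs_le_seven (t : TimeIcc) : |(t : ℝ)| ≤ 7 :=
  abs_le.2 ⟨by linarith [t.2.1], t.2.2⟩

/-- The primitive vanishing at time `0`. -/
def primitive : C(TimeIcc, G) →L[ℂ] C(TimeIcc, G) :=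
  LinearMap.mkContinuous
    { toFun := fun u => ⟨fun t => ∫ s in (0 : ℝ)..t, extendTime u s,
        (continuous_iff_continuousAt.2 fun t =>
          (hasDerivAt_integral_extendTime u t).continuousAt).comp continuous_subtype_val⟩
      map_add' := fun u v => by
        ext t
        exact intervalIntegral.integral_add ((continuous_extendTime u).intervalIntegrable _ _)
          ((continuous_extendTime v).intervalIntegrable _ _)
      map_smul' := fun c u => by
        ext t
        exact intervalIntegral.integral_smul c (extendTime u) } 7 fun u => by
    refine (ContinuousMap.norm_le _ (by positivity)).2 fun t => ?_
    refine (intervalIntegral.norm_integral_le_of_norm_le_const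
      (fun s _ => norm_extendTime_le u s)).trans ?_
    rw [sub_zero, mul_comm]
    exact mul_le_mul_of_nonneg_right (abs_le_seven t) (norm_nonneg _)

theorem primitive_apply (u : C(TimeIcc, G)) (t : TimeIcc) :
    primitive u t = ∫ s in (0 : ℝ)..t, extendTime u s := rfl

theorem primitive_timeZero (u : C(TimeIcc, G)) : primitive u timeZero = 0 := by
  rw [primitive_apply]; exact intervalIntegral.integral_same

/-- The derivative of a solution of the integral equation. -/
theorem hasDerivAt_extendTime_of_eq_primitive {u w : C(TimeIcc, G)} {v : G}
    (h : u = ContinuousMap.const _ v + primitive w) {t : ℝ} (ht : t ∈ Set.Ioo (-1 : ℝ) 7) :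
    HasDerivAt (extendTime u) (extendTime w t) t := by
  have h1 := (hasDerivAt_integral_extendTime w t).const_add v
  refine h1.congr_of_eventuallyEq ?_
  filter_upwards [Ioo_mem_nhds ht.1 ht.2] with s hs
  rw [extendTime_of_mem u (Set.Ioo_subset_Icc_self hs), h]
  rfl

/-- Pointwise application of a continuous linear map. -/
abbrev pointwise {H : Type*} [NormedAddCommGroup H] [NormedSpace ℂ H] (L : G →L[ℂ] H) :
    C(TimeIcc, G) →L[ℂ] C(TimeIcc, H) := L.compLeftContinuous ℂ TimeIcc

/-- Each integration turns `|s| ^ n` into `|t| ^ (n + 1) / (n + 1)`. The power of `|t|` has to be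
kept through the induction, since it produces the factorial. -/
theorem norm_volterra_pow_apply_le (L : G →L[ℂ] G) (u : C(TimeIcc, G)) (n : ℕ) (t : TimeIcc) :
    ‖((primitive ∘L pointwise L) ^ n) u t‖ ≤ ‖L‖ ^ n * |(t : ℝ)| ^ n / n.factorial * ‖u‖ := by
  induction n generalizing t with
  | zero => simpa using u.norm_coe_le_norm t
  | succ n ih =>
    rw [pow_succ']
    set w := ((primitive ∘L pointwise L) ^ n) u with hw
    change ‖∫ s in (0 : ℝ)..t, extendTime (pointwise L w) s‖ ≤ _
    have hb : ∀ s ∈ Set.uIoc (0 : ℝ) t, ‖extendTime (pointwise L w) s‖ ≤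
        ‖L‖ ^ (n + 1) / n.factorial * ‖u‖ * |s| ^ n := by
      intro s hs
      have hs' : s ∈ TimeIcc := by
        have h1 := Set.uIoc_subset_uIcc hs
        exact Set.uIcc_subset_Icc timeZero.2 t.2 h1
      rw [extendTime_of_mem _ hs']
      calc ‖L (w ⟨s, hs'⟩)‖ ≤ ‖L‖ * ‖w ⟨s, hs'⟩‖ := L.le_opNorm _
        _ ≤ ‖L‖ * (‖L‖ ^ n * |s| ^ n / n.factorial * ‖u‖) := by gcongr; exact ih ⟨s, hs'⟩
        _ = _ := by ring
    have hint : |∫ s in (0 : ℝ)..t, |s| ^ n| = |(t : ℝ)| ^ (n + 1) / (n + 1) := by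
      rcases le_total 0 (t : ℝ) with h0 | h0
      · have : ∫ s in (0 : ℝ)..t, |s| ^ n = ∫ s in (0 : ℝ)..t, s ^ n := by
          refine intervalIntegral.integral_congr fun s hs => ?_
          rw [Set.uIcc_of_le h0] at hs
          simp [abs_of_nonneg hs.1]
        rw [this, integral_pow, abs_of_nonneg h0, zero_pow (by omega), sub_zero,
          abs_of_nonneg (by positivity)]
      · have : ∫ s in (0 : ℝ)..t, |s| ^ n = ∫ s in (0 : ℝ)..t, (-1) ^ n * s ^ n := by
          refine intervalIntegral.integral_congr fun s hs => ?_
          rw [Set.uIcc_of_ge h0] at hs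
          simp only [abs_of_nonpos hs.2]
          rw [neg_pow]
        rw [this, intervalIntegral.integral_const_mul, integral_pow, zero_pow (by omega), sub_zero,
          abs_mul, abs_div, abs_pow, abs_pow]
        simp
        rw [abs_of_nonneg (by positivity : (0 : ℝ) ≤ n + 1)]
    calc _ ≤ |∫ s in (0 : ℝ)..t, ‖L‖ ^ (n + 1) / n.factorial * ‖u‖ * |s| ^ n| :=
          intervalIntegral.norm_integral_le_abs_of_norm_le
            ((MeasureTheory.ae_restrict_mem measurableSet_uIoc).mono hb)
            (Continuous.intervalIntegrable (by fun_prop) _ _)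
      _ = ‖L‖ ^ (n + 1) / n.factorial * ‖u‖ * (|(t : ℝ)| ^ (n + 1) / (n + 1)) := by
          rw [intervalIntegral.integral_const_mul, abs_mul, hint, abs_of_nonneg (by positivity)]
      _ = _ := by
          rw [Nat.factorial_succ]
          push_cast
          field_simp

/-- The element `1 - x ^ n` is a unit by the Neumann series, and `1 - x` is one of two commuting
factors of it. This allows an operator of large norm whose powers eventually become small. -/
theorem isUnit_one_sub_of_norm_pow_lt_one {R : Type*} [NormedRing R] [HasSummableGeomSeries R]
    {x : R} {n : ℕ} (h : ‖x ^ n‖ < 1) : IsUnit (1 - x) := by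
  have h1 := isUnit_one_sub_of_norm_lt_one h
  have hc : Commute (1 - x) (∑ i ∈ Finset.range n, x ^ i) :=
    Commute.sum_right _ _ _ fun i _ => ((Commute.one_left _).sub_left (Commute.self_pow x i))
  rw [← mul_neg_geom_sum, hc.isUnit_mul_iff] at h1
  exact h1.1

/-- Linear Volterra equations with constant coefficients are uniquely solvable. -/
theorem isUnit_one_sub_volterra (L : G →L[ℂ] G) :
    IsUnit (1 - primitive ∘L pointwise L : C(TimeIcc, G) →L[ℂ] C(TimeIcc, G)) := by
  have h := FloorSemiring.tendsto_pow_div_factorial_atTop (‖L‖ * 7)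
  obtain ⟨n, hn⟩ := (h.eventually (gt_mem_nhds one_pos)).exists
  refine isUnit_one_sub_of_norm_pow_lt_one (R := C(TimeIcc, G) →L[ℂ] C(TimeIcc, G)) (n := n)
    (lt_of_le_of_lt ?_ hn)
  refine ContinuousLinearMap.opNorm_le_bound _ (by positivity) fun u => ?_
  refine (ContinuousMap.norm_le _ (by positivity)).2 fun t => ?_
  refine (norm_volterra_pow_apply_le L u n t).trans ?_
  rw [mul_pow]
  gcongr
  exact abs_le_seven t

end Primitive

/-! ### Analytic superposition operators on spaces of curves -/

/-- The superposition operator of `(1 - z) ^ (-1/2)` is analytic at `0`. -/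
theorem exists_invSqrtOneSub :
    ∃ W : C(TimeIcc, ℂ) → C(TimeIcc, ℂ), ContDiffAt ℂ ω W 0 ∧ W 0 = 1 ∧
      HasFDerivAt W ((1 / 2 : ℂ) • ContinuousLinearMap.id ℂ C(TimeIcc, ℂ)) 0 ∧
      ∀ᶠ u in 𝓝 0, ∀ t, W u t = (1 - u t) ^ (-1 / 2 : ℂ) := by
  -- The root is defined implicitly by `w² (1 - u) = 1` in the Banach algebra. At `(0, 1)` the
  -- partial derivative in `w` is multiplication by `2`, hence invertible.
  let f : C(TimeIcc, ℂ) × C(TimeIcc, ℂ) → C(TimeIcc, ℂ) := fun x => x.2 * x.2 * (1 - x.1)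
  have cdf : ContDiffAt ℂ ω f (0, 1) := by fun_prop
  let f' : C(TimeIcc, ℂ) × C(TimeIcc, ℂ) →L[ℂ] C(TimeIcc, ℂ) :=
    (2 : ℂ) • ContinuousLinearMap.snd ℂ _ _ - ContinuousLinearMap.fst ℂ _ _
  have hf' : HasFDerivAt f f' (0, 1) := by
    have h2 : HasFDerivAt (fun x : C(TimeIcc, ℂ) × C(TimeIcc, ℂ) => x.2)
      (ContinuousLinearMap.snd ℂ _ _) (0, 1) := hasFDerivAt_snd
    have h1 : HasFDerivAt (fun x : C(TimeIcc, ℂ) × C(TimeIcc, ℂ) => 1 - x.1)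
      (-ContinuousLinearMap.fst ℂ C(TimeIcc, ℂ) C(TimeIcc, ℂ)) (0, 1) := hasFDerivAt_fst.const_sub 1
    refine ((h2.mul h2).mul h1).congr_fderiv ?_
    refine ContinuousLinearMap.ext fun x => ?_
    ext t
    change 1 * 1 * -x.1 t + (1 - 0) * (1 * x.2 t + 1 * x.2 t) = 2 * x.2 t - x.1 t
    ring
  have hinr : f' ∘L .inr ℂ C(TimeIcc, ℂ) C(TimeIcc, ℂ) =
      (2 : ℂ) • ContinuousLinearMap.id ℂ C(TimeIcc, ℂ) := by
    refine ContinuousLinearMap.ext fun x => ?_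
    change (2 : ℂ) • x - 0 = (2 : ℂ) • x
    rw [sub_zero]
  have hinv : (fderiv ℂ f (0, 1) ∘L .inr ℂ C(TimeIcc, ℂ) C(TimeIcc, ℂ)).IsInvertible := by
    rw [hf'.fderiv, hinr]
    refine ContinuousLinearMap.IsInvertible.of_inverse
      (g := (1 / 2 : ℂ) • ContinuousLinearMap.id ℂ C(TimeIcc, ℂ)) ?_ ?_ <;>
    · refine ContinuousLinearMap.ext fun x => ?_
      simp only [ContinuousLinearMap.comp_apply, smul_apply,
        ContinuousLinearMap.id_apply, smul_smul]
      norm_num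
  let W := cdf.implicitFunction (by simp) hinv
  have hW : ContDiffAt ℂ ω W 0 := cdf.contDiffAt_implicitFunction (by simp) hinv
  have hW0 : W 0 = 1 := cdf.implicitFunction_apply_self (by simp) hinv
  have hWe : ∀ᶠ u in 𝓝 0, f (u, W u) = f (0, 1) :=
    cdf.eventually_apply_implicitFunction (by simp) hinv
  refine ⟨W, hW, hW0, ?_, ?_⟩
  -- Differentiating the identity `f (u, W u) = f (0, 1)` at `0` gives `2 W'(0) x = x`.
  · have hd : HasFDerivAt W (fderiv ℂ W 0) 0 := (hW.differentiableAt (by simp)).hasFDerivAt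
    refine hd.congr_fderiv ?_
    have h0 : HasFDerivAt (fun u => (u, W u)) ((ContinuousLinearMap.id ℂ _).prod (fderiv ℂ W 0)) 0 :=
      (hasFDerivAt_id _).prodMk hd
    have h1 : HasFDerivAt (fun u => f (u, W u))
        (f' ∘L ((ContinuousLinearMap.id ℂ _).prod (fderiv ℂ W 0))) 0 := by
      have hf0 : HasFDerivAt f f' ((fun u => (u, W u)) 0) := by simpa only [hW0] using hf'
      exact hf0.comp 0 h0
    have h2 : HasFDerivAt (fun u => f (u, W u)) (0 : C(TimeIcc, ℂ) →L[ℂ] C(TimeIcc, ℂ)) 0 :=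
      (hasFDerivAt_const (f (0, 1)) _).congr_of_eventuallyEq hWe
    have h3 := h1.unique h2
    refine ContinuousLinearMap.ext fun x => ?_
    have h4 := DFunLike.congr_fun h3 x
    simp only [f', ContinuousLinearMap.comp_apply, ContinuousLinearMap.prod_apply,
      sub_apply, smul_apply, ContinuousLinearMap.coe_snd',
      ContinuousLinearMap.coe_fst', ContinuousLinearMap.id_apply, zero_apply,
      sub_eq_zero] at h4 ⊢
    calc _ = (1 / 2 : ℂ) • (2 : ℂ) • (fderiv ℂ W 0) x := by rw [smul_smul]; norm_num
      _ = _ := by rw [h4]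
  · have hc : ContinuousAt (fun z : ℂ => (1 - z) ^ (-1 / 2 : ℂ)) 0 := by
      refine ContinuousAt.cpow (by fun_prop) (by fun_prop) ?_
      simp
    have hc1 : ∀ᶠ z : ℂ in 𝓝 0, ‖(1 - z) ^ (-1 / 2 : ℂ) - 1‖ < 1 := by
      have := hc.eventually (Metric.ball_mem_nhds _ one_pos)
      simpa [dist_eq_norm] using this
    obtain ⟨ε, hε, hball⟩ := Metric.eventually_nhds_iff.1 hc1
    have hW1 : ∀ᶠ u in 𝓝 0, ‖W u - 1‖ < 1 := by
      have := hW.continuousAt.eventually (Metric.ball_mem_nhds _ one_pos)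
      simpa [dist_eq_norm, hW0] using this
    have hu : ∀ᶠ u : C(TimeIcc, ℂ) in 𝓝 0, ‖u‖ < min ε 1 := by
      have := Metric.ball_mem_nhds (0 : C(TimeIcc, ℂ)) (lt_min hε one_pos)
      filter_upwards [this] with u hu
      simpa using hu
    filter_upwards [hWe, hW1, hu] with u h1 h2 h3 t
    have hut : ‖u t‖ < min ε 1 := lt_of_le_of_lt (u.norm_coe_le_norm t) h3
    have ha : ‖(1 - u t) ^ (-1 / 2 : ℂ) - 1‖ < 1 :=
      hball (by simpa using lt_of_lt_of_le hut (min_le_left _ _))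
    have hb : ‖W u t - 1‖ < 1 := lt_of_le_of_lt ((W u - 1).norm_coe_le_norm t) h2
    have hne : (1 : ℂ) - u t ≠ 0 := by
      intro h
      have : u t = 1 := (sub_eq_zero.1 h).symm
      have h5 := lt_of_lt_of_le hut (min_le_right _ _)
      rw [this] at h5
      simp at h5
    have hd : W u t * W u t * (1 - u t) = 1 := by
      have := DFunLike.congr_fun h1 t
      simpa [f] using this
    have he : (1 - u t) ^ (-1 / 2 : ℂ) * (1 - u t) ^ (-1 / 2 : ℂ) * (1 - u t) = 1 := by
      rw [← Complex.cpow_add _ _ hne]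
      norm_num
      rw [Complex.cpow_neg_one, inv_mul_cancel₀ hne]
    -- The implicit root and the principal power have the same square, so they agree up to sign.
    -- Both lie within distance `1` of `1`, so they cannot be opposite.
    have hfac : (W u t - (1 - u t) ^ (-1 / 2 : ℂ)) * (W u t + (1 - u t) ^ (-1 / 2 : ℂ)) = 0 := by
      apply mul_right_cancel₀ hne
      linear_combination hd - he
    rcases mul_eq_zero.1 hfac with h | h
    · exact sub_eq_zero.1 h
    · exfalso
      have h6 : ‖(W u t - 1) + ((1 - u t) ^ (-1 / 2 : ℂ) - 1)‖ < 2 :=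
        (norm_add_le _ _).trans_lt (by linarith)
      have h7 : (W u t - 1) + ((1 - u t) ^ (-1 / 2 : ℂ) - 1) = -2 := by linear_combination h
      rw [h7] at h6
      simp at h6

/-- The state `(p, q, p', q')`. -/
abbrev State : Type := ℂ × ℂ × ℂ × ℂ

/-- Continuous functions on the time interval. -/
abbrev TimeFun : Type := C(TimeIcc, ℂ)

/-- Continuous curves of states on the time interval. -/
abbrev TimeCurve : Type := C(TimeIcc, State)

theorem remQ_eq_remP (p q : ℂ) : remQ p q = remP q p := by
  simp only [remQ, remP]; ring

/-- The linear part of the complex system at `lam = 0`, as a first order system. -/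
def linField (m : ℝ) : State →L[ℂ] State :=
  LinearMap.toContinuousLinearMap
    { toFun := fun u => (u.2.2.1, u.2.2.2,
        -2 * (1 + m) * Complex.I * u.2.2.1 + 3 / 2 * hillL m * (u.1 + u.2.1),
        2 * (1 + m) * Complex.I * u.2.2.2 + 3 / 2 * hillL m * (u.1 + u.2.1))
      map_add' := fun u v => by
        simp only [Prod.fst_add, Prod.snd_add, Prod.mk_add_mk, Prod.mk.injEq, true_and]
        constructor <;> ring
      map_smul' := fun c u => by
        simp only [Prod.smul_fst, Prod.smul_snd, smul_eq_mul, RingHom.id_apply, Prod.smul_mk,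
          Prod.mk.injEq, true_and]
        constructor <;> ring }

theorem linField_apply (m : ℝ) (u : State) : linField m u = (u.2.2.1, u.2.2.2,
    -2 * (1 + m) * Complex.I * u.2.2.1 + 3 / 2 * hillL m * (u.1 + u.2.1),
    2 * (1 + m) * Complex.I * u.2.2.2 + 3 / 2 * hillL m * (u.1 + u.2.1)) := rfl

/-- The complex system as a first order system. -/
def hillField (m : ℝ) (lam : ℂ) (t : ℝ) (u : State) : State :=
  linField m u +
    (0, 0, 3 / 2 * lam * (u.2.1 - 1) * Complex.exp (-2 * Complex.I * t) + hillL m * remP u.1 u.2.1,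
      3 / 2 * lam * (u.1 - 1) * Complex.exp (2 * Complex.I * t) + hillL m * remQ u.1 u.2.1)

/-- A superposition operator for `remP` that is analytic at `0`. -/
theorem exists_remP_superposition :
    ∃ R : TimeFun × TimeFun → TimeFun, ContDiffAt ℂ ω R 0 ∧ R 0 = 0 ∧
      HasFDerivAt R (0 : TimeFun × TimeFun →L[ℂ] TimeFun) 0 ∧
      ∀ᶠ x in 𝓝 0, ∀ t, R x t = remP (x.1 t) (x.2 t) := by
  obtain ⟨W, hW, hW0, hWd, hWe⟩ := exists_invSqrtOneSub
  -- The power `-3/2` is the cube of the power `-1/2`. The subtracted linear terms are exactly the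
  -- first order part of the product, so the derivative at `0` vanishes.
  refine ⟨fun x => W x.1 * (W x.2 * W x.2 * W x.2) - 1 - (1 / 2 : ℂ) • x.1 - (3 / 2 : ℂ) • x.2,
    ?_, ?_, ?_, ?_⟩
  · have h1 : ContDiffAt ℂ ω (fun x : TimeFun × TimeFun => W x.1) 0 :=
      ContDiffAt.comp (0 : TimeFun × TimeFun) (g := W) (f := Prod.fst) hW contDiffAt_fst
    have h2 : ContDiffAt ℂ ω (fun x : TimeFun × TimeFun => W x.2) 0 :=
      ContDiffAt.comp (0 : TimeFun × TimeFun) (g := W) (f := Prod.snd) hW contDiffAt_snd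
    fun_prop
  · ext t
    simp [hW0]
  · have h1 : HasFDerivAt (fun x : TimeFun × TimeFun => W x.1) _ 0 :=
      HasFDerivAt.comp (0 : TimeFun × TimeFun) (g := W) (f := Prod.fst) hWd hasFDerivAt_fst
    have h2 : HasFDerivAt (fun x : TimeFun × TimeFun => W x.2) _ 0 :=
      HasFDerivAt.comp (0 : TimeFun × TimeFun) (g := W) (f := Prod.snd) hWd hasFDerivAt_snd
    have h3 : HasFDerivAt (fun x : TimeFun × TimeFun => x.1) (ContinuousLinearMap.fst ℂ TimeFun TimeFun) 0 := hasFDerivAt_fst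
    have h4 : HasFDerivAt (fun x : TimeFun × TimeFun => x.2) (ContinuousLinearMap.snd ℂ TimeFun TimeFun) 0 := hasFDerivAt_snd
    refine ((((h1.mul ((h2.mul h2).mul h2)).sub_const 1).sub (h3.const_smul (1 / 2 : ℂ))).sub
      (h4.const_smul (3 / 2 : ℂ))).congr_fderiv ?_
    refine ContinuousLinearMap.ext fun x => ?_
    ext t
    have e : W 0 t = 1 := by rw [hW0]; rfl
    change W 0 t * (W 0 t * W 0 t * (1 / 2 * x.2 t)
      + W 0 t * (W 0 t * (1 / 2 * x.2 t) + W 0 t * (1 / 2 * x.2 t)))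
      + W 0 t * W 0 t * W 0 t * (1 / 2 * x.1 t) - 1 / 2 * x.1 t - 3 / 2 * x.2 t = 0
    rw [e]
    ring
  · have h1 : ∀ᶠ x : TimeFun × TimeFun in 𝓝 0, ∀ t, W x.1 t = (1 - x.1 t) ^ (-1 / 2 : ℂ) :=
      continuous_fst.tendsto (0 : TimeFun × TimeFun) |>.eventually hWe
    have h2 : ∀ᶠ x : TimeFun × TimeFun in 𝓝 0, ∀ t, W x.2 t = (1 - x.2 t) ^ (-1 / 2 : ℂ) :=
      continuous_snd.tendsto (0 : TimeFun × TimeFun) |>.eventually hWe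
    filter_upwards [h1, h2] with x h1 h2 t
    have h3 : (1 - x.2 t) ^ (-3 / 2 : ℂ) = W x.2 t * W x.2 t * W x.2 t := by
      rw [h2, show (-3 / 2 : ℂ) = (3 : ℕ) * (-1 / 2 : ℂ) by norm_num, Complex.cpow_nat_mul]
      ring
    simp only [remP]
    rw [h3, ← h1]
    rfl

/-- The exponential `e ^ (a t)` as a function on the time interval. -/
def expTime (a : ℂ) : TimeFun := ⟨fun t => Complex.exp (a * (t : ℝ)), by fun_prop⟩

/-- A superposition operator for `hillField` that is analytic at `0`. -/
theorem exists_hillField_superposition (m : ℝ) :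
    ∃ (N : TimeCurve × ℂ → TimeCurve) (b : TimeCurve),
      ContDiffAt ℂ ω N 0 ∧ N 0 = 0 ∧
      HasFDerivAt N ((pointwise (linField m)) ∘L ContinuousLinearMap.fst ℂ _ _ +
        (ContinuousLinearMap.snd ℂ _ _).smulRight b) 0 ∧
      ∀ᶠ x in 𝓝 0, ∀ t : TimeIcc, N x t = hillField m x.2 t (x.1 t) := by
  obtain ⟨R, hR, hR0, hRd, hRe⟩ := exists_remP_superposition
  let Pr : TimeCurve →L[ℂ] TimeFun := pointwise (ContinuousLinearMap.fst ℂ ℂ (ℂ × ℂ × ℂ))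
  let Qr : TimeCurve →L[ℂ] TimeFun := pointwise
    ((ContinuousLinearMap.fst ℂ ℂ (ℂ × ℂ)) ∘L (ContinuousLinearMap.snd ℂ ℂ (ℂ × ℂ × ℂ)))
  let i3 : TimeFun →L[ℂ] TimeCurve := pointwise ((ContinuousLinearMap.inr ℂ ℂ (ℂ × ℂ × ℂ)) ∘L
    (ContinuousLinearMap.inr ℂ ℂ (ℂ × ℂ)) ∘L (ContinuousLinearMap.inl ℂ ℂ ℂ))
  let i4 : TimeFun →L[ℂ] TimeCurve := pointwise ((ContinuousLinearMap.inr ℂ ℂ (ℂ × ℂ × ℂ)) ∘L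
    (ContinuousLinearMap.inr ℂ ℂ (ℂ × ℂ)) ∘L (ContinuousLinearMap.inr ℂ ℂ ℂ))
  let T3 : TimeCurve × ℂ → TimeFun := fun x => (3 / 2 * x.2) • ((Qr x.1 - 1) * expTime (-2 * Complex.I)) +
    (hillL m : ℂ) • R (Pr x.1, Qr x.1)
  let T4 : TimeCurve × ℂ → TimeFun := fun x => (3 / 2 * x.2) • ((Pr x.1 - 1) * expTime (2 * Complex.I)) +
    (hillL m : ℂ) • R (Qr x.1, Pr x.1)
  -- The nonlinear parts of the two second order equations differ only by exchanging `p` and `q` and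
  -- by the exponential. To first order only `-(3/2) lam e` survives, because `lam q` and the
  -- remainder are of second order.
  have key : ∀ S1 S2 : TimeCurve →L[ℂ] TimeFun, ∀ e : TimeFun,
      let T : TimeCurve × ℂ → TimeFun := fun x => (3 / 2 * x.2) • ((S2 x.1 - 1) * e) +
        (hillL m : ℂ) • R (S1 x.1, S2 x.1)
      ContDiffAt ℂ ω T 0 ∧
      HasFDerivAt T ((ContinuousLinearMap.snd ℂ TimeCurve ℂ).smulRight (-(3 / 2 : ℂ) • e)) 0 := by
    intro S1 S2 e T
    have hz : ((S1 (0 : TimeCurve × ℂ).1, S2 (0 : TimeCurve × ℂ).1) : TimeFun × TimeFun) = 0 := by simp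
    have hS : HasFDerivAt (fun x : TimeCurve × ℂ => (S1 x.1, S2 x.1))
        ((S1.prod S2) ∘L ContinuousLinearMap.fst ℂ TimeCurve ℂ) 0 :=
      ((S1.prod S2) ∘L ContinuousLinearMap.fst ℂ TimeCurve ℂ).hasFDerivAt
    constructor
    · have h1 : ContDiffAt ℂ ω (fun x : TimeCurve × ℂ => R (S1 x.1, S2 x.1)) 0 := by
        refine ContDiffAt.comp (0 : TimeCurve × ℂ) (g := R) (f := fun x : TimeCurve × ℂ => (S1 x.1, S2 x.1)) ?_ ?_
        · rw [hz]; exact hR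
        · fun_prop
      have h2 : ContDiffAt ℂ ω (fun x : TimeCurve × ℂ => 3 / 2 * x.2) 0 := by fun_prop
      have h3 : ContDiffAt ℂ ω (fun x : TimeCurve × ℂ => (S2 x.1 - 1) * e) 0 := by fun_prop
      exact (h2.smul h3).add (h1.const_smul (hillL m : ℂ))
    · have h1 : HasFDerivAt (fun x : TimeCurve × ℂ => R (S1 x.1, S2 x.1)) (0 : TimeCurve × ℂ →L[ℂ] TimeFun) 0 := by
        have h2 : HasFDerivAt R (0 : TimeFun × TimeFun →L[ℂ] TimeFun)
            ((fun x : TimeCurve × ℂ => (S1 x.1, S2 x.1)) 0) := by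
          simp only [hz]; exact hRd
        refine (HasFDerivAt.comp (0 : TimeCurve × ℂ) h2 hS).congr_fderiv ?_
        exact ContinuousLinearMap.zero_comp _
      have h3 : HasFDerivAt (fun x : TimeCurve × ℂ => 3 / 2 * x.2)
          ((3 / 2 : ℂ) • ContinuousLinearMap.snd ℂ TimeCurve ℂ) 0 := by
        exact ((3 / 2 : ℂ) • ContinuousLinearMap.snd ℂ TimeCurve ℂ).hasFDerivAt
      have h4 : HasFDerivAt (fun x : TimeCurve × ℂ => (S2 x.1 - 1) * e)
          (((ContinuousLinearMap.mul ℂ TimeFun).flip e) ∘L S2 ∘L ContinuousLinearMap.fst ℂ TimeCurve ℂ) 0 := by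
        have h5 : HasFDerivAt (fun x : TimeCurve × ℂ => S2 x.1 - 1)
            (S2 ∘L ContinuousLinearMap.fst ℂ TimeCurve ℂ) 0 :=
          (S2 ∘L ContinuousLinearMap.fst ℂ TimeCurve ℂ).hasFDerivAt.sub_const 1
        exact ((ContinuousLinearMap.mul ℂ TimeFun).flip e).hasFDerivAt.comp (0 : TimeCurve × ℂ) h5
      refine ((h3.smul h4).add (h1.const_smul (hillL m : ℂ))).congr_fderiv ?_
      refine ContinuousLinearMap.ext fun x => ?_
      ext t
      have e1 : S2 (0 : TimeCurve × ℂ).1 t = 0 := by rw [Prod.fst_zero, map_zero]; rfl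
      change (3 / 2 * (0 : ℂ)) * (S2 x.1 t * e t) +
        (3 / 2 * x.2) * ((S2 (0 : TimeCurve × ℂ).1 t - 1) * e t) + hillL m * 0 = x.2 * (-(3 / 2) * e t)
      rw [e1]
      ring
  obtain ⟨h3c, h3d⟩ := key Pr Qr (expTime (-2 * Complex.I))
  obtain ⟨h4c, h4d⟩ := key Qr Pr (expTime (2 * Complex.I))
  have hl : HasFDerivAt (fun x : TimeCurve × ℂ => pointwise (linField m) x.1)
      ((pointwise (linField m)) ∘L ContinuousLinearMap.fst ℂ TimeCurve ℂ) 0 :=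
    ((pointwise (linField m)) ∘L ContinuousLinearMap.fst ℂ TimeCurve ℂ).hasFDerivAt
  refine ⟨fun x => pointwise (linField m) x.1 + (i3 (T3 x) + i4 (T4 x)),
    i3 (-(3 / 2 : ℂ) • expTime (-2 * Complex.I)) + i4 (-(3 / 2 : ℂ) • expTime (2 * Complex.I)),
    ?_, ?_, ?_, ?_⟩
  · have e3 : ContDiffAt ℂ ω (fun x => i3 (T3 x)) 0 := i3.contDiff.contDiffAt.comp 0 h3c
    have e4 : ContDiffAt ℂ ω (fun x => i4 (T4 x)) 0 := i4.contDiff.contDiffAt.comp 0 h4c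
    fun_prop
  · have h1 : T3 0 = 0 := by
      simp only [T3, Prod.fst_zero, Prod.snd_zero, map_zero, Prod.mk_zero_zero, hR0]
      ext t
      simp
    have h2 : T4 0 = 0 := by
      simp only [T4, Prod.fst_zero, Prod.snd_zero, map_zero, Prod.mk_zero_zero, hR0]
      ext t
      simp
    simp only [h1, h2, map_zero, Prod.fst_zero, add_zero]
  · refine (hl.add ((i3.hasFDerivAt.comp (0 : TimeCurve × ℂ) h3d).add
      (i4.hasFDerivAt.comp (0 : TimeCurve × ℂ) h4d))).congr_fderiv ?_
    refine ContinuousLinearMap.ext fun x => ?_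
    simp only [ContinuousLinearMap.comp_apply, add_apply, ContinuousLinearMap.smulRight_apply,
      map_smul, smul_add]
  · have h1 : ∀ᶠ x : TimeCurve × ℂ in 𝓝 0, ∀ t, R (Pr x.1, Qr x.1) t = remP (Pr x.1 t) (Qr x.1 t) := by
      have hc : ContinuousAt (fun x : TimeCurve × ℂ => (Pr x.1, Qr x.1)) 0 := by fun_prop
      have hz : ((Pr (0 : TimeCurve × ℂ).1, Qr (0 : TimeCurve × ℂ).1) : TimeFun × TimeFun) = 0 := by simp
      rw [ContinuousAt, hz] at hc
      exact hc.eventually hRe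
    have h2 : ∀ᶠ x : TimeCurve × ℂ in 𝓝 0, ∀ t, R (Qr x.1, Pr x.1) t = remP (Qr x.1 t) (Pr x.1 t) := by
      have hc : ContinuousAt (fun x : TimeCurve × ℂ => (Qr x.1, Pr x.1)) 0 := by fun_prop
      have hz : ((Qr (0 : TimeCurve × ℂ).1, Pr (0 : TimeCurve × ℂ).1) : TimeFun × TimeFun) = 0 := by simp
      rw [ContinuousAt, hz] at hc
      exact hc.eventually hRe
    filter_upwards [h1, h2] with x h1 h2 t
    rw [hillField, remQ_eq_remP]
    change linField m (x.1 t) + ((0, 0, T3 x t, 0) + (0, 0, 0, T4 x t)) = _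
    congr 1
    have h3 : T3 x t = 3 / 2 * x.2 * (((x.1 t).2.1 - 1) * Complex.exp (-2 * Complex.I * (t : ℝ))) +
      hillL m * R (Pr x.1, Qr x.1) t := rfl
    have h4 : T4 x t = 3 / 2 * x.2 * (((x.1 t).1 - 1) * Complex.exp (2 * Complex.I * (t : ℝ))) +
      hillL m * R (Qr x.1, Pr x.1) t := rfl
    rw [h3, h4, h1, h2]
    simp only [Prod.mk_add_mk, add_zero, zero_add, mul_assoc]
    rfl

/-! ### Analytic dependence of the flow on initial state and parameter -/

/-- The flow of the complex system depends analytically on the initial state and on `lam`, near the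
equilibrium; its derivative in the direction of an initial state solves the linear system. -/
theorem exists_analytic_flow (m : ℝ) :
    ∃ Fl : State × ℂ → TimeCurve, ContDiffAt ℂ ω Fl 0 ∧ Fl 0 = 0 ∧
      (∀ᶠ z in 𝓝 0, Fl z timeZero = z.1 ∧ ∀ t ∈ Set.Ioo (-1 : ℝ) 7,
        HasDerivAt (extendTime (Fl z)) (hillField m z.2 t (extendTime (Fl z) t)) t) ∧
      ∀ v : State, fderiv ℂ Fl 0 (v, 0) timeZero = v ∧ ∀ t ∈ Set.Ioo (-1 : ℝ) 7,
        HasDerivAt (extendTime (fderiv ℂ Fl 0 (v, 0)))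
          (linField m (extendTime (fderiv ℂ Fl 0 (v, 0)) t)) t := by
  obtain ⟨N, b, hN, hN0, hNd, hNe⟩ := exists_hillField_superposition m
  let cst : State →L[ℂ] TimeCurve := ContinuousLinearMap.const ℂ TimeIcc
  have hb : (0 : ℂ) • b = 0 := ContinuousMap.ext fun t => zero_smul ℂ (b t)
  let prim : TimeCurve →L[ℂ] TimeCurve := primitive
  let N' : TimeCurve × ℂ →L[ℂ] TimeCurve := (pointwise (linField m)) ∘L
    ContinuousLinearMap.fst ℂ _ _ + (ContinuousLinearMap.snd ℂ _ _).smulRight b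
  let sw : (State × ℂ) × TimeCurve →L[ℂ] TimeCurve × ℂ :=
    (ContinuousLinearMap.snd ℂ (State × ℂ) TimeCurve).prod
      ((ContinuousLinearMap.snd ℂ State ℂ) ∘L (ContinuousLinearMap.fst ℂ (State × ℂ) TimeCurve))
  let lin : (State × ℂ) × TimeCurve →L[ℂ] TimeCurve :=
    ContinuousLinearMap.snd ℂ (State × ℂ) TimeCurve -
      cst ∘L (ContinuousLinearMap.fst ℂ State ℂ) ∘L (ContinuousLinearMap.fst ℂ (State × ℂ) TimeCurve)
  -- The zeros of `f` are the solutions of the integral equation `u = v + ∫₀ᵗ N(u, lam)`. The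
  -- implicit function theorem solves it for the whole curve `u` at once.
  let f : (State × ℂ) × TimeCurve → TimeCurve := fun x => lin x - primitive (N (sw x))
  let f' : (State × ℂ) × TimeCurve →L[ℂ] TimeCurve := lin - primitive ∘L N' ∘L sw
  have cdf : ContDiffAt ℂ ω f 0 := by
    have h1 : ContDiffAt ℂ ω (fun x => N (sw x)) 0 :=
      ContDiffAt.comp 0 (g := N) (f := sw) (by simpa only [map_zero] using hN)
        sw.contDiff.contDiffAt
    exact lin.contDiff.contDiffAt.sub
      (ContDiffAt.comp 0 (g := prim) prim.contDiff.contDiffAt h1)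
  have hf' : HasFDerivAt f f' 0 := by
    have h1 : HasFDerivAt (fun x => N (sw x)) (N' ∘L sw) 0 :=
      HasFDerivAt.comp 0 (g := N) (f := sw) (by simpa only [map_zero] using hNd)
        sw.hasFDerivAt
    exact lin.hasFDerivAt.sub
      (HasFDerivAt.comp 0 (g := prim) prim.hasFDerivAt h1)
  have hinr : f' ∘L .inr ℂ (State × ℂ) TimeCurve = 1 - primitive ∘L pointwise (linField m) := by
    refine ContinuousLinearMap.ext fun u => ?_
    have h1 : sw (0, u) = (u, 0) := rfl
    have h2 : lin (0, u) = u := by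
      change u - cst 0 = u
      rw [map_zero, sub_zero]
    change lin (0, u) - primitive (N' (sw (0, u))) = u - primitive (pointwise (linField m) u)
    rw [h1, h2]
    change u - primitive (pointwise (linField m) u + (0 : ℂ) • b) = _
    rw [hb, add_zero]
  have hinv : (fderiv ℂ f 0 ∘L .inr ℂ (State × ℂ) TimeCurve).IsInvertible := by
    rw [hf'.fderiv, hinr]
    obtain ⟨e, he⟩ := isUnit_one_sub_volterra (linField m)
    refine ⟨ContinuousLinearEquiv.unitsEquiv ℂ TimeCurve e, ?_⟩
    rw [← he]
    rfl
  let Fl := cdf.implicitFunction (by simp) hinv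
  have hFl : ContDiffAt ℂ ω Fl 0 := cdf.contDiffAt_implicitFunction (by simp) hinv
  have hFl0 : Fl 0 = 0 := cdf.implicitFunction_apply_self (by simp) hinv
  have hf0 : f 0 = 0 := by simp only [f, map_zero, hN0, sub_zero]
  have hFle : ∀ᶠ z in 𝓝 0, f (z, Fl z) = 0 := by
    have := cdf.eventually_apply_implicitFunction (by simp) hinv
    rw [hf0] at this
    exact this
  have hfst : ∀ (u w : TimeCurve) (v : State), u = ContinuousMap.const _ v + primitive w →
      u timeZero = v := by
    intro u w v h
    rw [h, ContinuousMap.add_apply, primitive_timeZero, add_zero]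
    rfl
  refine ⟨Fl, hFl, hFl0, ?_, fun v => ?_⟩
  · have hc : ContinuousAt (fun z : State × ℂ => (Fl z, z.2)) 0 :=
      hFl.continuousAt.prodMk continuousAt_snd
    have hc' := hc.tendsto
    simp only [hFl0] at hc'
    have hNe' := hc'.eventually hNe
    filter_upwards [hFle, hNe'] with z h1 h2
    have h3 : Fl z = ContinuousMap.const _ z.1 + primitive (N (Fl z, z.2)) := by
      have h4 : Fl z - ContinuousMap.const _ z.1 - primitive (N (Fl z, z.2)) = 0 := h1
      rw [sub_sub, sub_eq_zero] at h4
      exact h4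
    refine ⟨hfst _ _ _ h3, fun t ht => ?_⟩
    have h5 := hasDerivAt_extendTime_of_eq_primitive h3 ht
    have ht' := Set.Ioo_subset_Icc_self ht
    rw [extendTime_of_mem _ ht', h2] at h5
    rw [extendTime_of_mem _ ht']
    exact h5
  -- Differentiating `f (z, Fl z) = 0` in the direction `(v, 0)` gives the linear integral equation
  -- with initial state `v`; the term in `b` drops out since `lam` is not varied.
  · have hd : HasFDerivAt Fl (fderiv ℂ Fl 0) 0 := (hFl.differentiableAt (by simp)).hasFDerivAt
    have h0 : HasFDerivAt (fun z => (z, Fl z)) ((ContinuousLinearMap.id ℂ _).prod (fderiv ℂ Fl 0)) 0 :=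
      (hasFDerivAt_id _).prodMk hd
    have h1 : HasFDerivAt (fun z => f (z, Fl z))
        (f' ∘L ((ContinuousLinearMap.id ℂ _).prod (fderiv ℂ Fl 0))) 0 := by
      have hf0 : HasFDerivAt f f' ((fun z => (z, Fl z)) 0) := by
        simp only [hFl0]; exact hf'
      exact hf0.comp 0 h0
    have h2 : HasFDerivAt (fun z => f (z, Fl z)) (0 : State × ℂ →L[ℂ] TimeCurve) 0 :=
      (hasFDerivAt_const (0 : TimeCurve) _).congr_of_eventuallyEq hFle
    have h3 := DFunLike.congr_fun (h1.unique h2) (v, 0)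
    set w := fderiv ℂ Fl 0 (v, 0) with hw
    have h4 : w - ContinuousMap.const _ v - primitive (pointwise (linField m) w + (0 : ℂ) • b) = 0 :=
      h3
    rw [hb, add_zero, sub_sub, sub_eq_zero] at h4
    refine ⟨hfst _ _ _ h4, fun t ht => ?_⟩
    have h5 := hasDerivAt_extendTime_of_eq_primitive h4 ht
    have ht' := Set.Ioo_subset_Icc_self ht
    rw [extendTime_of_mem _ ht'] at h5
    rw [extendTime_of_mem _ ht']
    exact h5

/-! ### The first order system and uniqueness of its solutions -/

/-- The states in which the complex system is defined. -/
def admissibleState : Set State := {u | ‖u.1‖ < 1 ∧ ‖u.2.1‖ < 1}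

/-- The curve of states of a pair of functions. -/
def hillState (p q : ℝ → ℂ) (t : ℝ) : State := (p t, q t, deriv p t, deriv q t)

theorem one_sub_ne_zero_of_norm_lt_one {z : ℂ} (h : ‖z‖ < 1) : 1 - z ≠ 0 := by
  intro h0
  rw [← sub_eq_zero.1 h0] at h
  simp at h

theorem one_sub_mem_slitPlane {z : ℂ} (h : ‖z‖ < 1) : 1 - z ∈ Complex.slitPlane := by
  refine Or.inl ?_
  have := (Complex.re_le_norm z).trans_lt h
  simp only [Complex.sub_re, Complex.one_re]
  linarith

theorem IsComplexSolOn.mem_admissibleState {m : ℝ} {lam : ℂ} {I : Set ℝ} {p q : ℝ → ℂ}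
    (h : IsComplexSolOn m lam I p q) {t : ℝ} (ht : t ∈ I) : hillState p q t ∈ admissibleState :=
  ⟨h.norm_p_lt t ht, h.norm_q_lt t ht⟩

theorem IsComplexSolOn.hasDerivAt_hillState {m : ℝ} {lam : ℂ} {I : Set ℝ} {p q : ℝ → ℂ}
    (h : IsComplexSolOn m lam I p q) {t : ℝ} (ht : t ∈ I) :
    HasDerivAt (hillState p q) (hillField m lam t (hillState p q t)) t := by
  have h1 := (h.diff_p t ht).hasDerivAt.prodMk ((h.diff_q t ht).hasDerivAt.prodMk
    ((h.diff_p' t ht).hasDerivAt.prodMk (h.diff_q' t ht).hasDerivAt))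
  have h2 : HasDerivAt (hillState p q) (deriv p t, deriv q t, deriv (deriv p) t, deriv (deriv q) t) t :=
    h1
  refine h2.congr_deriv ?_
  rw [hillField, linField_apply]
  simp only [hillState, Prod.mk_add_mk, add_zero, Prod.mk.injEq, true_and]
  constructor
  · linear_combination h.eq_p t ht
  · linear_combination h.eq_q t ht

/-- Openness of `I` is essential: the derivative of the first component agrees with the third
component in a neighbourhood of each time, so it can be differentiated again. -/
theorem isComplexSolOn_of_hasDerivAt {m : ℝ} {lam : ℂ} {I : Set ℝ} {U : ℝ → State} (hI : IsOpen I)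
    (hU : ∀ t ∈ I, HasDerivAt U (hillField m lam t (U t)) t) (hadm : ∀ t ∈ I, U t ∈ admissibleState) :
    IsComplexSolOn m lam I (fun t => (U t).1) (fun t => (U t).2.1) ∧
      ∀ t ∈ I, hillState (fun t => (U t).1) (fun t => (U t).2.1) t = U t := by
  have h1 : ∀ t ∈ I, HasDerivAt (fun t => (U t).1) (U t).2.2.1 t := fun t ht => by
    have := (ContinuousLinearMap.fst ℝ ℂ (ℂ × ℂ × ℂ)).hasFDerivAt.comp_hasDerivAt t (hU t ht)
    simpa [hillField, linField_apply, Function.comp_def] using this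
  have h2 : ∀ t ∈ I, HasDerivAt (fun t => (U t).2.1) (U t).2.2.2 t := fun t ht => by
    have := ((ContinuousLinearMap.fst ℝ ℂ (ℂ × ℂ)) ∘L
      (ContinuousLinearMap.snd ℝ ℂ (ℂ × ℂ × ℂ))).hasFDerivAt.comp_hasDerivAt t (hU t ht)
    simpa [hillField, linField_apply, Function.comp_def] using this
  have h3 : ∀ t ∈ I, deriv (fun t => (U t).1) =ᶠ[𝓝 t] fun t => (U t).2.2.1 := fun t ht => by
    filter_upwards [hI.mem_nhds ht] with s hs using (h1 s hs).deriv
  have h4 : ∀ t ∈ I, deriv (fun t => (U t).2.1) =ᶠ[𝓝 t] fun t => (U t).2.2.2 := fun t ht => by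
    filter_upwards [hI.mem_nhds ht] with s hs using (h2 s hs).deriv
  have h5 : ∀ t ∈ I, HasDerivAt (deriv (fun t => (U t).1)) (hillField m lam t (U t)).2.2.1 t :=
    fun t ht => by
    refine HasDerivAt.congr_of_eventuallyEq ?_ (h3 t ht)
    exact ((ContinuousLinearMap.fst ℝ ℂ ℂ) ∘L (ContinuousLinearMap.snd ℝ ℂ (ℂ × ℂ)) ∘L
      (ContinuousLinearMap.snd ℝ ℂ (ℂ × ℂ × ℂ))).hasFDerivAt.comp_hasDerivAt t (hU t ht)
  have h6 : ∀ t ∈ I, HasDerivAt (deriv (fun t => (U t).2.1)) (hillField m lam t (U t)).2.2.2 t :=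
    fun t ht => by
    refine HasDerivAt.congr_of_eventuallyEq ?_ (h4 t ht)
    exact ((ContinuousLinearMap.snd ℝ ℂ ℂ) ∘L (ContinuousLinearMap.snd ℝ ℂ (ℂ × ℂ)) ∘L
      (ContinuousLinearMap.snd ℝ ℂ (ℂ × ℂ × ℂ))).hasFDerivAt.comp_hasDerivAt t (hU t ht)
  refine ⟨⟨fun t ht => (hadm t ht).1, fun t ht => (hadm t ht).2,
    fun t ht => (h1 t ht).differentiableAt, fun t ht => (h2 t ht).differentiableAt,
    fun t ht => (h5 t ht).differentiableAt, fun t ht => (h6 t ht).differentiableAt,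
    fun t ht => ?_, fun t ht => ?_⟩, fun t ht => ?_⟩
  · rw [(h5 t ht).deriv, (h1 t ht).deriv]
    simp only [hillField, linField_apply, Prod.mk_add_mk]
    ring
  · rw [(h6 t ht).deriv, (h2 t ht).deriv]
    simp only [hillField, linField_apply, Prod.mk_add_mk]
    ring
  · rw [hillState, (h1 t ht).deriv, (h2 t ht).deriv]

/-- Supplies the local Lipschitz bounds for uniqueness. Since `1 - p` and `1 - q` lie in the slit
plane, the principal powers are analytic; scalars are then restricted to `ℝ` because time is real.
-/
theorem contDiffAt_hillField (m : ℝ) (lam : ℂ) {x : ℝ × State} (hx : x.2 ∈ admissibleState) :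
    ContDiffAt ℝ 1 (fun x : ℝ × State => hillField m lam x.1 x.2) x := by
  have hl : ContDiffAt ℝ 1 (fun x : ℝ × State => linField m x.2) x :=
    ((linField m).restrictScalars ℝ).contDiff.contDiffAt.comp x contDiffAt_snd
  have hpow : ∀ (f : ℝ × State → ℂ) (a : ℂ), ContDiffAt ℝ 1 f x → ‖f x‖ < 1 →
      ContDiffAt ℝ 1 (fun y => (1 - f y) ^ a) x := by
    intro f a hf h1
    have h2 : ContDiffAt ℂ 1 (fun z : ℂ => z ^ a) (1 - f x) := by
      have := (analyticAt_id (𝕜 := ℂ) (z := 1 - f x)).cpow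
        (analyticAt_const (v := a)) (one_sub_mem_slitPlane h1)
      exact this.contDiffAt
    exact ContDiffAt.comp x (h2.restrict_scalars ℝ) (contDiffAt_const.sub hf)
  have hp : ContDiffAt ℝ 1 (fun x : ℝ × State => x.2.1) x := by fun_prop
  have hq : ContDiffAt ℝ 1 (fun x : ℝ × State => x.2.2.1) x := by fun_prop
  have p1 := hpow _ (-1 / 2) hp hx.1
  have p3 := hpow _ (-3 / 2) hp hx.1
  have q1 := hpow _ (-1 / 2) hq hx.2
  have q3 := hpow _ (-3 / 2) hq hx.2
  have ht : ContDiffAt ℝ 1 (fun x : ℝ × State => (x.1 : ℂ)) x :=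
    Complex.ofRealCLM.contDiff.contDiffAt.comp x contDiffAt_fst
  have he : ∀ a : ℂ, ContDiffAt ℝ 1 (fun x : ℝ × State => Complex.exp (a * x.1)) x := fun a =>
    (contDiffAt_const.mul ht).cexp
  simp only [hillField, remP, remQ]
  refine hl.add (contDiffAt_const.prodMk (contDiffAt_const.prodMk (ContDiffAt.prodMk ?_ ?_)))
  · have := he (-2 * Complex.I)
    fun_prop
  · have := he (2 * Complex.I)
    fun_prop

/-- Two solutions of the first order system with the same initial state coincide. -/
theorem eqOn_of_hasDerivAt_hillField {m : ℝ} {lam : ℂ} {T : ℝ} {U V : ℝ → State}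
    (hU : ∀ t ∈ Set.Icc 0 T, HasDerivAt U (hillField m lam t (U t)) t)
    (hUa : ∀ t ∈ Set.Icc 0 T, U t ∈ admissibleState)
    (hV : ∀ t ∈ Set.Icc 0 T, HasDerivAt V (hillField m lam t (V t)) t)
    (hVa : ∀ t ∈ Set.Icc 0 T, V t ∈ admissibleState) (h0 : U 0 = V 0) :
    Set.EqOn U V (Set.Icc 0 T) := by
  have hUc : ContinuousOn U (Set.Icc 0 T) := fun t ht => (hU t ht).continuousAt.continuousWithinAt
  have hVc : ContinuousOn V (Set.Icc 0 T) := fun t ht => (hV t ht).continuousAt.continuousWithinAt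
  -- A Lipschitz constant is needed only along the two curves. Their graphs form a compact set, on
  -- which a locally Lipschitz field is Lipschitz, so no tube around the curves is required.
  let S : Set (ℝ × State) := (fun t => (t, U t)) '' Set.Icc 0 T ∪ (fun t => (t, V t)) '' Set.Icc 0 T
  have hS : IsCompact S := (isCompact_Icc.image_of_continuousOn (continuousOn_id.prodMk hUc)).union
    (isCompact_Icc.image_of_continuousOn (continuousOn_id.prodMk hVc))
  have hadm : ∀ x ∈ S, x.2 ∈ admissibleState := by
    rintro x (⟨t, ht, rfl⟩ | ⟨t, ht, rfl⟩)
    · exact hUa t ht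
    · exact hVa t ht
  have hloc : LocallyLipschitzOn S (fun x : ℝ × State => hillField m lam x.1 x.2) := by
    intro x hx
    obtain ⟨K, s, hs, hK⟩ := (contDiffAt_hillField m lam (hadm x hx)).exists_lipschitzOnWith
    exact ⟨K, s, mem_nhdsWithin_of_mem_nhds hs, hK⟩
  obtain ⟨K, hK⟩ := hloc.exists_lipschitzOnWith_of_compact hS
  refine ODE_solution_unique_of_mem_Icc_right (v := hillField m lam) (s := fun t => {u | (t, u) ∈ S})
    (K := K) (fun t _ => ?_) hUc (fun t ht => ?_) (fun t ht => ?_) hVc (fun t ht => ?_)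
    (fun t ht => ?_) h0
  · intro u hu v hv
    simpa [Prod.edist_eq] using hK hu hv
  · exact (hU t (Set.Ico_subset_Icc_self ht)).hasDerivWithinAt
  · exact Or.inl ⟨t, Set.Ico_subset_Icc_self ht, rfl⟩
  · exact (hV t (Set.Ico_subset_Icc_self ht)).hasDerivWithinAt
  · exact Or.inr ⟨t, Set.Ico_subset_Icc_self ht, rfl⟩

/-! ### The energy integral -/

/-- The energy as a function of the time and the state. -/
def stateEnergy (m : ℝ) (lam : ℂ) (t : ℝ) (u : State) : ℂ :=
  (u.2.2.1 - Complex.I * (1 - u.1)) * (u.2.2.2 + Complex.I * (1 - u.2.1))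
    - 3 / 2 * m ^ 2 * (1 - u.1) * (1 - u.2.1)
    - 2 * hillL m * ((1 - u.1) ^ (-1 / 2 : ℂ) * (1 - u.2.1) ^ (-1 / 2 : ℂ))
    - 3 / 4 * lam * ((1 - u.1) ^ 2 * Complex.exp (2 * Complex.I * t)
        + (1 - u.2.1) ^ 2 * Complex.exp (-2 * Complex.I * t))

theorem hillEnergy_eq_stateEnergy (m : ℝ) (lam : ℂ) (p q : ℝ → ℂ) (t : ℝ) :
    hillEnergy m lam p q t = stateEnergy m lam t (hillState p q t) := rfl

theorem hasDerivAt_hillEnergy {m : ℝ} {lam : ℂ} {I : Set ℝ} {p q : ℝ → ℂ}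
    (h : IsComplexSolOn m lam I p q) {t : ℝ} (ht : t ∈ I) : HasDerivAt (hillEnergy m lam p q) 0 t := by
  have hp := (h.diff_p t ht).hasDerivAt
  have hq := (h.diff_q t ht).hasDerivAt
  have hp' := (h.diff_p' t ht).hasDerivAt
  have hq' := (h.diff_q' t ht).hasDerivAt
  have hA := hp.const_sub 1
  have hB := hq.const_sub 1
  have mA := one_sub_mem_slitPlane (h.norm_p_lt t ht)
  have mB := one_sub_mem_slitPlane (h.norm_q_lt t ht)
  have hcpow : ∀ {f : ℝ → ℂ} {f' : ℂ}, HasDerivAt f f' t → f t ∈ Complex.slitPlane →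
      HasDerivAt (fun s => f s ^ (-1 / 2 : ℂ)) (-1 / 2 * f t ^ (-3 / 2 : ℂ) * f') t := by
    intro f f' hf hm
    have h1 := (hasDerivAt_id (f t)).cpow_const (c := (-1 / 2 : ℂ)) hm
    have h2 := h1.comp t hf
    simp only [Function.comp_def, id] at h2
    refine h2.congr_deriv ?_
    rw [show (-1 / 2 - 1 : ℂ) = -3 / 2 by norm_num, mul_one]
  have ht' : HasDerivAt (fun s : ℝ => (s : ℂ)) 1 t := Complex.ofRealCLM.hasDerivAt
  have hexp : ∀ a : ℂ, HasDerivAt (fun s : ℝ => Complex.exp (a * s)) (Complex.exp (a * t) * a) t := by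
    intro a
    simpa using (ht'.const_mul a).cexp
  have hE := (((((hp'.sub (hA.const_mul Complex.I)).mul (hq'.add (hB.const_mul Complex.I))).sub
    ((hA.const_mul (3 / 2 * m ^ 2 : ℂ)).mul hB)).sub
    (((hcpow hA mA).mul (hcpow hB mB)).const_mul (2 * hillL m : ℂ))).sub
    ((((hA.pow 2).mul (hexp (2 * Complex.I))).add
      ((hB.pow 2).mul (hexp (-2 * Complex.I)))).const_mul (3 / 4 * lam)))
  have key := hE.congr_deriv (g' := 0) ?_
  · exact key
  have e1 := h.eq_p t ht
  have e2 := h.eq_q t ht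
  -- These relations cancel the two attraction terms multiplied by `i(1-q)` and `-i(1-p)`; what is
  -- left of the attraction is the derivative of `2l (1-p)^(-1/2) (1-q)^(-1/2)`.
  have n3 : ∀ z : ℂ, z ≠ 0 → z * z ^ (-3 / 2 : ℂ) = z ^ (-1 / 2 : ℂ) := by
    intro z hz
    rw [show (-1 / 2 : ℂ) = 1 + -3 / 2 by norm_num, Complex.cpow_add _ _ hz, Complex.cpow_one]
  have hA3 := n3 _ (one_sub_ne_zero_of_norm_lt_one (h.norm_p_lt t ht))
  have hB3 := n3 _ (one_sub_ne_zero_of_norm_lt_one (h.norm_q_lt t ht))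
  simp only [remP, remQ] at e1 e2
  simp only [Pi.sub_apply, Pi.add_apply, Pi.pow_apply]
  generalize hP : deriv (deriv p) t = P2 at *
  generalize hQ : deriv (deriv q) t = Q2 at *
  generalize ((1 - p t) ^ (-3 / 2 : ℂ)) = A3 at *
  generalize ((1 - q t) ^ (-3 / 2 : ℂ)) = B3 at *
  generalize ((1 - p t) ^ (-1 / 2 : ℂ)) = A1 at *
  generalize ((1 - q t) ^ (-1 / 2 : ℂ)) = B1 at *
  have hI := Complex.I_sq
  have hl : (hillL m : ℂ) = 1 + 2 * m + 3 / 2 * m ^ 2 := by simp [hillL]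
  -- The multipliers are the cofactors of `p''` and `q''` in the derivative of the kinetic product.
  linear_combination (deriv q t + Complex.I * (1 - q t)) * e1 +
    (deriv p t - Complex.I * (1 - p t)) * e2 + hillL m * Complex.I * A1 * hB3
    - hillL m * Complex.I * B1 * hA3
    - (1 + 2 * m) * (deriv p t * (1 - q t) + (1 - p t) * deriv q t) * hI
    - (deriv p t * (1 - q t) + (1 - p t) * deriv q t) * hl

theorem eq_of_hasDerivAt_zero {f : ℝ → ℂ} {α β : ℝ} (h : ∀ t ∈ Set.Ioo α β, HasDerivAt f 0 t)
    {s t : ℝ} (hs : s ∈ Set.Ioo α β) (ht : t ∈ Set.Ioo α β) : f s = f t :=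
  isOpen_Ioo.is_const_of_deriv_eq_zero isPreconnected_Ioo
    (fun x hx => (h x hx).differentiableAt.differentiableWithinAt) (fun x hx => (h x hx).deriv) hs ht

theorem hillEnergy_eq {m : ℝ} {lam : ℂ} {α β : ℝ} {p q : ℝ → ℂ}
    (h : IsComplexSolOn m lam (Set.Ioo α β) p q) {s t : ℝ} (hs : s ∈ Set.Ioo α β)
    (ht : t ∈ Set.Ioo α β) : hillEnergy m lam p q s = hillEnergy m lam p q t :=
  eq_of_hasDerivAt_zero (fun _ hx => hasDerivAt_hillEnergy h hx) hs ht

/-! ### The linearised system and its periodic solutions -/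

theorem hillChi_sq (m : ℝ) : hillChi m ^ 2 = 1 + 2 * m - m ^ 2 / 2 := by
  rw [hillChi, one_div]
  have := Complex.cpow_nat_inv_pow ((1 + 2 * m - m ^ 2 / 2 : ℝ) : ℂ) (n := 2) (by norm_num)
  push_cast at this ⊢
  exact this

theorem hillL_pos (m : ℝ) : 0 < hillL m := by
  rw [hillL]; nlinarith [sq_nonneg (3 * m + 2)]

theorem zero_mem_Ioo : (0 : ℝ) ∈ Set.Ioo (-1 : ℝ) 7 := by norm_num

theorem two_pi_mem_Ioo : 2 * Real.pi ∈ Set.Ioo (-1 : ℝ) 7 :=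
  ⟨by linarith [Real.pi_pos], by linarith [Real.pi_lt_d2]⟩

section LinearSystem

variable {m : ℝ} {U : ℝ → State}

theorem hasDerivAt_components
    (hU : ∀ t ∈ Set.Ioo (-1 : ℝ) 7, HasDerivAt U (linField m (U t)) t) {t : ℝ}
    (ht : t ∈ Set.Ioo (-1 : ℝ) 7) :
    HasDerivAt (fun t => (U t).1) (U t).2.2.1 t ∧ HasDerivAt (fun t => (U t).2.1) (U t).2.2.2 t ∧
    HasDerivAt (fun t => (U t).2.2.1)
      (-2 * (1 + m) * Complex.I * (U t).2.2.1 + 3 / 2 * hillL m * ((U t).1 + (U t).2.1)) t ∧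
    HasDerivAt (fun t => (U t).2.2.2)
      (2 * (1 + m) * Complex.I * (U t).2.2.2 + 3 / 2 * hillL m * ((U t).1 + (U t).2.1)) t :=
  ⟨(ContinuousLinearMap.fst ℝ ℂ (ℂ × ℂ × ℂ)).hasFDerivAt.comp_hasDerivAt t (hU t ht),
    ((ContinuousLinearMap.fst ℝ ℂ (ℂ × ℂ)) ∘L
      (ContinuousLinearMap.snd ℝ ℂ (ℂ × ℂ × ℂ))).hasFDerivAt.comp_hasDerivAt t (hU t ht),
    ((ContinuousLinearMap.fst ℝ ℂ ℂ) ∘L (ContinuousLinearMap.snd ℝ ℂ (ℂ × ℂ)) ∘L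
      (ContinuousLinearMap.snd ℝ ℂ (ℂ × ℂ × ℂ))).hasFDerivAt.comp_hasDerivAt t (hU t ht),
    ((ContinuousLinearMap.snd ℝ ℂ ℂ) ∘L (ContinuousLinearMap.snd ℝ ℂ (ℂ × ℂ)) ∘L
      (ContinuousLinearMap.snd ℝ ℂ (ℂ × ℂ × ℂ))).hasFDerivAt.comp_hasDerivAt t (hU t ht)⟩

/-- For the linear system, one of the periodicity conditions follows from the other three. -/
theorem linear_periodic_of_three
    (hU : ∀ t ∈ Set.Ioo (-1 : ℝ) 7, HasDerivAt U (linField m (U t)) t)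
    (h1 : (U (2 * Real.pi)).1 = (U 0).1) (h2 : (U (2 * Real.pi)).2.1 = (U 0).2.1)
    (h3 : (U (2 * Real.pi)).2.2.1 = (U 0).2.2.1) : U (2 * Real.pi) = U 0 := by
  -- The conserved quantity is the linear part of the energy at `lam = 0`. Its coefficient at `q'`
  -- is `-i ≠ 0`, whatever `m` is.
  have hE : ∀ t ∈ Set.Ioo (-1 : ℝ) 7, HasDerivAt (fun t => Complex.I * ((U t).2.2.1 - (U t).2.2.2)
      - 2 * (1 + m) * ((U t).1 + (U t).2.1)) 0 t := by
    intro t ht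
    obtain ⟨d1, d2, d3, d4⟩ := hasDerivAt_components hU ht
    refine (((d3.sub d4).const_mul Complex.I).sub
      ((d1.add d2).const_mul (2 * (1 + m) : ℂ))).congr_deriv ?_
    linear_combination (-2 * (1 + m) * ((U t).2.2.1 + (U t).2.2.2)) * Complex.I_sq
  have h := eq_of_hasDerivAt_zero hE two_pi_mem_Ioo zero_mem_Ioo
  simp only [h1, h2, h3] at h
  have h4 : (U (2 * Real.pi)).2.2.2 = (U 0).2.2.2 := by
    have : Complex.I * ((U (2 * Real.pi)).2.2.2 - (U 0).2.2.2) = 0 := by linear_combination -h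
    rcases mul_eq_zero.1 this with h | h
    · exact absurd h Complex.I_ne_zero
    · exact sub_eq_zero.1 h
  exact Prod.ext h1 (Prod.ext h2 (Prod.ext h3 h4))

/-- A solution is a multiple of `e^{at}`, and the hypothesis says that this exponential does not
return to its initial value after `2π`. -/
theorem eq_zero_of_periodic_of_hasDerivAt {z : ℝ → ℂ} {a : ℂ}
    (hz : ∀ t ∈ Set.Ioo (-1 : ℝ) 7, HasDerivAt z (a * z t) t) (hp : z (2 * Real.pi) = z 0)
    (ha : Complex.exp (2 * Real.pi * a) ≠ 1) {t : ℝ} (ht : t ∈ Set.Ioo (-1 : ℝ) 7) : z t = 0 := by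
  have hE : ∀ t ∈ Set.Ioo (-1 : ℝ) 7, HasDerivAt (fun t : ℝ => z t * Complex.exp (-a * t)) 0 t := by
    intro t ht
    have h1 : HasDerivAt (fun s : ℝ => (s : ℂ)) 1 t := Complex.ofRealCLM.hasDerivAt
    refine ((hz t ht).mul (h1.const_mul (-a)).cexp).congr_deriv ?_
    ring
  have h0 : z 0 = 0 := by
    have h := eq_of_hasDerivAt_zero hE two_pi_mem_Ioo zero_mem_Ioo
    simp only [hp, Complex.ofReal_zero, mul_zero, Complex.exp_zero, mul_one] at h
    by_contra hne
    have h1 : Complex.exp (-a * ((2 * Real.pi : ℝ) : ℂ)) = 1 :=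
      mul_left_cancel₀ hne (by rw [h, mul_one])
    apply ha
    have h2 : (2 * Real.pi * a : ℂ) = -(-a * ((2 * Real.pi : ℝ) : ℂ)) := by push_cast; ring
    rw [h2, Complex.exp_neg, h1, inv_one]
  have h := eq_of_hasDerivAt_zero hE ht zero_mem_Ioo
  simp only [h0, zero_mul] at h
  exact (mul_eq_zero.1 h).resolve_right (Complex.exp_ne_zero _)

/-- Either exponential equal to `1` would make `χ` an integer, where `sin πχ` vanishes. -/
theorem exp_two_pi_mul_ne_one {χ : ℂ} (h : Complex.sin (Real.pi * χ) ≠ 0) :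
    Complex.exp (2 * Real.pi * (Complex.I * χ)) ≠ 1 ∧
      Complex.exp (2 * Real.pi * (-(Complex.I * χ))) ≠ 1 := by
  have key : ∀ n : ℤ, χ ≠ n := by
    intro n hn
    apply h
    rw [hn, mul_comm, Complex.sin_int_mul_pi]
  constructor
  · intro h1
    obtain ⟨n, hn⟩ := Complex.exp_eq_one_iff.1 h1
    apply key n
    apply mul_left_cancel₀ Complex.two_pi_I_ne_zero
    linear_combination hn
  · intro h1
    obtain ⟨n, hn⟩ := Complex.exp_eq_one_iff.1 h1
    apply key (-n)
    apply mul_left_cancel₀ Complex.two_pi_I_ne_zero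
    push_cast
    linear_combination -hn

/-- Periodic solutions of the linear system with `p₀ = q₀` vanish. -/
theorem linear_periodic_eq_zero (hm : Complex.sin (Real.pi * hillChi m) ≠ 0)
    (hU : ∀ t ∈ Set.Ioo (-1 : ℝ) 7, HasDerivAt U (linField m (U t)) t)
    (hper : U (2 * Real.pi) = U 0) (h0 : (U 0).1 = (U 0).2.1) : U 0 = 0 := by
  set χ := hillChi m with hχ
  have hχ2 : χ ^ 2 = 1 + 2 * m - m ^ 2 / 2 := hillChi_sq m
  have hχ0 : χ ≠ 0 := by
    intro h
    rw [h] at hm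
    simp at hm
  have hl : (hillL m : ℂ) = 1 + 2 * m + 3 / 2 * m ^ 2 := by simp [hillL]
  have hl0 : (hillL m : ℂ) ≠ 0 := by exact_mod_cast (hillL_pos m).ne'
  have hI := Complex.I_sq
  -- First integral from the difference of the two linear equations, in which the common term `(3/2)
  -- l (p+q)` cancels.
  let K : ℝ → ℂ := fun t => ((U t).2.2.1 - (U t).2.2.2)
    + 2 * (1 + m) * Complex.I * ((U t).1 + (U t).2.1)
  have hK : ∀ t ∈ Set.Ioo (-1 : ℝ) 7, K t = K 0 := by
    intro t ht
    refine eq_of_hasDerivAt_zero (fun t ht => ?_) ht zero_mem_Ioo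
    obtain ⟨d1, d2, d3, d4⟩ := hasDerivAt_components hU ht
    refine ((d3.sub d4).add ((d1.add d2).const_mul (2 * (1 + m) * Complex.I : ℂ))).congr_deriv ?_
    ring
  -- With `s = p + q`, adding the equations and eliminating `p' - q'` by `K` gives `s'' = -χ² s -
  -- 2(1+m) i K`, because `4(1+m)² - 3l = χ²`. The constant `C` is the rest position of this
  -- oscillator.
  set C : ℂ := -2 * (1 + m) * Complex.I * K 0 / χ ^ 2 with hC
  have hC' : χ ^ 2 * C = -2 * (1 + m) * Complex.I * K 0 := by
    rw [hC]; field_simp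
  -- The oscillator is factored into first order equations: `s' + b(s - C)` grows at the rate `b`,
  -- for `b = ±iχ`. Both combinations vanish by periodicity, so `s = C` throughout.
  have hz : ∀ b : ℂ, b ^ 2 = -χ ^ 2 → ∀ t ∈ Set.Ioo (-1 : ℝ) 7,
      HasDerivAt (fun t => ((U t).2.2.1 + (U t).2.2.2) + b * ((U t).1 + (U t).2.1 - C))
        (b * (((U t).2.2.1 + (U t).2.2.2) + b * ((U t).1 + (U t).2.1 - C))) t := by
    intro b hb t ht
    obtain ⟨d1, d2, d3, d4⟩ := hasDerivAt_components hU ht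
    refine ((d3.add d4).add (((d1.add d2).sub_const C).const_mul b)).congr_deriv ?_
    have hKt := hK t ht
    simp only [K] at hKt hC'
    linear_combination (-2 * (1 + m) * Complex.I) * hKt - hC' - ((U t).1 + (U t).2.1 - C) * hb
      + 4 * (1 + m) ^ 2 * ((U t).1 + (U t).2.1) * hI + 3 * ((U t).1 + (U t).2.1) * hl
      + ((U t).1 + (U t).2.1) * hχ2
  obtain ⟨e1, e2⟩ := exp_two_pi_mul_ne_one hm
  have z1 : ∀ t ∈ Set.Ioo (-1 : ℝ) 7, _ := fun t ht => eq_zero_of_periodic_of_hasDerivAt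
    (hz (Complex.I * χ) (by rw [mul_pow, hI]; ring)) (by simp only [hper]) e1 ht
  have z2 : ∀ t ∈ Set.Ioo (-1 : ℝ) 7, _ := fun t ht => eq_zero_of_periodic_of_hasDerivAt
    (hz (-(Complex.I * χ)) (by rw [neg_sq, mul_pow, hI]; ring)) (by simp only [hper]) e2 ht
  have hs' : ∀ t ∈ Set.Ioo (-1 : ℝ) 7, (U t).2.2.1 + (U t).2.2.2 = 0 := fun t ht => by
    linear_combination (z1 t ht + z2 t ht) / 2
  have hs : ∀ t ∈ Set.Ioo (-1 : ℝ) 7, (U t).1 + (U t).2.1 = C := fun t ht => by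
    have : (Complex.I * χ) * ((U t).1 + (U t).2.1 - C) = 0 := by
      linear_combination (z1 t ht - z2 t ht) / 2
    rcases mul_eq_zero.1 this with h | h
    · exact absurd h (mul_ne_zero Complex.I_ne_zero hχ0)
    · exact sub_eq_zero.1 h
  set κ : ℂ := K 0 - 2 * (1 + m) * Complex.I * C with hκ
  have hd : ∀ t ∈ Set.Ioo (-1 : ℝ) 7, (U t).2.2.1 - (U t).2.2.2 = κ := fun t ht => by
    have h1 := hK t ht
    have h2 := hs t ht
    simp only [K] at h1
    rw [h2] at h1
    rw [hκ]
    simp only [K]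
    linear_combination h1
  -- The difference `p - q` has constant slope `κ`, so periodicity excludes a secular term.
  have hκ0 : κ = 0 := by
    have hE : ∀ t ∈ Set.Ioo (-1 : ℝ) 7,
        HasDerivAt (fun t : ℝ => (U t).1 - (U t).2.1 - κ * t) 0 t := by
      intro t ht
      obtain ⟨d1, d2, -, -⟩ := hasDerivAt_components hU ht
      have h1 : HasDerivAt (fun s : ℝ => (s : ℂ)) 1 t := Complex.ofRealCLM.hasDerivAt
      refine ((d1.sub d2).sub (h1.const_mul κ)).congr_deriv ?_
      linear_combination hd t ht
    have h := eq_of_hasDerivAt_zero hE two_pi_mem_Ioo zero_mem_Ioo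
    simp only [hper, Complex.ofReal_zero, mul_zero, sub_zero] at h
    have h2 : κ * ((2 * Real.pi : ℝ) : ℂ) = 0 := by linear_combination -h
    exact (mul_eq_zero.1 h2).resolve_right (by exact_mod_cast Real.two_pi_pos.ne')
  -- Now `K = 2(1+m) i C`, and the definition of `C` becomes `χ² C = 4(1+m)² C`, that is `3 l C = 0`
  -- with `l > 0`. Only `p - q = const` remains, which the condition `p₀ = q₀` removes.
  have hC0 : C = 0 := by
    have h1 : 3 * (hillL m : ℂ) * C = 0 := by
      linear_combination (2 * (1 + m) * Complex.I) * (hκ.symm.trans hκ0) - hC' + C * hχ2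
        + 3 * C * hl + 4 * (1 + m) ^ 2 * C * hI
    exact (mul_eq_zero.1 h1).resolve_left (mul_ne_zero (by norm_num) hl0)
  have a1 := hs 0 zero_mem_Ioo
  have a2 := hs' 0 zero_mem_Ioo
  have a3 := hd 0 zero_mem_Ioo
  rw [hC0] at a1
  rw [hκ0] at a3
  refine Prod.ext ?_ (Prod.ext ?_ (Prod.ext ?_ ?_))
  · change (U 0).1 = 0
    linear_combination (a1 + h0) / 2
  · change (U 0).2.1 = 0
    linear_combination (a1 - h0) / 2
  · change (U 0).2.2.1 = 0
    linear_combination (a2 + a3) / 2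
  · change (U 0).2.2.2 = 0
    linear_combination (a2 - a3) / 2

end LinearSystem

/-! ### Redundancy of one periodicity condition -/

theorem exists_flow_ball (m : ℝ) :
    ∃ (Fl : State × ℂ → TimeCurve) (r : ℝ), 0 < r ∧ ContDiffAt ℂ ω Fl 0 ∧ Fl 0 = 0 ∧
      (∀ z, ‖z‖ < r → ‖Fl z‖ < 1 ∧ Fl z timeZero = z.1 ∧ ∀ t ∈ Set.Ioo (-1 : ℝ) 7,
        HasDerivAt (extendTime (Fl z)) (hillField m z.2 t (extendTime (Fl z) t)) t) ∧
      ∀ v : State, fderiv ℂ Fl 0 (v, 0) timeZero = v ∧ ∀ t ∈ Set.Ioo (-1 : ℝ) 7,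
        HasDerivAt (extendTime (fderiv ℂ Fl 0 (v, 0)))
          (linField m (extendTime (fderiv ℂ Fl 0 (v, 0)) t)) t := by
  obtain ⟨Fl, h1, h2, h3, h4⟩ := exists_analytic_flow m
  have h5 : ∀ᶠ z in 𝓝 0, ‖Fl z‖ < 1 := by
    have := h1.continuousAt.eventually (Metric.ball_mem_nhds _ one_pos)
    simpa [h2] using this
  obtain ⟨r, hr, hball⟩ := Metric.eventually_nhds_iff.1 (h5.and h3)
  exact ⟨Fl, r, hr, h1, h2, fun z hz => hball (by simpa using hz), h4⟩

theorem extendTime_mem_admissibleState {u : TimeCurve} (h : ‖u‖ < 1) (t : ℝ) :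
    extendTime u t ∈ admissibleState := by
  have h1 := (norm_extendTime_le u t).trans_lt h
  exact ⟨(norm_fst_le _).trans_lt h1, (norm_fst_le _).trans_lt ((norm_snd_le _).trans_lt h1)⟩

theorem norm_hillState_prod_lt {ε : ℝ} {p q : ℝ → ℂ} {lam : ℂ} (h : SmallInit ε p q)
    (hl : ‖lam‖ < ε) : ‖(hillState p q 0, lam)‖ < ε := by
  obtain ⟨h1, h2, h3, h4⟩ := h
  simp only [hillState, Prod.norm_def, sup_lt_iff]
  exact ⟨⟨h1, h2, h3, h4⟩, hl⟩

theorem Icc_two_pi_subset : Set.Icc 0 (2 * Real.pi) ⊆ Set.Ioo (-1 : ℝ) 7 := fun _ ht =>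
  ⟨lt_of_lt_of_le (by norm_num) ht.1, lt_of_le_of_lt ht.2 two_pi_mem_Ioo.2⟩

theorem extendTime_zero (u : TimeCurve) : extendTime u 0 = u timeZero :=
  extendTime_coe u timeZero

/-- Solutions agree with the flow on the first period. -/
theorem hillState_eq_of_flow {m : ℝ} {lam : ℂ} {I : Set ℝ} {p q : ℝ → ℂ} {u : TimeCurve}
    (hI : Set.Icc 0 (2 * Real.pi) ⊆ I) (h : IsComplexSolOn m lam I p q) (hu : ‖u‖ < 1)
    (hU : ∀ t ∈ Set.Ioo (-1 : ℝ) 7, HasDerivAt (extendTime u) (hillField m lam t (extendTime u t)) t)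
    (h0 : u timeZero = hillState p q 0) {t : ℝ} (ht : t ∈ Set.Icc 0 (2 * Real.pi)) :
    hillState p q t = extendTime u t :=
  eqOn_of_hasDerivAt_hillField (fun _ ht => h.hasDerivAt_hillState (hI ht))
    (fun _ ht => h.mem_admissibleState (hI ht)) (fun _ ht => hU _ (Icc_two_pi_subset ht))
    (fun _ _ => extendTime_mem_admissibleState hu _) (by rw [extendTime_zero, h0]) ht

/-- Uniform in the parameter `y`: if `g` takes equal values at `(x, y)` and `(x', y)`, strict
differentiability bounds `‖x - x'‖ ‖g' (1, 0)‖` by half of itself. -/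
theorem exists_injective_of_hasStrictFDerivAt {Y : Type*} [NormedAddCommGroup Y] [NormedSpace ℂ Y]
    {g : ℂ × Y → ℂ} {g' : ℂ × Y →L[ℂ] ℂ} (hg : HasStrictFDerivAt g g' 0) (h1 : g' (1, 0) ≠ 0) :
    ∃ η : ℝ, 0 < η ∧ ∀ (x x' : ℂ) (y : Y), ‖x‖ < η → ‖x'‖ < η → ‖y‖ < η →
      g (x, y) = g (x', y) → x = x' := by
  have hc : 0 < ‖g' (1, 0)‖ / 2 := half_pos (norm_pos_iff.2 h1)
  obtain ⟨η, hη, hb⟩ := Metric.eventually_nhds_iff.1 (hg.isLittleO.def hc)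
  refine ⟨η, hη, fun x x' y hx hx' hy h => ?_⟩
  have h2 : ‖g (x, y) - g (x', y) - g' ((x, y) - (x', y))‖ ≤
      ‖g' (1, 0)‖ / 2 * ‖((x, y) - (x', y) : ℂ × Y)‖ := by
    refine @hb ((x, y), (x', y)) ?_
    rw [← Prod.zero_eq_mk, dist_zero_right, Prod.norm_def, Prod.norm_def, Prod.norm_def]
    simp only [sup_lt_iff]
    exact ⟨⟨hx, hy⟩, hx', hy⟩
  have h3 : ((x, y) - (x', y) : ℂ × Y) = (x - x') • ((1 : ℂ), (0 : Y)) := by simp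
  rw [h, sub_self, zero_sub, norm_neg, h3, map_smul, norm_smul, norm_smul] at h2
  have h4 : ‖((1 : ℂ), (0 : Y))‖ = 1 := by simp
  rw [h4, mul_one] at h2
  by_contra hne
  have h5 : 0 < ‖x - x'‖ := norm_pos_iff.2 (sub_ne_zero.2 hne)
  nlinarith [mul_pos h5 hc]

theorem contDiffAt_stateEnergy (m : ℝ) :
    ContDiffAt ℂ 1 (fun x : State × ℂ => stateEnergy m x.2 0 x.1) 0 := by
  have hpow : ∀ f : State × ℂ → ℂ, ContDiffAt ℂ 1 f 0 → f 0 = 0 →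
      ContDiffAt ℂ 1 (fun y => (1 - f y) ^ (-1 / 2 : ℂ)) 0 := by
    intro f hf h1
    have h2 : ContDiffAt ℂ 1 (fun z : ℂ => z ^ (-1 / 2 : ℂ)) (1 - f 0) := by
      have := (analyticAt_id (𝕜 := ℂ) (z := 1 - f 0)).cpow
        (analyticAt_const (v := (-1 / 2 : ℂ))) (one_sub_mem_slitPlane (by simp [h1]))
      exact this.contDiffAt
    exact ContDiffAt.comp 0 h2 (contDiffAt_const.sub hf)
  have p1 := hpow (fun x => x.1.1) (by fun_prop) rfl
  have q1 := hpow (fun x => x.1.2.1) (by fun_prop) rfl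
  simp only [stateEnergy]
  fun_prop

theorem hasDerivAt_one_sub_cpow : HasDerivAt (fun z : ℂ => (1 - z) ^ (-1 / 2 : ℂ)) (1 / 2) 0 := by
  have h := ((hasDerivAt_id (0 : ℂ)).const_sub 1).cpow_const (c := (-1 / 2 : ℂ)) (by simp)
  refine h.congr_deriv ?_
  simp
  norm_num

/-- The explicit time dependence of the energy is only through `e^{±2iτ}`. Thus conservation between
`0` and `2π` compares the same function at two states. -/
theorem stateEnergy_two_pi (m : ℝ) (lam : ℂ) (u : State) :
    stateEnergy m lam (2 * Real.pi) u = stateEnergy m lam 0 u := by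
  have h1 : Complex.exp (2 * Complex.I * ((2 * Real.pi : ℝ) : ℂ)) = 1 :=
    Complex.exp_eq_one_iff.2 ⟨2, by push_cast; ring⟩
  have h2 : Complex.exp (-2 * Complex.I * ((2 * Real.pi : ℝ) : ℂ)) = 1 :=
    Complex.exp_eq_one_iff.2 ⟨-2, by push_cast; ring⟩
  simp only [stateEnergy, h1, h2, Complex.ofReal_zero, mul_zero, Complex.exp_zero]

/-- Near the equilibrium the energy determines `p` and `q` from the other variables. -/
theorem exists_stateEnergy_injective {m : ℝ} (hm : m ≠ -1) :
    ∃ η : ℝ, 0 < η ∧ ∀ (p p' q q' r s lam : ℂ), ‖p‖ < η → ‖p'‖ < η → ‖q‖ < η → ‖q'‖ < η →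
      ‖r‖ < η → ‖s‖ < η → ‖lam‖ < η →
      (stateEnergy m lam 0 (p, q, r, s) = stateEnergy m lam 0 (p', q, r, s) → p = p') ∧
      (stateEnergy m lam 0 (p, q, r, s) = stateEnergy m lam 0 (p, q', r, s) → q = q') := by
  have hs := (contDiffAt_stateEnergy m).hasStrictFDerivAt one_ne_zero
  set D := fderiv ℂ (fun x : State × ℂ => stateEnergy m x.2 0 x.1) 0
  have hm' : (-2 * (1 + m) : ℂ) ≠ 0 := by
    refine mul_ne_zero (by norm_num) ?_
    intro h
    apply hm
    have : ((1 + m : ℝ) : ℂ) = 0 := by push_cast; exact h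
    have := Complex.ofReal_eq_zero.1 this
    linarith
  have hl : (hillL m : ℂ) = 1 + 2 * m + 3 / 2 * m ^ 2 := by simp [hillL]
  have hI := Complex.I_sq
  have hlin := (hasDerivAt_id (0 : ℂ)).const_sub 1
  -- The kinetic product contributes `1`, the quadratic term `(3/2) m²` and the attraction `-l`;
  -- their sum is `-2(1+m)`. This is where `m ≠ -1` enters.
  have hDp : D ((1, 0), 0) = -2 * (1 + m) := by
    have h1 : HasDerivAt (fun z : ℂ => (((z, 0, 0, 0), 0) : State × ℂ)) ((1, 0), 0) 0 :=
      ((hasDerivAt_id 0).prodMk (hasDerivAt_const 0 0)).prodMk (hasDerivAt_const 0 0)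
    have h2 := hs.hasFDerivAt.comp_hasDerivAt_of_eq 0 h1 rfl
    have h3 : HasDerivAt (fun z : ℂ => (0 - Complex.I * (1 - z)) * (0 + Complex.I * (1 - 0))
        - 3 / 2 * m ^ 2 * (1 - z) * (1 - 0)
        - 2 * hillL m * ((1 - z) ^ (-1 / 2 : ℂ) * (1 - 0) ^ (-1 / 2 : ℂ))
        - 3 / 4 * 0 * ((1 - z) ^ 2 * Complex.exp (2 * Complex.I * (0 : ℝ))
          + (1 - 0) ^ 2 * Complex.exp (-2 * Complex.I * (0 : ℝ)))) (-2 * (1 + m) : ℂ) 0 := by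
      simp only [mul_zero, zero_mul, sub_zero, Complex.one_cpow, mul_one, zero_sub, zero_add]
      refine ((((hlin.const_mul Complex.I).neg.mul_const Complex.I).sub
        (hlin.const_mul (3 / 2 * m ^ 2 : ℂ))).sub
        (hasDerivAt_one_sub_cpow.const_mul (2 * hillL m : ℂ))).congr_deriv ?_
      linear_combination hI - hl
    exact h2.unique h3
  have hDq : D ((0, 1, 0), 0) = -2 * (1 + m) := by
    have h1 : HasDerivAt (fun z : ℂ => (((0, z, 0, 0), 0) : State × ℂ)) ((0, 1, 0), 0) 0 :=
      ((hasDerivAt_const 0 0).prodMk ((hasDerivAt_id 0).prodMk (hasDerivAt_const 0 0))).prodMk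
        (hasDerivAt_const 0 0)
    have h2 := hs.hasFDerivAt.comp_hasDerivAt_of_eq 0 h1 rfl
    have h3 : HasDerivAt (fun z : ℂ => (0 - Complex.I * (1 - 0)) * (0 + Complex.I * (1 - z))
        - 3 / 2 * m ^ 2 * (1 - 0) * (1 - z)
        - 2 * hillL m * ((1 - 0) ^ (-1 / 2 : ℂ) * (1 - z) ^ (-1 / 2 : ℂ))
        - 3 / 4 * 0 * ((1 - 0) ^ 2 * Complex.exp (2 * Complex.I * (0 : ℝ))
          + (1 - z) ^ 2 * Complex.exp (-2 * Complex.I * (0 : ℝ)))) (-2 * (1 + m) : ℂ) 0 := by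
      simp only [mul_zero, zero_mul, sub_zero, Complex.one_cpow, mul_one, one_mul, zero_sub, zero_add]
      refine ((((hlin.const_mul Complex.I).const_mul (-Complex.I)).sub
        (hlin.const_mul (3 / 2 * m ^ 2 : ℂ))).sub
        (hasDerivAt_one_sub_cpow.const_mul (2 * hillL m : ℂ))).congr_deriv ?_
      linear_combination hI - hl
    exact h2.unique h3
  let Sp : ℂ × ((ℂ × ℂ × ℂ) × ℂ) →L[ℂ] State × ℂ := LinearMap.toContinuousLinearMap
    { toFun := fun x => ((x.1, x.2.1), x.2.2)
      map_add' := fun _ _ => rfl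
      map_smul' := fun _ _ => rfl }
  let Sq : ℂ × ((ℂ × ℂ × ℂ) × ℂ) →L[ℂ] State × ℂ := LinearMap.toContinuousLinearMap
    { toFun := fun x => ((x.2.1.1, x.1, x.2.1.2), x.2.2)
      map_add' := fun _ _ => rfl
      map_smul' := fun _ _ => rfl }
  have hsp : HasStrictFDerivAt (fun x => stateEnergy m (Sp x).2 0 (Sp x).1) (D ∘L Sp) 0 :=
    HasStrictFDerivAt.comp (g := fun x : State × ℂ => stateEnergy m x.2 0 x.1) (f := Sp) 0
      (by rw [map_zero]; exact hs) Sp.hasStrictFDerivAt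
  have hsq : HasStrictFDerivAt (fun x => stateEnergy m (Sq x).2 0 (Sq x).1) (D ∘L Sq) 0 :=
    HasStrictFDerivAt.comp (g := fun x : State × ℂ => stateEnergy m x.2 0 x.1) (f := Sq) 0
      (by rw [map_zero]; exact hs) Sq.hasStrictFDerivAt
  obtain ⟨η₁, hη₁, inj₁⟩ := exists_injective_of_hasStrictFDerivAt hsp (by
    change D ((1, 0), 0) ≠ 0
    rw [hDp]; exact hm')
  obtain ⟨η₂, hη₂, inj₂⟩ := exists_injective_of_hasStrictFDerivAt hsq (by
    change D ((0, 1, 0), 0) ≠ 0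
    rw [hDq]; exact hm')
  refine ⟨min η₁ η₂, lt_min hη₁ hη₂, fun p p' q q' r s lam h1 h2 h3 h4 h5 h6 h7 => ⟨fun h => ?_,
    fun h => ?_⟩⟩
  · refine inj₁ p p' ((q, r, s), lam) (h1.trans_le (min_le_left _ _))
      (h2.trans_le (min_le_left _ _)) ?_ h
    simp only [Prod.norm_def, sup_lt_iff]
    exact ⟨⟨h3.trans_le (min_le_left _ _), h5.trans_le (min_le_left _ _),
      h6.trans_le (min_le_left _ _)⟩, h7.trans_le (min_le_left _ _)⟩
  · refine inj₂ q q' ((p, r, s), lam) (h3.trans_le (min_le_right _ _))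
      (h4.trans_le (min_le_right _ _)) ?_ h
    simp only [Prod.norm_def, sup_lt_iff]
    exact ⟨⟨h1.trans_le (min_le_right _ _), h5.trans_le (min_le_right _ _),
      h6.trans_le (min_le_right _ _)⟩, h7.trans_le (min_le_right _ _)⟩

/-- The summand `e * (1 - z)` has modulus above `1/2` and `w` below. With `e = ±i` these are the two
factors of the kinetic product, which are the slopes of the energy in the velocities. -/
theorem velocity_ne {w z : ℂ} (hw : ‖w‖ < 1 / 2) (hz : ‖z‖ < 1 / 2) {e : ℂ} (he : ‖e‖ = 1) :
    w + e * (1 - z) ≠ 0 := by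
  intro h
  have h1 : ‖w‖ = ‖1 - z‖ := by
    rw [eq_neg_of_add_eq_zero_left h, norm_neg, norm_mul, he, one_mul]
  have h2 := norm_sub_norm_le (1 : ℂ) z
  rw [norm_one] at h2
  linarith

/-- The energy is affine in `p'` with slope `q' + i(1-q)`, so no implicit function theorem and no
condition on `m` is needed. -/
theorem stateEnergy_eq_fst_velocity {m : ℝ} {lam p q r r' s : ℂ} (hq : ‖q‖ < 1 / 2)
    (hs : ‖s‖ < 1 / 2)
    (h : stateEnergy m lam 0 (p, q, r, s) = stateEnergy m lam 0 (p, q, r', s)) : r = r' := by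
  have h1 := velocity_ne hs hq Complex.norm_I
  simp only [stateEnergy] at h
  have h2 : (r - r') * (s + Complex.I * (1 - q)) = 0 := by linear_combination h
  exact sub_eq_zero.1 ((mul_eq_zero.1 h2).resolve_right h1)

theorem stateEnergy_eq_snd_velocity {m : ℝ} {lam p q r s s' : ℂ} (hp : ‖p‖ < 1 / 2)
    (hr : ‖r‖ < 1 / 2)
    (h : stateEnergy m lam 0 (p, q, r, s) = stateEnergy m lam 0 (p, q, r, s')) : s = s' := by
  have h1 := velocity_ne hr hp (e := -Complex.I) (by simp)
  simp only [stateEnergy] at h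
  have h2 : (s - s') * (r + -Complex.I * (1 - p)) = 0 := by linear_combination h
  exact sub_eq_zero.1 ((mul_eq_zero.1 h2).resolve_right h1)

/-- Each of the four periodicity conditions follows from the other three. -/
theorem exists_periodicity_redundant (m : ℝ) :
    ∃ ε : ℝ, 0 < ε ∧ ∀ lam : ℂ, ‖lam‖ < ε → ∀ (α β : ℝ) (p q : ℝ → ℂ),
        α < 0 → 2 * Real.pi < β → IsComplexSolOn m lam (Set.Ioo α β) p q → SmallInit ε p q →
        (p (2 * Real.pi) = p 0 → q (2 * Real.pi) = q 0 →
          deriv p (2 * Real.pi) = deriv p 0 → deriv q (2 * Real.pi) = deriv q 0) ∧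
        (p (2 * Real.pi) = p 0 → q (2 * Real.pi) = q 0 →
          deriv q (2 * Real.pi) = deriv q 0 → deriv p (2 * Real.pi) = deriv p 0) ∧
        (m ≠ -1 → p (2 * Real.pi) = p 0 → deriv p (2 * Real.pi) = deriv p 0 →
          deriv q (2 * Real.pi) = deriv q 0 → q (2 * Real.pi) = q 0) ∧
        (m ≠ -1 → q (2 * Real.pi) = q 0 → deriv p (2 * Real.pi) = deriv p 0 →
          deriv q (2 * Real.pi) = deriv q 0 → p (2 * Real.pi) = p 0) := by
  obtain ⟨Fl, r, hr, hFl, hFl0, hball, -⟩ := exists_flow_ball m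
  obtain ⟨η, hη, hinj⟩ : ∃ η : ℝ, 0 < η ∧ (m ≠ -1 → ∀ (p p' q q' r s lam : ℂ), ‖p‖ < η → ‖p'‖ < η →
      ‖q‖ < η → ‖q'‖ < η → ‖r‖ < η → ‖s‖ < η → ‖lam‖ < η →
      (stateEnergy m lam 0 (p, q, r, s) = stateEnergy m lam 0 (p', q, r, s) → p = p') ∧
      (stateEnergy m lam 0 (p, q, r, s) = stateEnergy m lam 0 (p, q', r, s) → q = q')) := by
    by_cases hm : m = -1
    -- For `m = -1` nothing is claimed about positions, and any positive `η` serves.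
    · exact ⟨1, one_pos, fun h => absurd hm h⟩
    · obtain ⟨η, h1, h2⟩ := exists_stateEnergy_injective hm
      exact ⟨η, h1, fun _ => h2⟩
  have hcont : ∀ᶠ z in 𝓝 0, ‖Fl z‖ < η := by
    have := hFl.continuousAt.eventually (Metric.ball_mem_nhds _ hη)
    simpa [hFl0] using this
  obtain ⟨ε₀, hε₀, hsmall⟩ := Metric.eventually_nhds_iff.1 hcont
  refine ⟨min (min r ε₀) (min η (1 / 2)), by positivity, fun lam hlam α β p q hα hβ hsol hinit => ?_⟩
  have hz := norm_hillState_prod_lt hinit hlam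
  have hzr := hz.trans_le ((min_le_left _ _).trans (min_le_left _ _))
  have hzε := hz.trans_le ((min_le_left _ _).trans (min_le_right _ _))
  have hη' : min (min r ε₀) (min η (1 / 2)) ≤ η := (min_le_right _ _).trans (min_le_left _ _)
  have hhalf : min (min r ε₀) (min η (1 / 2)) ≤ 1 / 2 := (min_le_right _ _).trans (min_le_right _ _)
  obtain ⟨b1, b2, b3⟩ := hball _ hzr
  have h2π : (2 * Real.pi) ∈ Set.Icc 0 (2 * Real.pi) := ⟨Real.two_pi_pos.le, le_rfl⟩
  have hsub : Set.Icc 0 (2 * Real.pi) ⊆ Set.Ioo α β := fun t ht =>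
    ⟨hα.trans_le ht.1, ht.2.trans_lt hβ⟩
  -- Only the state at time `0` is assumed small. Identifying the solution with the flow shows that
  -- the state at `2π` is small too, which local injectivity of the energy in the positions
  -- requires.
  have hst := hillState_eq_of_flow hsub hsol b1 b3 b2 h2π
  have hn : ‖hillState p q (2 * Real.pi)‖ < η := by
    rw [hst]
    exact (norm_extendTime_le _ _).trans_lt (hsmall (by simpa using hzε))
  have hpn : ‖p (2 * Real.pi)‖ < η := (norm_fst_le (hillState p q (2 * Real.pi))).trans_lt hn
  have hqn : ‖q (2 * Real.pi)‖ < η := (norm_fst_le (hillState p q (2 * Real.pi)).2).trans_lt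
    ((norm_snd_le (hillState p q (2 * Real.pi))).trans_lt hn)
  have hE := hillEnergy_eq hsol (hsub h2π) (hsub ⟨le_rfl, Real.two_pi_pos.le⟩)
  rw [hillEnergy_eq_stateEnergy, hillEnergy_eq_stateEnergy, stateEnergy_two_pi] at hE
  simp only [hillState] at hE
  obtain ⟨i1, i2, i3, i4⟩ := hinit
  refine ⟨fun e1 e2 e3 => ?_, fun e1 e2 e3 => ?_, fun hm e1 e2 e3 => ?_, fun hm e1 e2 e3 => ?_⟩
  · rw [e1, e2, e3] at hE
    exact stateEnergy_eq_snd_velocity (i1.trans_le hhalf) (i3.trans_le hhalf) hE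
  · rw [e1, e2, e3] at hE
    exact stateEnergy_eq_fst_velocity (i2.trans_le hhalf) (i4.trans_le hhalf) hE
  · rw [e1, e2, e3] at hE
    exact (hinj hm (p 0) (p 0) _ _ _ _ _ (i1.trans_le hη') (i1.trans_le hη') hqn (i2.trans_le hη')
      (i3.trans_le hη') (i4.trans_le hη') (hlam.trans_le hη')).2 hE
  · rw [e1, e2, e3] at hE
    exact (hinj hm _ _ (q 0) (q 0) _ _ _ hpn (i1.trans_le hη') (i2.trans_le hη') (i2.trans_le hη')
      (i3.trans_le hη') (i4.trans_le hη') (hlam.trans_le hη')).1 hE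

/-! ### The shooting problem -/

/-- The time `2π`. -/
def timeTwoPi : TimeIcc := ⟨2 * Real.pi, Set.Ioo_subset_Icc_self two_pi_mem_Ioo⟩

theorem extendTime_two_pi (u : TimeCurve) : extendTime u (2 * Real.pi) = u timeTwoPi :=
  extendTime_coe u timeTwoPi

/-- A curve that runs through a solution of the complex system on the time interval. -/
def IsFlowCurve (m : ℝ) (lam : ℂ) (u : TimeCurve) : Prop :=
  ‖u‖ < 1 ∧ ∀ t ∈ Set.Ioo (-1 : ℝ) 7,
    HasDerivAt (extendTime u) (hillField m lam t (extendTime u t)) t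

/-- The quantities prescribed by the shooting problem: `p₀ - q₀` and the increments of
`p`, `q` and `p'` over a period. -/
def shootingMap : State × State →L[ℂ] State := LinearMap.toContinuousLinearMap
  { toFun := fun x => (x.1.1 - x.1.2.1, x.2.1, x.2.2.1, x.2.2.2.1)
    map_add' := fun x y => by
      simp only [Prod.fst_add, Prod.snd_add, Prod.mk_add_mk, Prod.mk.injEq, and_true]
      ring
    map_smul' := fun c x => by
      simp only [Prod.smul_fst, Prod.smul_snd, smul_eq_mul, RingHom.id_apply, Prod.smul_mk,
        Prod.mk.injEq, and_true]
      ring }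

theorem shootingMap_apply (u v : State) :
    shootingMap (u, v) = (u.1 - u.2.1, v.1, v.2.1, v.2.2.1) := rfl

/-- The analytic two-parameter family of periodic solutions, on one period, and its uniqueness. -/
theorem exists_periodic_curves (m : ℝ) (hm : Complex.sin (Real.pi * hillChi m) ≠ 0) :
    ∃ F : ℂ × ℂ → TimeCurve, AnalyticAt ℂ F 0 ∧ F 0 = 0 ∧
      (∀ᶠ z in 𝓝 0, IsFlowCurve m z.2 (F z) ∧ F z timeTwoPi = F z timeZero ∧
        (F z timeZero).1 - (F z timeZero).2.1 = z.1) ∧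
      ∃ ε : ℝ, 0 < ε ∧ ∀ lam : ℂ, ‖lam‖ < ε → ∀ p q : ℝ → ℂ,
        IsComplexSolOn m lam Set.univ p q → SmallInit ε p q →
        hillState p q (2 * Real.pi) = hillState p q 0 →
        ∀ t ∈ Set.Icc 0 (2 * Real.pi), hillState p q t = extendTime (F (p 0 - q 0, lam)) t := by
  obtain ⟨Fl, r, hr, hFl, hFl0, hball, hlin⟩ := exists_flow_ball m
  obtain ⟨ε₁, hε₁, hred⟩ := exists_periodicity_redundant m
  let ev : TimeCurve →L[ℂ] State := ContinuousMap.evalCLM ℂ timeTwoPi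
  -- Keeping `lam` as a last component makes domain and range equal in dimension, so that the
  -- inverse function theorem treats the parameter as well.
  let Θ : State × ℂ → State × ℂ := fun z => (shootingMap (z.1, ev (Fl z) - z.1), z.2)
  let Θ' : State × ℂ →L[ℂ] State × ℂ :=
    (shootingMap ∘L ((ContinuousLinearMap.fst ℂ State ℂ).prod
      (ev ∘L fderiv ℂ Fl 0 - ContinuousLinearMap.fst ℂ State ℂ))).prod
      (ContinuousLinearMap.snd ℂ State ℂ)
  have hΘc : ContDiffAt ℂ ω Θ 0 := by
    have h1 : ContDiffAt ℂ ω (fun z => ev (Fl z)) 0 :=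
      ContDiffAt.comp 0 (g := ev) ev.contDiff.contDiffAt hFl
    have h2 : ContDiffAt ℂ ω (fun z : State × ℂ => shootingMap (z.1, ev (Fl z) - z.1)) 0 :=
      ContDiffAt.comp 0 (g := shootingMap) shootingMap.contDiff.contDiffAt
        (contDiffAt_fst.prodMk (h1.sub contDiffAt_fst))
    exact h2.prodMk contDiffAt_snd
  have hΘd : HasFDerivAt Θ Θ' 0 := by
    have hd : HasFDerivAt Fl (fderiv ℂ Fl 0) 0 := (hFl.differentiableAt (by simp)).hasFDerivAt
    have h1 : HasFDerivAt (fun z => ev (Fl z)) (ev ∘L fderiv ℂ Fl 0) 0 :=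
      HasFDerivAt.comp 0 (g := ev) ev.hasFDerivAt hd
    have h2 : HasFDerivAt (fun z : State × ℂ => shootingMap (z.1, ev (Fl z) - z.1))
        (shootingMap ∘L ((ContinuousLinearMap.fst ℂ State ℂ).prod
          (ev ∘L fderiv ℂ Fl 0 - ContinuousLinearMap.fst ℂ State ℂ))) 0 :=
      HasFDerivAt.comp 0 (g := shootingMap) shootingMap.hasFDerivAt
        (hasFDerivAt_fst.prodMk (h1.sub hasFDerivAt_fst))
    exact h2.prodMk hasFDerivAt_snd
  -- A kernel vector is the initial state of a solution of the linear system with `p₀ = q₀` and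
  -- three periodicity conditions. The fourth then follows, and the nonresonance condition makes the
  -- vector zero. In finite dimension this gives invertibility.
  have hinj : Function.Injective Θ' := by
    rw [injective_iff_map_eq_zero]
    rintro ⟨v, μ⟩ h
    have hμ : μ = 0 := congrArg Prod.snd h
    subst hμ
    obtain ⟨l0, l1⟩ := hlin v
    have h1 : shootingMap (v, fderiv ℂ Fl 0 (v, 0) timeTwoPi - v) = 0 := congrArg Prod.fst h
    set w := fderiv ℂ Fl 0 (v, 0)
    rw [shootingMap_apply] at h1
    have a1 : v.1 - v.2.1 = 0 := congrArg Prod.fst h1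
    have a2 : (w timeTwoPi).1 - v.1 = 0 := congrArg (fun x : State => x.2.1) h1
    have a3 : (w timeTwoPi).2.1 - v.2.1 = 0 := congrArg (fun x : State => x.2.2.1) h1
    have a4 : (w timeTwoPi).2.2.1 - v.2.2.1 = 0 := congrArg (fun x : State => x.2.2.2) h1
    have hw0 : extendTime w 0 = v := by rw [extendTime_zero, l0]
    have hper : extendTime w (2 * Real.pi) = extendTime w 0 := by
      apply linear_periodic_of_three l1 <;> rw [extendTime_two_pi, hw0]
      · exact sub_eq_zero.1 a2
      · exact sub_eq_zero.1 a3
      · exact sub_eq_zero.1 a4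
    have := linear_periodic_eq_zero hm l1 hper (by rw [hw0]; exact sub_eq_zero.1 a1)
    rw [hw0] at this
    rw [this]
    rfl
  let e : (State × ℂ) ≃L[ℂ] (State × ℂ) :=
    (LinearEquiv.ofInjectiveEndo (Θ' : State × ℂ →ₗ[ℂ] State × ℂ) hinj).toContinuousLinearEquiv
  have he : (e : State × ℂ →L[ℂ] State × ℂ) = Θ' :=
    ContinuousLinearMap.ext fun _ => rfl
  have hΘe : HasFDerivAt Θ (e : State × ℂ →L[ℂ] State × ℂ) 0 := he ▸ hΘd
  have hΘs : HasStrictFDerivAt Θ (e : State × ℂ →L[ℂ] State × ℂ) 0 := hΘc.hasStrictFDerivAt' hΘe (by simp)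
  have hΘ0 : Θ 0 = 0 := by
    have h1 : ev (Fl 0) - (0 : State × ℂ).1 = 0 := by
      rw [hFl0, map_zero]; simp
    change (shootingMap (0, ev (Fl 0) - (0 : State × ℂ).1), (0 : ℂ)) = 0
    rw [h1, Prod.mk_zero_zero, map_zero, Prod.mk_zero_zero]
  let G : State × ℂ → State × ℂ := hΘc.localInverse hΘe (by simp)
  have hGc : ContDiffAt ℂ ω G 0 := by
    have := hΘc.to_localInverse hΘe (by simp)
    rwa [hΘ0] at this
  have hG0 : G 0 = 0 := by
    have := hΘc.localInverse_apply_image hΘe (by simp)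
    rwa [hΘ0] at this
  have hright : ∀ᶠ y in 𝓝 0, Θ (G y) = y := by
    have := hΘs.eventually_right_inverse
    rwa [hΘ0] at this
  have hleft : ∀ᶠ z in 𝓝 0, G (Θ z) = z := hΘs.eventually_left_inverse
  -- The targets of the shooting map: prescribed `c`, zero increments of `p`, `q` and `p'`, and the
  -- parameter `lam`.
  let ι : ℂ × ℂ →L[ℂ] State × ℂ := LinearMap.toContinuousLinearMap
    { toFun := fun z => ((z.1, 0, 0, 0), z.2)
      map_add' := fun x y => by simp
      map_smul' := fun c x => by simp }
  have hι : ∀ z, ι z = ((z.1, 0, 0, 0), z.2) := fun _ => rfl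
  have hGι : ContDiffAt ℂ ω (fun z => G (ι z)) 0 :=
    ContDiffAt.comp 0 (g := G) (by rw [map_zero]; exact hGc) ι.contDiff.contDiffAt
  have hGι0 : G (ι 0) = 0 := by rw [map_zero, hG0]
  have hF : ContDiffAt ℂ ω (fun z => Fl (G (ι z))) 0 :=
    ContDiffAt.comp 0 (g := Fl) (by rw [hGι0]; exact hFl) hGι
  refine ⟨fun z => Fl (G (ι z)), hF.analyticAt, by simp only [hGι0, hFl0], ?_, ?_⟩
  · have htend : Tendsto (fun z => G (ι z)) (𝓝 0) (𝓝 0) := by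
      have := hGι.continuousAt
      rwa [ContinuousAt, hGι0] at this
    have h1 := htend.eventually (Metric.ball_mem_nhds 0 (lt_min hr hε₁))
    have hιt : Tendsto ι (𝓝 0) (𝓝 0) := by
      have := ι.continuous.tendsto 0
      rwa [map_zero] at this
    filter_upwards [h1, hιt.eventually hright] with z h1 h2
    have h1 : ‖G (ι z)‖ < min r ε₁ := by simpa using h1
    rw [hι] at h2
    rw [hι] at h1 ⊢
    set g := G ((z.1, 0, 0, 0), z.2)
    obtain ⟨b1, b2, b3⟩ := hball g (h1.trans_le (min_le_left _ _))
    have hg2 : g.2 = z.2 := congrArg Prod.snd h2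
    have h3 : shootingMap (g.1, Fl g timeTwoPi - g.1) = (z.1, 0, 0, 0) := congrArg Prod.fst h2
    rw [shootingMap_apply] at h3
    have a1 : g.1.1 - g.1.2.1 = z.1 := congrArg Prod.fst h3
    have a2 : (Fl g timeTwoPi).1 - g.1.1 = 0 := congrArg (fun x : State => x.2.1) h3
    have a3 : (Fl g timeTwoPi).2.1 - g.1.2.1 = 0 := congrArg (fun x : State => x.2.2.1) h3
    have a4 : (Fl g timeTwoPi).2.2.1 - g.1.2.2.1 = 0 := congrArg (fun x : State => x.2.2.2) h3
    refine ⟨⟨b1, hg2 ▸ b3⟩, ?_, by rw [b2]; exact a1⟩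
    obtain ⟨s1, s2⟩ := isComplexSolOn_of_hasDerivAt isOpen_Ioo b3
      (fun t _ => extendTime_mem_admissibleState b1 t)
    set p := fun t => (extendTime (Fl g) t).1
    set q := fun t => (extendTime (Fl g) t).2.1
    have hst0 : hillState p q 0 = g.1 := by rw [s2 0 zero_mem_Ioo, extendTime_zero, b2]
    have hst2 : hillState p q (2 * Real.pi) = Fl g timeTwoPi := by
      rw [s2 _ two_pi_mem_Ioo, extendTime_two_pi]
    have hgε : ‖g‖ < ε₁ := h1.trans_le (min_le_right _ _)
    have hn1 : ‖hillState p q 0‖ < ε₁ := by rw [hst0]; exact (norm_fst_le g).trans_lt hgε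
    have hn2 := (norm_snd_le (hillState p q 0)).trans_lt hn1
    have hn3 := (norm_snd_le (hillState p q 0).2).trans_lt hn2
    have hinit : SmallInit ε₁ p q := ⟨(norm_fst_le (hillState p q 0)).trans_lt hn1,
      (norm_fst_le (hillState p q 0).2).trans_lt hn2,
      (norm_fst_le (hillState p q 0).2.2).trans_lt hn3,
      (norm_snd_le (hillState p q 0).2.2).trans_lt hn3⟩
    have hfin := (hred g.2 ((norm_snd_le g).trans_lt hgε) (-1) 7 p q (by norm_num) two_pi_mem_Ioo.2
      s1 hinit).1
    have c1 : p (2 * Real.pi) = p 0 := by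
      have x1 := congrArg Prod.fst hst2
      have x2 := congrArg Prod.fst hst0
      simp only [hillState] at x1 x2
      rw [x1, x2]; exact sub_eq_zero.1 a2
    have c2 : q (2 * Real.pi) = q 0 := by
      have x1 := congrArg (fun x : State => x.2.1) hst2
      have x2 := congrArg (fun x : State => x.2.1) hst0
      simp only [hillState] at x1 x2
      rw [x1, x2]; exact sub_eq_zero.1 a3
    have c3 : deriv p (2 * Real.pi) = deriv p 0 := by
      have x1 := congrArg (fun x : State => x.2.2.1) hst2
      have x2 := congrArg (fun x : State => x.2.2.1) hst0
      simp only [hillState] at x1 x2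
      rw [x1, x2]; exact sub_eq_zero.1 a4
    -- The increment of `q'` was not imposed; the energy supplies it. For this the initial state was
    -- kept below `ε₁`.
    have c4 := hfin c1 c2 c3
    rw [b2, ← hst0, ← hst2]
    simp only [hillState, c1, c2, c3, c4]
  · obtain ⟨ε₂, hε₂, hleft'⟩ := Metric.eventually_nhds_iff.1 hleft
    refine ⟨min r ε₂, lt_min hr hε₂, fun lam hlam p q hsol hinit hper t ht => ?_⟩
    have hz := norm_hillState_prod_lt hinit hlam
    obtain ⟨b1, b2, b3⟩ := hball _ (hz.trans_le (min_le_left _ _))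
    have hst : ∀ t ∈ Set.Icc 0 (2 * Real.pi), _ := fun t ht =>
      hillState_eq_of_flow (Set.subset_univ _) hsol b1 b3 b2 ht
    have h2π := hst (2 * Real.pi) ⟨Real.two_pi_pos.le, le_rfl⟩
    rw [hper, extendTime_two_pi] at h2π
    -- A small periodic solution solves the shooting problem for its own `c`, so the left inverse
    -- property returns its initial state.
    have hΘz : Θ (hillState p q 0, lam) = ι (p 0 - q 0, lam) := by
      change (shootingMap (hillState p q 0, Fl (hillState p q 0, lam) timeTwoPi - hillState p q 0),
        lam) = _
      rw [← h2π, sub_self]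
      rfl
    have hG : G (ι (p 0 - q 0, lam)) = (hillState p q 0, lam) := by
      rw [← hΘz]
      exact hleft' (by simpa using hz.trans_le (min_le_right _ _))
    rw [hst t ht]
    simp only [hG]

/-! ### Periodic extension by continuous linear functionals -/

theorem two_pi_complex_ne_zero : (2 * Real.pi : ℂ) ≠ 0 := by exact_mod_cast Real.two_pi_pos.ne'

/-- A `2π`-periodic function, linear in `g`, which is equal to `g` on `[0, 2π)` if
`g 0 = g (2π)`. -/
def periodize (g : TimeFun) (τ : ℝ) : ℂ :=
  extendTime g (toIcoMod Real.two_pi_pos 0 τ) -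
    toIcoMod Real.two_pi_pos 0 τ / (2 * Real.pi) * (g timeTwoPi - g timeZero)

theorem periodize_periodic (g : TimeFun) : Function.Periodic (periodize g) (2 * Real.pi) := fun τ => by
  simp only [periodize, toIcoMod_add_right]

theorem continuous_periodize (g : TimeFun) : Continuous (periodize g) := by
  have : Fact (0 < 2 * Real.pi) := ⟨Real.two_pi_pos⟩
  -- The linear correction equalises the values at `0` and `2π`, so `f` on one period descends to a
  -- continuous function on the circle.
  let f : ℝ → ℂ := fun θ => extendTime g θ - θ / (2 * Real.pi) * (g timeTwoPi - g timeZero)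
  have hf : Continuous f := by
    have := continuous_extendTime g
    fun_prop
  have h0 : f 0 = f (2 * Real.pi) := by
    simp only [f, show extendTime g 0 = g timeZero from extendTime_coe g timeZero,
      show extendTime g (2 * Real.pi) = g timeTwoPi from extendTime_coe g timeTwoPi]
    push_cast
    rw [div_self two_pi_complex_ne_zero]
    ring
  have hc := AddCircle.liftIco_zero_continuous h0 hf.continuousOn
  have he : periodize g = fun τ : ℝ => AddCircle.liftIco (2 * Real.pi) 0 f (τ : AddCircle (2 * Real.pi)) := by
    funext τ
    have hmem : toIcoMod Real.two_pi_pos 0 τ ∈ Set.Ico 0 (2 * Real.pi) := by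
      simpa using toIcoMod_mem_Ico Real.two_pi_pos 0 τ
    have hcoe : (τ : AddCircle (2 * Real.pi)) = (toIcoMod Real.two_pi_pos 0 τ : ℝ) := by
      conv_lhs => rw [← toIcoMod_add_toIcoDiv_zsmul Real.two_pi_pos 0 τ]
      rw [AddCircle.coe_add, AddCircle.coe_zsmul, AddCircle.coe_period, smul_zero, add_zero]
    rw [hcoe, AddCircle.liftIco_zero_coe_apply hmem]
    rfl
  rw [he]
  exact hc.comp (AddCircle.continuous_mk' _)

theorem norm_periodize_le (g : TimeFun) (τ : ℝ) : ‖periodize g τ‖ ≤ 3 * ‖g‖ := by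
  have hmem := toIcoMod_mem_Ico Real.two_pi_pos 0 τ
  rw [zero_add] at hmem
  have h1 : ‖((toIcoMod Real.two_pi_pos 0 τ : ℝ) / (2 * Real.pi) : ℂ)‖ ≤ 1 := by
    rw [show ((toIcoMod Real.two_pi_pos 0 τ : ℝ) / (2 * Real.pi) : ℂ)
      = ((toIcoMod Real.two_pi_pos 0 τ / (2 * Real.pi) : ℝ) : ℂ) by push_cast; rfl,
      Complex.norm_real, Real.norm_eq_abs, abs_of_nonneg (div_nonneg hmem.1 Real.two_pi_pos.le)]
    exact (div_le_one Real.two_pi_pos).2 hmem.2.le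
  have h2 : ‖g timeTwoPi - g timeZero‖ ≤ ‖g‖ + ‖g‖ :=
    (norm_sub_le _ _).trans (add_le_add (g.norm_coe_le_norm _) (g.norm_coe_le_norm _))
  calc ‖periodize g τ‖ ≤ ‖g‖ + 1 * (‖g‖ + ‖g‖) := by
        refine (norm_sub_le _ _).trans (add_le_add (norm_extendTime_le g _) ?_)
        rw [norm_mul]
        exact mul_le_mul h1 h2 (norm_nonneg _) zero_le_one
    _ = 3 * ‖g‖ := by ring

/-- The mean value of `periodize g`. -/
def periodMean (g : TimeFun) : ℂ := (∫ s in (0 : ℝ)..2 * Real.pi, periodize g s) / (2 * Real.pi)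

theorem norm_periodMean_le (g : TimeFun) : ‖periodMean g‖ ≤ 3 * ‖g‖ := by
  rw [periodMean, norm_div, show ‖(2 * Real.pi : ℂ)‖ = 2 * Real.pi by
    simp [abs_of_pos Real.pi_pos], div_le_iff₀ Real.two_pi_pos]
  have := intervalIntegral.norm_integral_le_of_norm_le_const (a := (0 : ℝ)) (b := 2 * Real.pi)
    (fun s _ => norm_periodize_le g s)
  rwa [sub_zero, abs_of_pos Real.two_pi_pos] at this

/-- A `2π`-periodic function of mean zero, linear in `g`, which is equal to `g` on `[0, 2π]` if
`g 0 = g (2π)` and `g` has mean zero on this interval. -/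
def meanFree (g : TimeFun) (τ : ℝ) : ℂ := periodize g τ - periodMean g

theorem meanFree_periodic (g : TimeFun) : Function.Periodic (meanFree g) (2 * Real.pi) := fun τ => by
  rw [meanFree, meanFree, periodize_periodic g τ]

theorem continuous_meanFree (g : TimeFun) : Continuous (meanFree g) :=
  (continuous_periodize g).sub continuous_const

theorem norm_meanFree_le (g : TimeFun) (τ : ℝ) : ‖meanFree g τ‖ ≤ 6 * ‖g‖ := by
  refine (norm_sub_le _ _).trans ?_
  linarith [norm_periodize_le g τ, norm_periodMean_le g]

theorem integral_meanFree (g : TimeFun) : ∫ s in (0 : ℝ)..2 * Real.pi, meanFree g s = 0 := by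
  simp only [meanFree]
  rw [intervalIntegral.integral_sub ((continuous_periodize g).intervalIntegrable _ _)
    (continuous_const.intervalIntegrable _ _), intervalIntegral.integral_const, periodMean, sub_zero,
    Complex.real_smul]
  push_cast
  rw [mul_div_cancel₀ _ two_pi_complex_ne_zero, sub_self]

theorem periodize_add (f g : TimeFun) (τ : ℝ) :
    periodize (f + g) τ = periodize f τ + periodize g τ := by
  simp only [periodize, extendTime, Set.IccExtend, Function.comp_apply, ContinuousMap.add_apply]
  ring

theorem periodize_smul (c : ℂ) (g : TimeFun) (τ : ℝ) :
    periodize (c • g) τ = c * periodize g τ := by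
  simp only [periodize, extendTime, Set.IccExtend, Function.comp_apply, ContinuousMap.smul_apply,
    smul_eq_mul]
  ring

theorem meanFree_add (f g : TimeFun) (τ : ℝ) : meanFree (f + g) τ = meanFree f τ + meanFree g τ := by
  have : periodMean (f + g) = periodMean f + periodMean g := by
    simp only [periodMean, periodize_add]
    rw [intervalIntegral.integral_add ((continuous_periodize f).intervalIntegrable _ _)
      ((continuous_periodize g).intervalIntegrable _ _), add_div]
  rw [meanFree, periodize_add, this, meanFree, meanFree]
  ring

theorem meanFree_smul (c : ℂ) (g : TimeFun) (τ : ℝ) : meanFree (c • g) τ = c * meanFree g τ := by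
  have : periodMean (c • g) = c * periodMean g := by
    simp only [periodMean, periodize_smul]
    rw [intervalIntegral.integral_const_mul, mul_div_assoc]
  rw [meanFree, periodize_smul, this, meanFree]
  ring

/-- `meanFree` as a continuous linear functional. -/
def meanFreeL (τ : ℝ) : TimeFun →L[ℂ] ℂ :=
  LinearMap.mkContinuous
    { toFun := fun g => meanFree g τ
      map_add' := fun f g => meanFree_add f g τ
      map_smul' := fun c g => meanFree_smul c g τ } 6 fun g => norm_meanFree_le g τ

/-- The primitive of `meanFree g` vanishing at `0`, as a continuous linear functional. -/
def primMeanFreeL (τ : ℝ) : TimeFun →L[ℂ] ℂ :=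
  LinearMap.mkContinuous
    { toFun := fun g => ∫ s in (0 : ℝ)..τ, meanFree g s
      map_add' := fun f g => by
        simp only [meanFree_add]
        exact intervalIntegral.integral_add ((continuous_meanFree f).intervalIntegrable _ _)
          ((continuous_meanFree g).intervalIntegrable _ _)
      map_smul' := fun c g => by
        simp only [meanFree_smul]
        exact intervalIntegral.integral_const_mul _ _ } (6 * |τ|) fun g => by
    refine (intervalIntegral.norm_integral_le_of_norm_le_const
      (fun s _ => norm_meanFree_le g s)).trans (le_of_eq ?_)
    rw [sub_zero]
    ring

theorem hasDerivAt_primMeanFreeL (g : TimeFun) (τ : ℝ) :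
    HasDerivAt (fun τ => primMeanFreeL τ g) (meanFreeL τ g) τ :=
  intervalIntegral.integral_hasDerivAt_right ((continuous_meanFree g).intervalIntegrable _ _)
    ((continuous_meanFree g).stronglyMeasurableAtFilter _ _) (continuous_meanFree g).continuousAt

theorem primMeanFreeL_periodic (g : TimeFun) :
    Function.Periodic (fun τ => primMeanFreeL τ g) (2 * Real.pi) := fun τ => by
  change ∫ s in (0 : ℝ)..(τ + 2 * Real.pi), meanFree g s = ∫ s in (0 : ℝ)..τ, meanFree g s
  have hi := fun a b => (continuous_meanFree g).intervalIntegrable (μ := MeasureTheory.volume) a b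
  rw [← intervalIntegral.integral_add_adjacent_intervals (hi 0 τ) (hi τ _),
    (meanFree_periodic g).intervalIntegral_add_eq τ 0, zero_add, integral_meanFree, add_zero]

/-- On genuine periodic data both corrections vanish: the jump because `g` has equal end values, the
mean because `g` is the derivative of `f`, which has equal end values. The linear construction
therefore reproduces the actual solutions. -/
theorem meanFree_eq_of_primitive {f g : TimeFun}
    (hf : ∀ t ∈ Set.Ioo (-1 : ℝ) 7, HasDerivAt (extendTime f) (extendTime g t) t)
    (hf0 : f timeTwoPi = f timeZero) (hg0 : g timeTwoPi = g timeZero) {t : ℝ}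
    (ht : t ∈ Set.Icc 0 (2 * Real.pi)) :
    meanFree g t = extendTime g t ∧ f timeZero + ∫ s in (0 : ℝ)..t, meanFree g s = extendTime f t := by
  have hint : ∀ t ∈ Set.Icc 0 (2 * Real.pi), ∫ s in (0 : ℝ)..t, extendTime g s =
      extendTime f t - f timeZero := by
    intro t ht
    rw [← show extendTime f 0 = f timeZero from extendTime_coe f timeZero]
    refine intervalIntegral.integral_eq_sub_of_hasDerivAt (fun s hs => hf s ?_)
      ((continuous_extendTime g).intervalIntegrable _ _)
    rw [Set.uIcc_of_le ht.1] at hs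
    exact Icc_two_pi_subset ⟨hs.1, hs.2.trans ht.2⟩
  have hper : ∀ t ∈ Set.Icc 0 (2 * Real.pi), periodize g t = extendTime g t := by
    intro t ht
    rcases eq_or_lt_of_le ht.2 with h | h
    -- The endpoint `2π` is separate because reduction modulo the period lands in `[0, 2π)` and
    -- sends it to `0`.
    · have := periodize_periodic g 0
      rw [zero_add] at this
      rw [h, this, periodize, hg0, sub_self, mul_zero, sub_zero,
        (toIcoMod_eq_self Real.two_pi_pos).2 ⟨le_rfl, by simpa using Real.two_pi_pos⟩]
      rw [show extendTime g 0 = g timeZero from extendTime_coe g timeZero,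
        show extendTime g (2 * Real.pi) = g timeTwoPi from extendTime_coe g timeTwoPi, hg0]
    · rw [periodize, hg0, sub_self, mul_zero, sub_zero,
        (toIcoMod_eq_self Real.two_pi_pos).2 ⟨ht.1, by simpa using h⟩]
  have hmean : periodMean g = 0 := by
    have h1 : ∫ s in (0 : ℝ)..2 * Real.pi, periodize g s =
        ∫ s in (0 : ℝ)..2 * Real.pi, extendTime g s := by
      refine intervalIntegral.integral_congr fun s hs => hper s ?_
      rwa [Set.uIcc_of_le Real.two_pi_pos.le] at hs
    rw [periodMean, h1, hint _ ⟨Real.two_pi_pos.le, le_rfl⟩,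
      show extendTime f (2 * Real.pi) = f timeTwoPi from extendTime_coe f timeTwoPi, hf0, sub_self,
      zero_div]
  have hmf : ∀ t ∈ Set.Icc 0 (2 * Real.pi), meanFree g t = extendTime g t := fun t ht => by
    rw [meanFree, hmean, sub_zero, hper t ht]
  refine ⟨hmf t ht, ?_⟩
  have h1 : ∫ s in (0 : ℝ)..t, meanFree g s = ∫ s in (0 : ℝ)..t, extendTime g s := by
    refine intervalIntegral.integral_congr fun s hs => hmf s ?_
    rw [Set.uIcc_of_le ht.1] at hs
    exact ⟨hs.1, hs.2.trans ht.2⟩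
  rw [h1, hint t ht]
  ring

/-- The component `p` of a curve of states. -/
abbrev curveP : TimeCurve →L[ℂ] TimeFun := pointwise (ContinuousLinearMap.fst ℂ ℂ (ℂ × ℂ × ℂ))

/-- The component `q` of a curve of states. -/
abbrev curveQ : TimeCurve →L[ℂ] TimeFun := pointwise
  ((ContinuousLinearMap.fst ℂ ℂ (ℂ × ℂ)) ∘L (ContinuousLinearMap.snd ℂ ℂ (ℂ × ℂ × ℂ)))

/-- The component `p'` of a curve of states. -/
abbrev curveP' : TimeCurve →L[ℂ] TimeFun := pointwise ((ContinuousLinearMap.fst ℂ ℂ ℂ) ∘L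
  (ContinuousLinearMap.snd ℂ ℂ (ℂ × ℂ)) ∘L (ContinuousLinearMap.snd ℂ ℂ (ℂ × ℂ × ℂ)))

/-- The component `q'` of a curve of states. -/
abbrev curveQ' : TimeCurve →L[ℂ] TimeFun := pointwise ((ContinuousLinearMap.snd ℂ ℂ ℂ) ∘L
  (ContinuousLinearMap.snd ℂ ℂ (ℂ × ℂ)) ∘L (ContinuousLinearMap.snd ℂ ℂ (ℂ × ℂ × ℂ)))

/-- Evaluation at the origin of time. -/
abbrev evalZero : TimeFun →L[ℂ] ℂ := ContinuousMap.evalCLM ℂ timeZero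

/-- Extension of curves of states to `2π`-periodic curves `(p, q, p', q')`, at the time `τ`. -/
def periodicState (τ : ℝ) : TimeCurve →L[ℂ] State :=
  (evalZero ∘L curveP + primMeanFreeL τ ∘L curveP').prod
    ((evalZero ∘L curveQ + primMeanFreeL τ ∘L curveQ').prod
      ((meanFreeL τ ∘L curveP').prod (meanFreeL τ ∘L curveQ')))

theorem periodicState_periodic (u : TimeCurve) :
    Function.Periodic (fun τ => periodicState τ u) (2 * Real.pi) := fun τ => by
  have h1 := primMeanFreeL_periodic (curveP' u) τ
  have h2 := primMeanFreeL_periodic (curveQ' u) τ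
  have h3 := meanFree_periodic (curveP' u) τ
  have h4 := meanFree_periodic (curveQ' u) τ
  refine Prod.ext ?_ (Prod.ext ?_ (Prod.ext h3 h4))
  · exact congrArg (fun x => evalZero (curveP u) + x) h1
  · exact congrArg (fun x => evalZero (curveQ u) + x) h2

theorem hasDerivAt_periodicState_p (u : TimeCurve) (τ : ℝ) :
    HasDerivAt (fun τ => (periodicState τ u).1) (periodicState τ u).2.2.1 τ :=
  (hasDerivAt_primMeanFreeL (curveP' u) τ).const_add (evalZero (curveP u))

theorem hasDerivAt_periodicState_q (u : TimeCurve) (τ : ℝ) :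
    HasDerivAt (fun τ => (periodicState τ u).2.1) (periodicState τ u).2.2.2 τ :=
  (hasDerivAt_primMeanFreeL (curveQ' u) τ).const_add (evalZero (curveQ u))

theorem periodicState_eq {m : ℝ} {lam : ℂ} {u : TimeCurve} (hu : IsFlowCurve m lam u)
    (hper : u timeTwoPi = u timeZero) {t : ℝ} (ht : t ∈ Set.Icc 0 (2 * Real.pi)) :
    periodicState t u = extendTime u t := by
  have hd := fun t ht => hu.2 t ht
  have h1 : ∀ t ∈ Set.Ioo (-1 : ℝ) 7,
      HasDerivAt (extendTime (curveP u)) (extendTime (curveP' u) t) t := fun t ht => by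
    have := (ContinuousLinearMap.fst ℝ ℂ (ℂ × ℂ × ℂ)).hasFDerivAt.comp_hasDerivAt t (hd t ht)
    refine this.congr_deriv ?_
    change _ = (extendTime u t).2.2.1
    simp [hillField, linField_apply]
  have h2 : ∀ t ∈ Set.Ioo (-1 : ℝ) 7,
      HasDerivAt (extendTime (curveQ u)) (extendTime (curveQ' u) t) t := fun t ht => by
    have := ((ContinuousLinearMap.fst ℝ ℂ (ℂ × ℂ)) ∘L
      (ContinuousLinearMap.snd ℝ ℂ (ℂ × ℂ × ℂ))).hasFDerivAt.comp_hasDerivAt t (hd t ht)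
    refine this.congr_deriv ?_
    change _ = (extendTime u t).2.2.2
    simp [hillField, linField_apply]
  obtain ⟨a1, a2⟩ := meanFree_eq_of_primitive h1 (congrArg (fun x : State => x.1) hper)
    (congrArg (fun x : State => x.2.2.1) hper) ht
  obtain ⟨b1, b2⟩ := meanFree_eq_of_primitive h2 (congrArg (fun x : State => x.2.1) hper)
    (congrArg (fun x : State => x.2.2.2) hper) ht
  exact Prod.ext a2 (Prod.ext b2 (Prod.ext a1 b1))

theorem norm_periodicState_le {m : ℝ} {lam : ℂ} {u : TimeCurve} (hu : IsFlowCurve m lam u)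
    (hper : u timeTwoPi = u timeZero) (t : ℝ) : ‖periodicState t u‖ ≤ ‖u‖ := by
  obtain ⟨s, hs, he⟩ := (periodicState_periodic u).exists_mem_Ico₀ Real.two_pi_pos t
  rw [he, periodicState_eq hu hper (Set.Ico_subset_Icc_self hs)]
  exact norm_extendTime_le u s

theorem hillField_periodic (m : ℝ) (lam : ℂ) : Function.Periodic (hillField m lam) (2 * Real.pi) := by
  intro t
  have h1 : Complex.exp (2 * Complex.I * ((t + 2 * Real.pi : ℝ) : ℂ)) =
      Complex.exp (2 * Complex.I * t) :=
    Complex.exp_eq_exp_iff_exists_int.2 ⟨2, by push_cast; ring⟩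
  have h2 : Complex.exp (-2 * Complex.I * ((t + 2 * Real.pi : ℝ) : ℂ)) =
      Complex.exp (-2 * Complex.I * t) :=
    Complex.exp_eq_exp_iff_exists_int.2 ⟨-2, by push_cast; ring⟩
  funext u
  simp only [hillField, h1, h2]

/-- The curve `V` agrees with a known solution only on one closed period. One-sided derivatives at
interior times come from `U` directly and are glued; only the seam needs an argument. -/
theorem hasDerivAt_of_periodic {v : ℝ → State → State} (hv : Function.Periodic v (2 * Real.pi))
    {U V : ℝ → State} (hV : Function.Periodic V (2 * Real.pi))
    (hUV : ∀ t ∈ Set.Icc 0 (2 * Real.pi), V t = U t)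
    (hU : ∀ t ∈ Set.Ioo (-1 : ℝ) 7, HasDerivAt U (v t (U t)) t) (t : ℝ) :
    HasDerivAt V (v t (V t)) t := by
  have hpos := Real.two_pi_pos
  have hright : ∀ t ∈ Set.Ico 0 (2 * Real.pi), HasDerivWithinAt V (v t (V t)) (Set.Ici t) t := by
    intro t ht
    have ht' := Set.Ico_subset_Icc_self ht
    rw [hUV t ht']
    refine (hU t (Icc_two_pi_subset ht')).hasDerivWithinAt.congr_of_eventuallyEq ?_ (hUV t ht')
    filter_upwards [Ico_mem_nhdsGE ht.2] with s hs
    exact hUV s ⟨ht.1.trans hs.1, hs.2.le⟩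
  have hleft : ∀ t ∈ Set.Ioc 0 (2 * Real.pi), HasDerivWithinAt V (v t (V t)) (Set.Iic t) t := by
    intro t ht
    have ht' := Set.Ioc_subset_Icc_self ht
    rw [hUV t ht']
    refine (hU t (Icc_two_pi_subset ht')).hasDerivWithinAt.congr_of_eventuallyEq ?_ (hUV t ht')
    filter_upwards [Ioc_mem_nhdsLE ht.1] with s hs
    exact hUV s ⟨hs.1.le, hs.2.trans ht.2⟩
  have hboth : ∀ t, HasDerivWithinAt V (v t (V t)) (Set.Ici t) t →
      HasDerivWithinAt V (v t (V t)) (Set.Iic t) t → HasDerivAt V (v t (V t)) t := by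
    intro t h1 h2
    rw [← hasDerivWithinAt_univ, ← Set.Iic_union_Ici (a := t)]
    exact h2.union h1
  have hIco : ∀ t ∈ Set.Ico 0 (2 * Real.pi), HasDerivAt V (v t (V t)) t := by
    intro t ht
    rcases eq_or_lt_of_le ht.1 with h | h
    · subst h
      refine hboth 0 (hright 0 ht) ?_
      -- To the left of `0` the curve is a copy of `U` to the left of `2π`; periodicity of the field
      -- makes the two one-sided derivatives equal.
      have h1 : HasDerivAt (fun s => U (s + 2 * Real.pi)) (v 0 (V 0)) 0 := by
        have h2 := hU (0 + 2 * Real.pi) (by rw [zero_add]; exact two_pi_mem_Ioo)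
        have h3 := h2.comp_add_const 0 (2 * Real.pi)
        rw [hv 0, ← hUV (0 + 2 * Real.pi) (by rw [zero_add]; exact ⟨hpos.le, le_rfl⟩), hV 0] at h3
        exact h3
      refine h1.hasDerivWithinAt.congr_of_eventuallyEq ?_ ?_
      · filter_upwards [Ioc_mem_nhdsLE (show -(2 * Real.pi) < 0 by linarith)] with s hs
        rw [← hV s]
        exact hUV _ ⟨by linarith [hs.1], by linarith [hs.2]⟩
      · rw [← hV 0]
        exact hUV _ ⟨by linarith, by linarith⟩
    · exact hboth t (hright t ht) (hleft t ⟨h, ht.2.le⟩)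
  have hmem := toIcoMod_mem_Ico hpos 0 t
  rw [zero_add] at hmem
  have h1 := hIco _ hmem
  have ht : toIcoMod hpos 0 t = t - toIcoDiv hpos 0 t * (2 * Real.pi) := by
    rw [toIcoMod, zsmul_eq_mul]
  rw [ht] at h1
  have h2 := h1.comp_sub_const t (toIcoDiv hpos 0 t * (2 * Real.pi))
  rw [hv.sub_int_mul_eq, hV.sub_int_mul_eq] at h2
  have h3 : (fun s => V (s - toIcoDiv hpos 0 t * (2 * Real.pi))) = V := funext fun s =>
    hV.sub_int_mul_eq _
  rwa [h3] at h2

/-- The periodic extension of a periodic flow curve solves the complex system. -/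
theorem isComplexSolOn_periodicState {m : ℝ} {lam : ℂ} {u : TimeCurve} (hu : IsFlowCurve m lam u)
    (hper : u timeTwoPi = u timeZero) :
    IsComplexSolOn m lam Set.univ (fun t => (periodicState t u).1)
      (fun t => (periodicState t u).2.1) := by
  refine (isComplexSolOn_of_hasDerivAt (U := fun t => periodicState t u) isOpen_univ (fun t _ => ?_)
    fun t _ => ?_).1
  · exact hasDerivAt_of_periodic (hillField_periodic m lam) (periodicState_periodic u)
      (fun t ht => periodicState_eq hu hper ht) hu.2 t
  · have h1 := (norm_periodicState_le hu hper t).trans_lt hu.1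
    exact ⟨(norm_fst_le _).trans_lt h1, (norm_fst_le _).trans_lt ((norm_snd_le _).trans_lt h1)⟩

/-! ### Conjugation symmetry and equivalence with the real system -/

open ComplexConjugate in
-- Principal powers with real exponent commute with conjugation away from the negative axis, and
-- `‖z‖ < 1` keeps `1 - z` in the right half plane.
theorem remP_conj {z : ℂ} (hz : ‖z‖ < 1) (w : ℂ) (hw : ‖w‖ < 1) :
    conj (remP z w) = remP (conj z) (conj w) := by
  have key : ∀ x : ℂ, ‖x‖ < 1 → ∀ r : ℂ, conj r = r → conj ((1 - x) ^ r) = (1 - conj x) ^ r := by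
    intro x hx r hr
    have h := Complex.conj_cpow (1 - x) r (Complex.slitPlane_arg_ne_pi (one_sub_mem_slitPlane hx))
    rw [hr] at h
    rw [← h, map_sub, map_one]
  have h1 : conj (-1 / 2 : ℂ) = -1 / 2 := by simp [map_ofNat]
  have h3 : conj (-3 / 2 : ℂ) = -3 / 2 := by simp [map_ofNat]
  simp only [remP, map_sub, map_mul, map_one, key z hz _ h1, key w hw _ h3]
  simp [map_ofNat]

open ComplexConjugate in
-- The left side is `|w^(-1/2)|² / conj w = 1 / (|w| conj w)`. This identifies the product of powers
-- with the inverse square attraction.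
theorem cpow_mul_conj_cpow {w : ℂ} (hw : w ∈ Complex.slitPlane) :
    w ^ (-1 / 2 : ℂ) * (conj w) ^ (-3 / 2 : ℂ) = w / (‖w‖ ^ 3 : ℝ) := by
  have hw0 : w ≠ 0 := Complex.slitPlane_ne_zero hw
  have hc0 : conj w ≠ 0 := (map_ne_zero _).2 hw0
  have hn : (‖w‖ : ℂ) ≠ 0 := by exact_mod_cast (norm_pos_iff.2 hw0).ne'
  have h1 : (conj w) ^ (-1 / 2 : ℂ) = conj (w ^ (-1 / 2 : ℂ)) := by
    have h := Complex.conj_cpow w (-1 / 2) (Complex.slitPlane_arg_ne_pi hw)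
    rw [h]
    simp [map_ofNat]
  have h2 : ‖w ^ (-1 / 2 : ℂ)‖ ^ 2 * ‖w‖ = 1 := by
    have h3 : w ^ (-1 / 2 : ℂ) * w ^ (-1 / 2 : ℂ) * w = 1 := by
      rw [← Complex.cpow_add _ _ hw0]
      norm_num
      rw [Complex.cpow_neg_one, inv_mul_cancel₀ hw0]
    have h4 := congrArg norm h3
    rw [norm_mul, norm_mul, norm_one] at h4
    rw [sq, h4]
  have h3 : (conj w) ^ (-3 / 2 : ℂ) = (conj w) ^ (-1 / 2 : ℂ) * (conj w)⁻¹ := by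
    rw [show (-3 / 2 : ℂ) = -1 / 2 + -1 by norm_num, Complex.cpow_add _ _ hc0, Complex.cpow_neg_one]
  have h5 : w ^ (-1 / 2 : ℂ) * conj (w ^ (-1 / 2 : ℂ)) * ‖w‖ = 1 := by
    rw [Complex.mul_conj, Complex.normSq_eq_norm_sq]
    exact_mod_cast h2
  have h6 : w * conj w = ‖w‖ ^ 2 := by
    rw [Complex.mul_conj, Complex.normSq_eq_norm_sq]
    push_cast
    rfl
  rw [h3, h1, eq_div_iff (by push_cast; exact pow_ne_zero 3 hn)]
  push_cast
  have h7 : (‖w‖ : ℂ) ^ 3 = ‖w‖ * (w * conj w) := by rw [h6]; ring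
  rw [h7]
  have h8 : (conj w)⁻¹ * conj w = 1 := inv_mul_cancel₀ hc0
  linear_combination (w * ((conj w)⁻¹ * conj w)) * h5 + w * h8

/-- The position `x + iy` as a complex number. -/
def orbitZ (a : ℝ) (p : ℝ → ℂ) (τ : ℝ) : ℂ := a * (1 - p τ) * Complex.exp (Complex.I * τ)

theorem exp_I_mul (τ : ℝ) : Complex.exp (Complex.I * τ) = Real.cos τ + Real.sin τ * Complex.I := by
  rw [mul_comm, Complex.exp_mul_I]
  push_cast
  rfl

theorem orbitZ_re (a : ℝ) (p : ℝ → ℂ) (τ : ℝ) : (orbitZ a p τ).re = orbitX a p τ := by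
  rw [orbitZ, exp_I_mul, orbitX]
  simp [Complex.mul_re, Complex.mul_im, -Complex.ofReal_cos, -Complex.ofReal_sin]

theorem orbitZ_im (a : ℝ) (p : ℝ → ℂ) (τ : ℝ) : (orbitZ a p τ).im = orbitY a p τ := by
  rw [orbitZ, exp_I_mul, orbitY]
  simp [Complex.mul_re, Complex.mul_im, -Complex.ofReal_cos, -Complex.ofReal_sin]
  ring

theorem norm_exp_I_mul (τ : ℝ) : ‖Complex.exp (Complex.I * τ)‖ = 1 := by
  rw [mul_comm, Complex.norm_exp_ofReal_mul_I]

theorem hasDerivAt_exp_mul (b : ℂ) (τ : ℝ) :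
    HasDerivAt (fun τ : ℝ => Complex.exp (b * τ)) (b * Complex.exp (b * τ)) τ := by
  have ht' : HasDerivAt (fun s : ℝ => (s : ℂ)) 1 τ := Complex.ofRealCLM.hasDerivAt
  refine (ht'.const_mul b).cexp.congr_deriv ?_
  ring

theorem hasDerivAt_orbitZ (a : ℝ) {p : ℝ → ℂ} {p' : ℂ} {τ : ℝ} (hp : HasDerivAt p p' τ) :
    HasDerivAt (orbitZ a p) (a * (-p' + Complex.I * (1 - p τ)) * Complex.exp (Complex.I * τ)) τ := by
  refine (((hp.const_sub 1).const_mul (a : ℂ)).mul (hasDerivAt_exp_mul Complex.I τ)).congr_deriv ?_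
  ring

theorem hasDerivAt_orbitZ_deriv (a : ℝ) {p p' : ℝ → ℂ} {p'' : ℂ} {τ : ℝ}
    (hp : HasDerivAt p (p' τ) τ) (hp' : HasDerivAt p' p'' τ) :
    HasDerivAt (fun τ => a * (-p' τ + Complex.I * (1 - p τ)) * Complex.exp (Complex.I * τ))
      (a * (-p'' - 2 * Complex.I * p' τ - (1 - p τ)) * Complex.exp (Complex.I * τ)) τ := by
  refine (((hp'.neg.add ((hp.const_sub 1).const_mul Complex.I)).const_mul (a : ℂ)).mul
    (hasDerivAt_exp_mul Complex.I τ)).congr_deriv ?_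
  simp only [Pi.add_apply, Pi.neg_apply]
  linear_combination a * (1 - p τ) * Complex.exp (Complex.I * τ) * Complex.I_sq

theorem HasDerivAt.complex_re {f : ℝ → ℂ} {f' : ℂ} {t : ℝ} (h : HasDerivAt f f' t) :
    HasDerivAt (fun t => (f t).re) f'.re t :=
  Complex.reCLM.hasFDerivAt.comp_hasDerivAt t h

theorem HasDerivAt.complex_im {f : ℝ → ℂ} {f' : ℂ} {t : ℝ} (h : HasDerivAt f f' t) :
    HasDerivAt (fun t => (f t).im) f'.im t :=
  Complex.imCLM.hasFDerivAt.comp_hasDerivAt t h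

theorem HasDerivAt.add_I_mul {f g : ℝ → ℝ} {f' g' t : ℝ} (hf : HasDerivAt f f' t)
    (hg : HasDerivAt g g' t) :
    HasDerivAt (fun t => (f t : ℂ) + g t * Complex.I) (f' + g' * Complex.I) t :=
  hf.ofReal_comp.add (hg.ofReal_comp.mul_const Complex.I)

open ComplexConjugate in
/-- The real system in complex notation. -/
theorem isRealSol_iff_complex {m k lam : ℝ} {x y : ℝ → ℝ} {z z' z'' : ℝ → ℂ}
    (hx : ∀ t, (z t).re = x t) (hy : ∀ t, (z t).im = y t) (hpos : ∀ t, z t ≠ 0)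
    (h1 : ∀ t, HasDerivAt z (z' t) t) (h2 : ∀ t, HasDerivAt z' (z'' t) t) :
    IsRealSol m k lam x y ↔ ∀ t, z'' t + 2 * m * Complex.I * z' t - 3 / 2 * m ^ 2 * z t
      + k * z t / (‖z t‖ ^ 3 : ℝ) = 3 / 2 * lam * conj (z t) := by
  have ex : x = fun t => (z t).re := funext fun t => (hx t).symm
  have ey : y = fun t => (z t).im := funext fun t => (hy t).symm
  have dx : deriv x = fun t => (z' t).re := by
    rw [ex]; exact funext fun t => (h1 t).complex_re.deriv
  have dy : deriv y = fun t => (z' t).im := by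
    rw [ey]; exact funext fun t => (h1 t).complex_im.deriv
  have ddx : deriv (deriv x) = fun t => (z'' t).re := by
    rw [dx]; exact funext fun t => (h2 t).complex_re.deriv
  have ddy : deriv (deriv y) = fun t => (z'' t).im := by
    rw [dy]; exact funext fun t => (h2 t).complex_im.deriv
  have hsq : ∀ t, x t ^ 2 + y t ^ 2 = ‖z t‖ ^ 2 := fun t => by
    rw [← hx, ← hy, ← Complex.normSq_eq_norm_sq, Complex.normSq_apply]; ring
  have hpow : ∀ t, (x t ^ 2 + y t ^ 2) ^ (3 / 2 : ℝ) = ‖z t‖ ^ 3 := fun t => by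
    rw [hsq, ← Real.rpow_natCast, ← Real.rpow_natCast, ← Real.rpow_mul (norm_nonneg _)]
    norm_num
  have hdiv : ∀ t, (k * z t / (‖z t‖ ^ 3 : ℝ)).re = k * x t / ‖z t‖ ^ 3 ∧
      (k * z t / (‖z t‖ ^ 3 : ℝ)).im = k * y t / ‖z t‖ ^ 3 := fun t => by
    rw [Complex.div_ofReal_re, Complex.div_ofReal_im, Complex.re_ofReal_mul, Complex.im_ofReal_mul,
      hx, hy]
    exact ⟨rfl, rfl⟩
  have hre : ∀ t, (z'' t + 2 * m * Complex.I * z' t - 3 / 2 * m ^ 2 * z t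
      + k * z t / (‖z t‖ ^ 3 : ℝ)).re = (z'' t).re - 2 * m * (z' t).im - 3 / 2 * m ^ 2 * x t
      + k * x t / ‖z t‖ ^ 3 := fun t => by
    rw [Complex.add_re, (hdiv t).1,
      show (2 * m * Complex.I * z' t : ℂ) = ((2 * m : ℝ) : ℂ) * (Complex.I * z' t) by push_cast; ring,
      show (3 / 2 * m ^ 2 * z t : ℂ) = ((3 / 2 * m ^ 2 : ℝ) : ℂ) * z t by push_cast; ring,
      Complex.sub_re, Complex.add_re, Complex.re_ofReal_mul, Complex.re_ofReal_mul, hx,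
      Complex.I_mul_re]
    ring
  have him : ∀ t, (z'' t + 2 * m * Complex.I * z' t - 3 / 2 * m ^ 2 * z t
      + k * z t / (‖z t‖ ^ 3 : ℝ)).im = (z'' t).im + 2 * m * (z' t).re - 3 / 2 * m ^ 2 * y t
      + k * y t / ‖z t‖ ^ 3 := fun t => by
    rw [Complex.add_im, (hdiv t).2,
      show (2 * m * Complex.I * z' t : ℂ) = ((2 * m : ℝ) : ℂ) * (Complex.I * z' t) by push_cast; ring,
      show (3 / 2 * m ^ 2 * z t : ℂ) = ((3 / 2 * m ^ 2 : ℝ) : ℂ) * z t by push_cast; ring,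
      Complex.sub_im, Complex.add_im, Complex.im_ofReal_mul, Complex.im_ofReal_mul, hy,
      Complex.I_mul_im]
  have hrre : ∀ t, (3 / 2 * lam * conj (z t) : ℂ).re = 3 / 2 * lam * x t := fun t => by
    rw [show (3 / 2 * lam * conj (z t) : ℂ) = ((3 / 2 * lam : ℝ) : ℂ) * conj (z t) by push_cast; ring,
      Complex.re_ofReal_mul, Complex.conj_re, hx]
  have hrim : ∀ t, (3 / 2 * lam * conj (z t) : ℂ).im = -(3 / 2) * lam * y t := fun t => by
    rw [show (3 / 2 * lam * conj (z t) : ℂ) = ((3 / 2 * lam : ℝ) : ℂ) * conj (z t) by push_cast; ring,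
      Complex.im_ofReal_mul, Complex.conj_im, hy]
    ring
  constructor
  · intro h t
    apply Complex.ext
    · rw [hre, hrre, ← h.eq_x t, ddx, dy, hpow]
    · rw [him, hrim, ← h.eq_y t, ddy, dx, hpow]
  · intro h
    refine ⟨fun t => ?_, ?_, ?_, ?_, ?_, fun t => ?_, fun t => ?_⟩
    · rw [hsq]
      exact pow_pos (norm_pos_iff.2 (hpos t)) 2
    · rw [ex]; exact fun t => (h1 t).complex_re.differentiableAt
    · rw [ey]; exact fun t => (h1 t).complex_im.differentiableAt
    · rw [dx]; exact fun t => (h2 t).complex_re.differentiableAt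
    · rw [dy]; exact fun t => (h2 t).complex_im.differentiableAt
    · rw [ddx, dy, hpow, ← hrre, ← h t, hre]
    · rw [ddy, dx, hpow, ← hrim, ← h t, him]

open ComplexConjugate in
/-- With `q` the conjugate of `p` the two complex equations are equivalent. -/
theorem isComplexSolOn_conj_iff {m lam : ℝ} {p : ℝ → ℂ} (hp : ∀ τ, ‖p τ‖ < 1) :
    IsComplexSolOn m lam Set.univ p (fun τ => conj (p τ)) ↔
      Differentiable ℝ p ∧ Differentiable ℝ (deriv p) ∧ ∀ τ,
        deriv (deriv p) τ + 2 * (1 + m) * Complex.I * deriv p τ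
          - 3 / 2 * hillL m * (p τ + conj (p τ)) =
        3 / 2 * lam * (conj (p τ) - 1) * Complex.exp (-2 * Complex.I * τ)
          + hillL m * remP (p τ) (conj (p τ)) := by
  have hd : deriv (fun τ => conj (p τ)) = fun τ => conj (deriv p τ) := funext fun τ => deriv.star
  have hdd : deriv (fun τ => conj (deriv p τ)) = fun τ => conj (deriv (deriv p) τ) :=
    funext fun τ => deriv.star
  constructor
  · intro h
    exact ⟨fun τ => h.diff_p τ trivial, fun τ => h.diff_p' τ trivial, fun τ => h.eq_p τ trivial⟩
  · rintro ⟨h1, h2, h3⟩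
    have hpc : ∀ τ, ‖conj (p τ)‖ < 1 := fun τ => by rw [Complex.norm_conj]; exact hp τ
    refine ⟨fun τ _ => hp τ, fun τ _ => hpc τ, fun τ _ => h1 τ, fun τ _ => (h1 τ).star,
      fun τ _ => h2 τ, fun τ _ => ?_, fun τ _ => h3 τ, fun τ _ => ?_⟩
    · rw [hd]; exact (h2 τ).star
    · rw [hd, hdd]
      have h4 := congrArg conj (h3 τ)
      have he : conj (Complex.exp (-2 * Complex.I * τ)) = Complex.exp (2 * Complex.I * τ) := by
        rw [← Complex.exp_conj]
        simp [map_ofNat]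
      simp only [map_add, map_sub, map_mul, remP_conj (hp τ) _ (hpc τ), he, Complex.conj_conj,
        Complex.conj_ofReal, Complex.conj_I, map_one, map_div₀, map_ofNat] at h4
      rw [remQ_eq_remP, ← sub_eq_zero]
      rw [← sub_eq_zero] at h4
      linear_combination h4

open ComplexConjugate in
/-- Equivalence of the real and the complex system. -/
theorem isComplexSolOn_iff_isRealSol {m a k : ℝ} (ha : 0 < a) (hk : k / a ^ 3 = hillL m) (lam : ℝ)
    (p : ℝ → ℂ) (hp : ∀ τ, ‖p τ‖ < 1) :
    IsComplexSolOn m lam Set.univ p (fun τ => conj (p τ)) ↔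
      IsRealSol m k lam (orbitX a p) (orbitY a p) := by
  have ha0 : (a : ℂ) ≠ 0 := by exact_mod_cast ha.ne'
  have main : Differentiable ℝ p → Differentiable ℝ (deriv p) →
      (IsRealSol m k lam (orbitX a p) (orbitY a p) ↔ ∀ τ,
        deriv (deriv p) τ + 2 * (1 + m) * Complex.I * deriv p τ
          - 3 / 2 * hillL m * (p τ + conj (p τ)) =
        3 / 2 * lam * (conj (p τ) - 1) * Complex.exp (-2 * Complex.I * τ)
          + hillL m * remP (p τ) (conj (p τ))) := by
    intro h1 h2
    have hne : ∀ τ, orbitZ a p τ ≠ 0 := fun τ =>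
      mul_ne_zero (mul_ne_zero ha0 (one_sub_ne_zero_of_norm_lt_one (hp τ))) (Complex.exp_ne_zero _)
    rw [isRealSol_iff_complex (orbitZ_re a p) (orbitZ_im a p) hne
      (fun τ => hasDerivAt_orbitZ a (h1 τ).hasDerivAt)
      (fun τ => hasDerivAt_orbitZ_deriv a (h1 τ).hasDerivAt (h2 τ).hasDerivAt)]
    refine forall_congr' fun τ => ?_
    have hw := one_sub_mem_slitPlane (hp τ)
    have hrem := cpow_mul_conj_cpow hw
    have hn : ‖orbitZ a p τ‖ = a * ‖1 - p τ‖ := by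
      rw [orbitZ, norm_mul, norm_mul, norm_exp_I_mul, Complex.norm_real, Real.norm_eq_abs,
        abs_of_pos ha, mul_one]
    -- Here `k / a ^ 3 = l` enters. The choice of `l` also balances the inertial terms: rotation,
    -- Coriolis and quadratic terms sum to `-(1 + 2m + (3/2) m²)(1 - p)`.
    have hgrav : (k * orbitZ a p τ / (‖orbitZ a p τ‖ ^ 3 : ℝ) : ℂ) =
        a * (hillL m * ((1 - p τ) ^ (-1 / 2 : ℂ) * (conj (1 - p τ)) ^ (-3 / 2 : ℂ)))
          * Complex.exp (Complex.I * τ) := by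
      rw [hrem, hn, ← hk, orbitZ]
      have hn0 : (‖1 - p τ‖ : ℂ) ≠ 0 := by
        exact_mod_cast (norm_pos_iff.2 (one_sub_ne_zero_of_norm_lt_one (hp τ))).ne'
      push_cast
      field_simp
    have hconj : conj (orbitZ a p τ) = a * (1 - conj (p τ)) *
        (Complex.exp (-2 * Complex.I * τ) * Complex.exp (Complex.I * τ)) := by
      rw [orbitZ, ← Complex.exp_add, map_mul, map_mul, ← Complex.exp_conj]
      simp only [map_sub, map_one, map_mul, Complex.conj_ofReal, Complex.conj_I]
      congr 2
      ring
    have hl : (hillL m : ℂ) = 1 + 2 * m + 3 / 2 * m ^ 2 := by simp [hillL]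
    have hE : (a : ℂ) * Complex.exp (Complex.I * τ) ≠ 0 := mul_ne_zero ha0 (Complex.exp_ne_zero _)
    rw [hgrav, hconj, orbitZ, remP]
    simp only [map_sub, map_one]
    have hI := Complex.I_sq
    constructor
    · intro h
      apply mul_left_cancel₀ hE
      linear_combination -h + a * Complex.exp (Complex.I * τ) * (1 - p τ) * (2 * m * hI + hl)
    · intro h
      linear_combination -(a * Complex.exp (Complex.I * τ)) * h
        + a * Complex.exp (Complex.I * τ) * (1 - p τ) * (2 * m * hI + hl)
  rw [isComplexSolOn_conj_iff hp]
  constructor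
  · rintro ⟨h1, h2, h3⟩
    exact (main h1 h2).2 h3
  · intro h
    -- Nothing is assumed about the regularity of `p` in this direction; solving for `p` transfers
    -- the differentiability of `x` and `y` to it.
    have hZ : ∀ τ, p τ = 1 - (orbitX a p τ + orbitY a p τ * Complex.I) *
        Complex.exp (-Complex.I * τ) / a := by
      intro τ
      rw [← orbitZ_re, ← orbitZ_im, Complex.re_add_im, orbitZ, mul_assoc, ← Complex.exp_add]
      have : Complex.I * τ + -Complex.I * τ = 0 := by ring
      rw [this, Complex.exp_zero]
      field_simp
      ring
    have hd1 : ∀ τ, HasDerivAt p (-(((deriv (orbitX a p) τ + deriv (orbitY a p) τ * Complex.I) *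
        Complex.exp (-Complex.I * τ) + (orbitX a p τ + orbitY a p τ * Complex.I) *
        (-Complex.I * Complex.exp (-Complex.I * τ))) / a)) τ := by
      intro τ
      have h1 := ((((h.diff_x τ).hasDerivAt.add_I_mul (h.diff_y τ).hasDerivAt).mul
        (hasDerivAt_exp_mul (-Complex.I) τ)).div_const (a : ℂ)).const_sub 1
      exact h1.congr_of_eventuallyEq (Eventually.of_forall hZ)
    have hd2 : Differentiable ℝ (deriv p) := by
      intro τ
      rw [show deriv p = _ from funext fun τ => (hd1 τ).deriv]
      have e := (hasDerivAt_exp_mul (-Complex.I) τ)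
      have h1 := ((h.diff_x τ).hasDerivAt.add_I_mul (h.diff_y τ).hasDerivAt)
      have h2 := ((h.diff_x' τ).hasDerivAt.add_I_mul (h.diff_y' τ).hasDerivAt)
      exact (((h2.mul e).add (h1.mul (e.const_mul (-Complex.I)))).div_const (a : ℂ)).neg.differentiableAt
    have hd1' : Differentiable ℝ p := fun τ => (hd1 τ).differentiableAt
    exact ⟨hd1', hd2, (main hd1' hd2).1 h⟩

/-- The hypothesis holds for the lunar value of `m`. -/
theorem sin_pi_hillChi_lunar_ne_zero : Complex.sin (Real.pi * hillChi 0.080848933808312) ≠ 0 := by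
  intro h
  obtain ⟨n, hn⟩ := Complex.sin_eq_zero_iff.1 h
  have hpi : (Real.pi : ℂ) ≠ 0 := by exact_mod_cast Real.pi_ne_zero
  have h1 : hillChi 0.080848933808312 = n := mul_left_cancel₀ hpi (by rw [hn, mul_comm])
  have h2 := hillChi_sq 0.080848933808312
  rw [h1] at h2
  have h3 : ((n : ℝ)) ^ 2 = 1 + 2 * 0.080848933808312 - 0.080848933808312 ^ 2 / 2 := by
    exact_mod_cast h2
  -- A zero of the sine would make `χ` an integer with square strictly between `1` and `4`.
  have h4 : (1 : ℝ) < (n : ℝ) ^ 2 := by rw [h3]; norm_num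
  have h5 : (n : ℝ) ^ 2 < 4 := by rw [h3]; norm_num
  have h6 : 1 < n ^ 2 := by exact_mod_cast h4
  have h7 : n ^ 2 < 4 := by exact_mod_cast h5
  have h8 : n < 2 := by nlinarith
  have h9 : -2 < n := by nlinarith
  interval_cases n <;> omega

open ComplexConjugate in
/-- The symmetry of the complex system under conjugation. -/
theorem IsComplexSolOn.conj {m lam : ℝ} {p q : ℝ → ℂ} (h : IsComplexSolOn m lam Set.univ p q) :
    IsComplexSolOn m lam Set.univ (fun τ => conj (q τ)) (fun τ => conj (p τ)) := by
  have hd : ∀ f : ℝ → ℂ, deriv (fun τ => conj (f τ)) = fun τ => conj (deriv f τ) :=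
    fun f => funext fun τ => deriv.star
  have hn : ∀ z : ℂ, ‖z‖ < 1 → ‖conj z‖ < 1 := fun z hz => by rwa [Complex.norm_conj]
  have he : ∀ τ : ℝ, conj (Complex.exp (-2 * Complex.I * τ)) = Complex.exp (2 * Complex.I * τ) :=
    fun τ => by rw [← Complex.exp_conj]; simp [map_ofNat]
  have he' : ∀ τ : ℝ, conj (Complex.exp (2 * Complex.I * τ)) = Complex.exp (-2 * Complex.I * τ) :=
    fun τ => by rw [← Complex.exp_conj]; simp [map_ofNat]
  refine ⟨fun τ hτ => hn _ (h.norm_q_lt τ hτ), fun τ hτ => hn _ (h.norm_p_lt τ hτ),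
    fun τ hτ => (h.diff_q τ hτ).star, fun τ hτ => (h.diff_p τ hτ).star, fun τ hτ => ?_,
    fun τ hτ => ?_, fun τ hτ => ?_, fun τ hτ => ?_⟩
  · rw [hd]; exact (h.diff_q' τ hτ).star
  · rw [hd]; exact (h.diff_p' τ hτ).star
  · rw [hd, hd]
    have h4 := congrArg conj (h.eq_q τ hτ)
    rw [remQ_eq_remP] at h4
    simp only [map_add, map_sub, map_mul, remP_conj (h.norm_q_lt τ hτ) _ (h.norm_p_lt τ hτ), he',
      Complex.conj_ofReal, Complex.conj_I, map_one, map_div₀, map_ofNat] at h4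
    linear_combination h4
  · rw [hd, hd]
    have h4 := congrArg conj (h.eq_p τ hτ)
    rw [remQ_eq_remP]
    simp only [map_add, map_sub, map_mul, remP_conj (h.norm_p_lt τ hτ) _ (h.norm_q_lt τ hτ), he,
      Complex.conj_ofReal, Complex.conj_I, map_one, map_div₀, map_ofNat] at h4
    linear_combination h4

/-! ### The periodic family and its series -/

theorem Function.Periodic.deriv {f : ℝ → ℂ} {T : ℝ} (h : Function.Periodic f T) :
    Function.Periodic (deriv f) T := fun x => by
  rw [← deriv_comp_add_const f T x, show (fun x => f (x + T)) = f from funext h]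

theorem hillState_periodic {p q : ℝ → ℂ} {T : ℝ} (hp : Function.Periodic p T)
    (hq : Function.Periodic q T) : Function.Periodic (hillState p q) T := fun t => by
  simp only [hillState, hp t, hq t, hp.deriv t, hq.deriv t]

theorem eq_of_periodic {α : Type*} {U V : ℝ → α} (hU : Function.Periodic U (2 * Real.pi))
    (hV : Function.Periodic V (2 * Real.pi)) (h : ∀ t ∈ Set.Icc 0 (2 * Real.pi), U t = V t) :
    U = V := by
  funext t
  have hmem := toIcoMod_mem_Ico Real.two_pi_pos 0 t
  rw [zero_add] at hmem
  have ht : toIcoMod Real.two_pi_pos 0 t = t - toIcoDiv Real.two_pi_pos 0 t * (2 * Real.pi) := by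
    rw [toIcoMod, zsmul_eq_mul]
  have h1 := h _ (Set.Ico_subset_Icc_self hmem)
  rwa [ht, hU.sub_int_mul_eq, hV.sub_int_mul_eq] at h1

/-- The analytic family of periodic solutions, with parameters `c = p₀ - q₀` and `λ`. -/
theorem exists_periodic_family (m : ℝ) (hm : Complex.sin (Real.pi * hillChi m) ≠ 0) :
    ∃ (F : ℂ × ℂ → TimeCurve) (a : ℕ × ℕ → TimeCurve) (δ ε : ℝ), 0 < δ ∧ δ ≤ ε ∧
      ContinuousAt F 0 ∧ F 0 = 0 ∧
      (∀ c lam : ℂ, ‖c‖ < δ → ‖lam‖ < δ →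
        IsFlowCurve m lam (F (c, lam)) ∧ F (c, lam) timeTwoPi = F (c, lam) timeZero ∧
        (F (c, lam) timeZero).1 - (F (c, lam) timeZero).2.1 = c ∧ ‖F (c, lam)‖ < ε ∧
        Summable (fun n => ‖(c ^ n.1 * lam ^ n.2) • a n‖) ∧
        HasSum (fun n => (c ^ n.1 * lam ^ n.2) • a n) (F (c, lam))) ∧
      ∀ lam : ℂ, ‖lam‖ < δ → ∀ p q : ℝ → ℂ, IsComplexSolOn m lam Set.univ p q → SmallInit ε p q →
        Function.Periodic p (2 * Real.pi) → Function.Periodic q (2 * Real.pi) → ‖p 0 - q 0‖ < δ →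
        hillState p q = fun t => periodicState t (F (p 0 - q 0, lam)) := by
  obtain ⟨F, hF, hF0, hev, ε, hε, huniq⟩ := exists_periodic_curves m hm
  obtain ⟨r, a, hr, hser⟩ := hF.exists_double_series
  -- Members of the family must themselves lie in the range of the uniqueness statement, so that it
  -- can later be applied to their conjugates.
  have hsmall : ∀ᶠ z in 𝓝 (0 : ℂ × ℂ), ‖F z‖ < ε := by
    refine hF.continuousAt.norm.eventually_lt_const ?_
    simpa only [hF0, norm_zero] using hε
  obtain ⟨δ, hδ, hball⟩ := Metric.eventually_nhds_iff.1 (hev.and hsmall)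
  have hz : ∀ c lam : ℂ, ‖c‖ < δ → ‖lam‖ < δ → dist (c, lam) 0 < δ := fun c lam hc hl => by
    rw [dist_zero_right]
    exact max_lt hc hl
  refine ⟨F, a, min (min δ r) ε, ε, lt_min (lt_min hδ hr) hε, min_le_right _ _, hF.continuousAt,
    hF0, fun c lam hc hl => ?_, fun lam hl p q hpq hs hp hq hc => ?_⟩
  · simp only [lt_min_iff] at hc hl
    obtain ⟨⟨h1, h2, h3⟩, h4⟩ := hball (hz c lam hc.1.1 hl.1.1)
    obtain ⟨h5, h6⟩ := hser c lam hc.1.2 hl.1.2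
    exact ⟨h1, h2, h3, h4, h5, h6⟩
  · simp only [lt_min_iff] at hc hl
    obtain ⟨⟨h1, h2, -⟩, -⟩ := hball (hz _ lam hc.1.1 hl.1.1)
    have hper := hillState_periodic hp hq
    refine eq_of_periodic hper (periodicState_periodic _) fun t ht => ?_
    rw [periodicState_eq h1 h2 ht]
    refine huniq lam hl.2 p q hpq hs ?_ t ht
    have := hper 0
    rwa [zero_add] at this

/-- Convergence in the space of curves is pushed through a continuous functional, with the operator
norm as majorant. Values and derivatives of `p` and `q` at any time are all of this form. -/
theorem hasAbsSeries_apply {E : Type*} [NormedAddCommGroup E] [NormedSpace ℂ E] {a : ℕ × ℕ → E}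
    {c lam : ℂ} {s : E} (hn : Summable fun n => ‖(c ^ n.1 * lam ^ n.2) • a n‖)
    (hs : HasSum (fun n => (c ^ n.1 * lam ^ n.2) • a n) s) (L : E →L[ℂ] ℂ) :
    HasAbsSeries (fun n => L (a n)) c lam (L s) := by
  have he : ∀ n : ℕ × ℕ, L (a n) * c ^ n.1 * lam ^ n.2 = L ((c ^ n.1 * lam ^ n.2) • a n) :=
    fun n => by rw [map_smul, smul_eq_mul]; ring
  simp only [HasAbsSeries, he]
  exact ⟨Summable.of_nonneg_of_le (fun _ => norm_nonneg _) (fun n => L.le_opNorm _)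
    (hn.mul_left ‖L‖), L.hasSum hs⟩

theorem hasAbsSeries_periodicState {a : ℕ × ℕ → TimeCurve} {c lam : ℂ} {u : TimeCurve}
    (hn : Summable fun n => ‖(c ^ n.1 * lam ^ n.2) • a n‖)
    (hs : HasSum (fun n => (c ^ n.1 * lam ^ n.2) • a n) u) (τ : ℝ) :
    HasAbsSeries (fun n => (periodicState τ (a n)).1) c lam (periodicState τ u).1 ∧
      HasAbsSeries (fun n => (periodicState τ (a n)).2.1) c lam (periodicState τ u).2.1 ∧
      HasAbsSeries (fun n => (periodicState τ (a n)).2.2.1) c lam (periodicState τ u).2.2.1 ∧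
      HasAbsSeries (fun n => (periodicState τ (a n)).2.2.2) c lam (periodicState τ u).2.2.2 := by
  have h : ∀ L : State →L[ℂ] ℂ,
      HasAbsSeries (fun n => L (periodicState τ (a n))) c lam (L (periodicState τ u)) := fun L =>
    hasAbsSeries_apply (E := TimeCurve) (a := a) hn hs (L ∘L periodicState τ)
  exact ⟨h (ContinuousLinearMap.fst ℂ ℂ (ℂ × ℂ × ℂ)),
    h ((ContinuousLinearMap.fst ℂ ℂ (ℂ × ℂ)) ∘L (ContinuousLinearMap.snd ℂ ℂ (ℂ × ℂ × ℂ))),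
    h ((ContinuousLinearMap.fst ℂ ℂ ℂ) ∘L (ContinuousLinearMap.snd ℂ ℂ (ℂ × ℂ)) ∘L
      (ContinuousLinearMap.snd ℂ ℂ (ℂ × ℂ × ℂ))),
    h ((ContinuousLinearMap.snd ℂ ℂ ℂ) ∘L (ContinuousLinearMap.snd ℂ ℂ (ℂ × ℂ)) ∘L
      (ContinuousLinearMap.snd ℂ ℂ (ℂ × ℂ × ℂ)))⟩

/-! ### Convergence of orbits to the circular motion -/

theorem norm_orbitZ_sub_le {a : ℝ} (ha : 0 < a) (p : ℝ → ℂ) (τ : ℝ) :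
    ‖orbitZ a p τ - a * Complex.exp (Complex.I * τ)‖ ≤ a * ‖p τ‖ := by
  rw [show orbitZ a p τ - a * Complex.exp (Complex.I * τ) =
    -(a * p τ * Complex.exp (Complex.I * τ)) by rw [orbitZ]; ring, norm_neg, norm_mul, norm_mul,
    norm_exp_I_mul, mul_one, Complex.norm_real, Real.norm_of_nonneg ha.le]

theorem norm_orbitZ_deriv_sub_le {a : ℝ} (ha : 0 < a) (w w' : ℂ) (τ : ℝ) :
    ‖a * (-w' + Complex.I * (1 - w)) * Complex.exp (Complex.I * τ) -
      a * Complex.I * Complex.exp (Complex.I * τ)‖ ≤ a * (‖w'‖ + ‖w‖) := by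
  rw [show a * (-w' + Complex.I * (1 - w)) * Complex.exp (Complex.I * τ) -
    a * Complex.I * Complex.exp (Complex.I * τ) =
    -(a * (w' + Complex.I * w) * Complex.exp (Complex.I * τ)) by ring, norm_neg, norm_mul, norm_mul,
    norm_exp_I_mul, mul_one, Complex.norm_real, Real.norm_of_nonneg ha.le]
  refine mul_le_mul_of_nonneg_left ((norm_add_le _ _).trans_eq ?_) ha.le
  rw [norm_mul, Complex.norm_I, one_mul]

theorem abs_orbitX_sub_le {a : ℝ} (ha : 0 < a) (p : ℝ → ℂ) (τ : ℝ) :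
    |orbitX a p τ - a * Real.cos τ| ≤ a * ‖p τ‖ := by
  refine le_trans (le_of_eq ?_) ((Complex.abs_re_le_norm _).trans (norm_orbitZ_sub_le ha p τ))
  rw [Complex.sub_re, orbitZ_re, exp_I_mul, Complex.re_ofReal_mul]
  simp [-Complex.ofReal_cos, -Complex.ofReal_sin]

theorem abs_orbitY_sub_le {a : ℝ} (ha : 0 < a) (p : ℝ → ℂ) (τ : ℝ) :
    |orbitY a p τ - a * Real.sin τ| ≤ a * ‖p τ‖ := by
  refine le_trans (le_of_eq ?_) ((Complex.abs_im_le_norm _).trans (norm_orbitZ_sub_le ha p τ))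
  rw [Complex.sub_im, orbitZ_im, exp_I_mul, Complex.im_ofReal_mul]
  simp [-Complex.ofReal_cos, -Complex.ofReal_sin]

theorem abs_deriv_orbitX_sub_le {a : ℝ} (ha : 0 < a) {p : ℝ → ℂ} {p' : ℂ} {τ : ℝ}
    (hp : HasDerivAt p p' τ) :
    |deriv (orbitX a p) τ - -a * Real.sin τ| ≤ a * (‖p'‖ + ‖p τ‖) := by
  have hd := (hasDerivAt_orbitZ a hp).complex_re
  rw [show (fun t => (orbitZ a p t).re) = orbitX a p from funext (orbitZ_re a p)] at hd
  refine le_trans (le_of_eq ?_)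
    ((Complex.abs_re_le_norm _).trans (norm_orbitZ_deriv_sub_le ha (p τ) p' τ))
  rw [hd.deriv, Complex.sub_re, mul_assoc (a : ℂ) Complex.I, Complex.re_ofReal_mul a (_ * _),
    Complex.I_mul_re, exp_I_mul]
  simp [-Complex.ofReal_cos, -Complex.ofReal_sin]

theorem abs_deriv_orbitY_sub_le {a : ℝ} (ha : 0 < a) {p : ℝ → ℂ} {p' : ℂ} {τ : ℝ}
    (hp : HasDerivAt p p' τ) :
    |deriv (orbitY a p) τ - a * Real.cos τ| ≤ a * (‖p'‖ + ‖p τ‖) := by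
  have hd := (hasDerivAt_orbitZ a hp).complex_im
  rw [show (fun t => (orbitZ a p t).im) = orbitY a p from funext (orbitZ_im a p)] at hd
  refine le_trans (le_of_eq ?_)
    ((Complex.abs_im_le_norm _).trans (norm_orbitZ_deriv_sub_le ha (p τ) p' τ))
  rw [hd.deriv, Complex.sub_im, mul_assoc (a : ℂ) Complex.I, Complex.im_ofReal_mul a (_ * _),
    Complex.I_mul_im, exp_I_mul]
  simp [-Complex.ofReal_cos, -Complex.ofReal_sin]

theorem orbitX_periodic {p : ℝ → ℂ} (hp : Function.Periodic p (2 * Real.pi)) (a : ℝ) :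
    Function.Periodic (orbitX a p) (2 * Real.pi) := fun τ => by
  simp only [orbitX, hp τ, Real.cos_add_two_pi, Real.sin_add_two_pi]

theorem orbitY_periodic {p : ℝ → ℂ} (hp : Function.Periodic p (2 * Real.pi)) (a : ℝ) :
    Function.Periodic (orbitY a p) (2 * Real.pi) := fun τ => by
  simp only [orbitY, hp τ, Real.cos_add_two_pi, Real.sin_add_two_pi]

theorem tendstoUniformly_of_norm_le {X : Type*} [TopologicalSpace X] {G : Type*}
    [SeminormedAddCommGroup G] {x₀ : X} {s : X → ℝ} (hs : Tendsto s (𝓝 x₀) (𝓝 0))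
    {f : X → ℝ → G} {g : ℝ → G} {K : ℝ} (h : ∀ᶠ x in 𝓝 x₀, ∀ τ, ‖f x τ - g τ‖ ≤ K * s x) :
    TendstoUniformly f g (𝓝 x₀) := by
  refine Metric.tendstoUniformly_iff.2 fun η hη => ?_
  have h0 : Tendsto (fun x => K * s x) (𝓝 x₀) (𝓝 0) := by simpa using hs.const_mul K
  filter_upwards [h, h0.eventually_lt_const hη] with x hx hx' τ
  rw [dist_comm, dist_eq_norm]
  exact (hx τ).trans_lt hx'

/-- Uniform convergence of the orbits of a family of curves to the circular motion. -/
theorem tendstoUniformly_orbit {X : Type*} [TopologicalSpace X] {x₀ : X} {s : X → ℝ}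
    (hs : Tendsto s (𝓝 x₀) (𝓝 0)) {p p' : X → ℝ → ℂ} (hp : ∀ x τ, HasDerivAt (p x) (p' x τ) τ)
    (h : ∀ᶠ x in 𝓝 x₀, ∀ τ, ‖p x τ‖ ≤ s x ∧ ‖p' x τ‖ ≤ s x) {a : ℝ} (ha : 0 < a) :
    TendstoUniformly (fun x => orbitX a (p x)) (fun τ => a * Real.cos τ) (𝓝 x₀) ∧
      TendstoUniformly (fun x => orbitY a (p x)) (fun τ => a * Real.sin τ) (𝓝 x₀) ∧
      TendstoUniformly (fun x => deriv (orbitX a (p x))) (fun τ => -a * Real.sin τ) (𝓝 x₀) ∧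
      TendstoUniformly (fun x => deriv (orbitY a (p x))) (fun τ => a * Real.cos τ) (𝓝 x₀) := by
  have key : ∀ {w w' : ℂ} {s : ℝ}, ‖w‖ ≤ s ∧ ‖w'‖ ≤ s → a * (‖w'‖ + ‖w‖) ≤ 2 * a * s := by
    intro w w' s h
    nlinarith [h.1, h.2]
  exact ⟨tendstoUniformly_of_norm_le hs (K := a) (h.mono fun x hx τ =>
      (abs_orbitX_sub_le ha _ τ).trans (mul_le_mul_of_nonneg_left (hx τ).1 ha.le)),
    tendstoUniformly_of_norm_le hs (K := a) (h.mono fun x hx τ =>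
      (abs_orbitY_sub_le ha _ τ).trans (mul_le_mul_of_nonneg_left (hx τ).1 ha.le)),
    tendstoUniformly_of_norm_le hs (K := 2 * a) (h.mono fun x hx τ =>
      (abs_deriv_orbitX_sub_le ha (hp x τ)).trans (key (hx τ))),
    tendstoUniformly_of_norm_le hs (K := 2 * a) (h.mono fun x hx τ =>
      (abs_deriv_orbitY_sub_le ha (hp x τ)).trans (key (hx τ)))⟩

end

theorem mainTheorem2 :
    -- the lunar value of `m` satisfies the hypothesis
    Complex.sin (Real.pi * hillChi 0.080848933808312) ≠ 0 ∧
    ∀ m : ℝ, Complex.sin (Real.pi * hillChi m) ≠ 0 →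
      -- equivalence of the real and the complex system
      (∀ (a k : ℝ), 0 < a → k / a ^ 3 = hillL m → ∀ (lam : ℝ) (p : ℝ → ℂ), (∀ τ, ‖p τ‖ < 1) →
        (IsComplexSolOn m lam Set.univ p (fun τ => (starRingEnd ℂ) (p τ)) ↔
          IsRealSol m k lam (orbitX a p) (orbitY a p))) ∧
      -- the energy integral
      (∀ (lam : ℂ) (α β : ℝ) (p q : ℝ → ℂ), IsComplexSolOn m lam (Set.Ioo α β) p q →
        ∀ s ∈ Set.Ioo α β, ∀ t ∈ Set.Ioo α β,
          hillEnergy m lam p q s = hillEnergy m lam p q t) ∧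
      -- each of the four periodicity conditions follows from the other three
      (∃ ε : ℝ, 0 < ε ∧ ∀ lam : ℂ, ‖lam‖ < ε → ∀ (α β : ℝ) (p q : ℝ → ℂ),
        α < 0 → 2 * Real.pi < β → IsComplexSolOn m lam (Set.Ioo α β) p q → SmallInit ε p q →
        (p (2 * Real.pi) = p 0 → q (2 * Real.pi) = q 0 →
          deriv p (2 * Real.pi) = deriv p 0 → deriv q (2 * Real.pi) = deriv q 0) ∧
        (p (2 * Real.pi) = p 0 → q (2 * Real.pi) = q 0 →
          deriv q (2 * Real.pi) = deriv q 0 → deriv p (2 * Real.pi) = deriv p 0) ∧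
        (m ≠ -1 → p (2 * Real.pi) = p 0 → deriv p (2 * Real.pi) = deriv p 0 →
          deriv q (2 * Real.pi) = deriv q 0 → q (2 * Real.pi) = q 0) ∧
        (m ≠ -1 → q (2 * Real.pi) = q 0 → deriv p (2 * Real.pi) = deriv p 0 →
          deriv q (2 * Real.pi) = deriv q 0 → p (2 * Real.pi) = p 0)) ∧
      -- the family of periodic solutions, with parameters `c = p₀ - q₀` and `λ`
      ∃ (δ : ℝ) (P Q : ℂ → ℂ → ℝ → ℂ) (A B : ℕ × ℕ → ℝ → ℂ), 0 < δ ∧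
        (∀ n, Differentiable ℝ (A n) ∧ Differentiable ℝ (B n) ∧
          Function.Periodic (A n) (2 * Real.pi) ∧ Function.Periodic (B n) (2 * Real.pi)) ∧
        (∀ c lam : ℂ, ‖c‖ < δ → ‖lam‖ < δ →
          IsComplexSolOn m lam Set.univ (P c lam) (Q c lam) ∧
          Function.Periodic (P c lam) (2 * Real.pi) ∧
          Function.Periodic (Q c lam) (2 * Real.pi) ∧
          P c lam 0 - Q c lam 0 = c ∧
          ∀ τ : ℝ,
            HasAbsSeries (fun n => A n τ) c lam (P c lam τ) ∧
            HasAbsSeries (fun n => B n τ) c lam (Q c lam τ) ∧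
            HasAbsSeries (fun n => deriv (A n) τ) c lam (deriv (P c lam) τ) ∧
            HasAbsSeries (fun n => deriv (B n) τ) c lam (deriv (Q c lam) τ)) ∧
        -- the family tends to the circular motion
        (∀ τ : ℝ, P 0 0 τ = 0 ∧ Q 0 0 τ = 0) ∧
        TendstoUniformly (fun z : ℂ × ℂ => P z.1 z.2) (fun _ => 0) (𝓝 0) ∧
        TendstoUniformly (fun z : ℂ × ℂ => Q z.1 z.2) (fun _ => 0) (𝓝 0) ∧
        TendstoUniformly (fun z : ℂ × ℂ => deriv (P z.1 z.2)) (fun _ => 0) (𝓝 0) ∧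
        TendstoUniformly (fun z : ℂ × ℂ => deriv (Q z.1 z.2)) (fun _ => 0) (𝓝 0) ∧
        -- there is no other small periodic solution: `c` is the only arbitrary constant
        (∃ ε : ℝ, 0 < ε ∧ ∀ lam : ℂ, ‖lam‖ < ε → ∀ p q : ℝ → ℂ,
          IsComplexSolOn m lam Set.univ p q → SmallInit ε p q →
          Function.Periodic p (2 * Real.pi) → Function.Periodic q (2 * Real.pi) →
          p = P (p 0 - q 0) lam ∧ q = Q (p 0 - q 0) lam) ∧
        -- real motions, for real `λ` and `p₀ - q₀ = -2iη₀` with `η₀` real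
        (∀ lam eta : ℝ, |lam| < δ → 2 * |eta| < δ → ∀ τ : ℝ,
          Q (-2 * Complex.I * eta) lam τ = (starRingEnd ℂ) (P (-2 * Complex.I * eta) lam τ)) ∧
        ∀ a k : ℝ, 0 < a → k / a ^ 3 = hillL m →
          (∀ lam eta : ℝ, |lam| < δ → 2 * |eta| < δ →
            IsRealSol m k lam (orbitX a (P (-2 * Complex.I * eta) lam))
              (orbitY a (P (-2 * Complex.I * eta) lam)) ∧
            Function.Periodic (orbitX a (P (-2 * Complex.I * eta) lam)) (2 * Real.pi) ∧
            Function.Periodic (orbitY a (P (-2 * Complex.I * eta) lam)) (2 * Real.pi) ∧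
            orbitY a (P (-2 * Complex.I * eta) lam) 0 = a * eta) ∧
          TendstoUniformly (fun z : ℝ × ℝ => orbitX a (P (-2 * Complex.I * z.1) z.2))
            (fun τ => a * Real.cos τ) (𝓝 0) ∧
          TendstoUniformly (fun z : ℝ × ℝ => orbitY a (P (-2 * Complex.I * z.1) z.2))
            (fun τ => a * Real.sin τ) (𝓝 0) ∧
          TendstoUniformly (fun z : ℝ × ℝ => deriv (orbitX a (P (-2 * Complex.I * z.1) z.2)))
            (fun τ => -a * Real.sin τ) (𝓝 0) ∧
          TendstoUniformly (fun z : ℝ × ℝ => deriv (orbitY a (P (-2 * Complex.I * z.1) z.2)))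
            (fun τ => a * Real.cos τ) (𝓝 0) := by
  refine ⟨sin_pi_hillChi_lunar_ne_zero, fun m hm => ⟨fun a k ha hk lam p hp =>
    isComplexSolOn_iff_isRealSol ha hk lam p hp, fun lam α β p q h s hs t ht =>
    hillEnergy_eq h hs ht, exists_periodicity_redundant m, ?_⟩⟩
  obtain ⟨F, a, δ, ε, hδ, hδε, hFc, hF0, hfam, huniq⟩ := exists_periodic_family m hm
  have hε := hδ.trans_le hδε
  let P : ℂ → ℂ → ℝ → ℂ := fun c lam t => (periodicState t (F (c, lam))).1
  let Q : ℂ → ℂ → ℝ → ℂ := fun c lam t => (periodicState t (F (c, lam))).2.1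
  have hP' : ∀ c lam t, HasDerivAt (P c lam) (periodicState t (F (c, lam))).2.2.1 t :=
    fun c lam t => hasDerivAt_periodicState_p _ t
  have hQ' : ∀ c lam t, HasDerivAt (Q c lam) (periodicState t (F (c, lam))).2.2.2 t :=
    fun c lam t => hasDerivAt_periodicState_q _ t
  have hperP : ∀ u : TimeCurve, Function.Periodic (fun t => (periodicState t u).1) (2 * Real.pi) :=
    fun u t => congrArg Prod.fst (periodicState_periodic u t)
  have hperQ : ∀ u : TimeCurve,
      Function.Periodic (fun t => (periodicState t u).2.1) (2 * Real.pi) :=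
    fun u t => congrArg (fun x : State => x.2.1) (periodicState_periodic u t)
  have hsol : ∀ c lam : ℂ, ‖c‖ < δ → ‖lam‖ < δ →
      IsComplexSolOn m lam Set.univ (P c lam) (Q c lam) := fun c lam hc hl =>
    isComplexSolOn_periodicState (hfam c lam hc hl).1 (hfam c lam hc hl).2.1
  have hinit : ∀ c lam : ℂ, ‖c‖ < δ → ‖lam‖ < δ → P c lam 0 - Q c lam 0 = c := by
    intro c lam hc hl
    obtain ⟨h1, h2, h3, -⟩ := hfam c lam hc hl
    have h4 := periodicState_eq h1 h2 (t := 0) ⟨le_rfl, Real.two_pi_pos.le⟩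
    rw [extendTime_zero] at h4
    change (periodicState 0 (F (c, lam))).1 - (periodicState 0 (F (c, lam))).2.1 = c
    rw [h4, h3]
  -- This single bound, uniform in `τ`, with `‖F z‖ → 0` yields all the uniform limits, including
  -- those of the derivatives, which are components of the state.
  have hbound : ∀ᶠ z in 𝓝 (0 : ℂ × ℂ), ∀ τ, ‖periodicState τ (F z)‖ ≤ ‖F z‖ := by
    refine Metric.eventually_nhds_iff.2 ⟨δ, hδ, fun z hz τ => ?_⟩
    rw [dist_zero_right] at hz
    obtain ⟨h1, h2, -⟩ :=
      hfam z.1 z.2 ((norm_fst_le z).trans_lt hz) ((norm_snd_le z).trans_lt hz)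
    exact norm_periodicState_le h1 h2 τ
  have hFt : Tendsto (fun z => ‖F z‖) (𝓝 0) (𝓝 0) := by
    have := hFc.tendsto.norm
    rwa [hF0, norm_zero] at this
  have hn1 : ∀ x : State, ‖x.1‖ ≤ ‖x‖ := fun x => norm_fst_le x
  have hn2 : ∀ x : State, ‖x.2.1‖ ≤ ‖x‖ := fun x => (norm_fst_le _).trans (norm_snd_le x)
  have hn3 : ∀ x : State, ‖x.2.2.1‖ ≤ ‖x‖ := fun x =>
    (norm_fst_le _).trans ((norm_snd_le _).trans (norm_snd_le x))
  have hn4 : ∀ x : State, ‖x.2.2.2‖ ≤ ‖x‖ := fun x =>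
    (norm_snd_le _).trans ((norm_snd_le _).trans (norm_snd_le x))
  have hconj : ∀ lam eta : ℝ, |lam| < δ → 2 * |eta| < δ →
      ‖(-2 * Complex.I * eta : ℂ)‖ < δ ∧ ‖(lam : ℂ)‖ < δ ∧ ∀ τ : ℝ,
      Q (-2 * Complex.I * eta) lam τ = (starRingEnd ℂ) (P (-2 * Complex.I * eta) lam τ) := by
    intro lam eta hl he
    have hl' : ‖(lam : ℂ)‖ < δ := by rwa [Complex.norm_real]
    have hc : ‖(-2 * Complex.I * eta : ℂ)‖ < δ := by
      rw [norm_mul, norm_mul, Complex.norm_I, Complex.norm_real, norm_neg, Complex.norm_ofNat,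
        mul_one]
      exact he
    refine ⟨hc, hl', ?_⟩
    generalize hcdef : (-2 * Complex.I * eta : ℂ) = c at hc
    -- Passing to `(conj q, conj p)` replaces `c` by `-conj c`, which is `c` for imaginary `c`. The
    -- conjugate pair is thus the member of the family with the same parameters.
    have hcc : (starRingEnd ℂ) c = -c := by
      rw [← hcdef]
      simp [map_ofNat]
    obtain ⟨h1, h2, -, h4, -⟩ := hfam c lam hc hl'
    have hst : ‖periodicState 0 (F (c, lam))‖ < ε := (norm_periodicState_le h1 h2 0).trans_lt h4
    have hdc : ∀ f : ℝ → ℂ, deriv (fun τ => (starRingEnd ℂ) (f τ)) 0 =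
      (starRingEnd ℂ) (deriv f 0) := fun f => deriv.star
    have hsm : SmallInit ε (fun τ => (starRingEnd ℂ) (Q c lam τ))
        (fun τ => (starRingEnd ℂ) (P c lam τ)) := by
      refine ⟨?_, ?_, ?_, ?_⟩
      · rw [Complex.norm_conj]; exact (hn2 _).trans_lt hst
      · rw [Complex.norm_conj]; exact (hn1 _).trans_lt hst
      · rw [hdc, Complex.norm_conj, (hQ' c lam 0).deriv]; exact (hn4 _).trans_lt hst
      · rw [hdc, Complex.norm_conj, (hP' c lam 0).deriv]; exact (hn3 _).trans_lt hst
    have hc0 : (starRingEnd ℂ) (Q c lam 0) - (starRingEnd ℂ) (P c lam 0) = c := by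
      rw [← map_sub, ← neg_sub, hinit c lam hc hl', map_neg, hcc, neg_neg]
    have h5 := huniq lam hl' _ _ (hsol c lam hc hl').conj hsm
      (fun t => congrArg (starRingEnd ℂ) (hperQ (F (c, lam)) t))
      (fun t => congrArg (starRingEnd ℂ) (hperP (F (c, lam)) t)) (by rwa [hc0])
    intro τ
    have h6 := congrArg (fun x : State => x.2.1) (congrFun h5 τ)
    simp only [hc0] at h6
    exact h6.symm
  refine ⟨δ, P, Q, fun n t => (periodicState t (a n)).1, fun n t => (periodicState t (a n)).2.1, hδ,
    fun n => ⟨fun t => (hasDerivAt_periodicState_p (a n) t).differentiableAt,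
      fun t => (hasDerivAt_periodicState_q (a n) t).differentiableAt, hperP _, hperQ _⟩,
    fun c lam hc hl => ⟨hsol c lam hc hl, hperP _, hperQ _, hinit c lam hc hl, fun τ => ?_⟩,
    fun τ => ?_, ?_, ?_, ?_, ?_, ⟨min ε (δ / 2), lt_min hε (half_pos hδ), ?_⟩,
    fun lam eta hl he => (hconj lam eta hl he).2.2, fun b k hb hk => ⟨fun lam eta hl he => ?_, ?_⟩⟩
  · obtain ⟨-, -, -, -, h5, h6⟩ := hfam c lam hc hl
    obtain ⟨h7, h8, h9, h10⟩ := hasAbsSeries_periodicState h5 h6 τ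
    refine ⟨h7, h8, ?_, ?_⟩
    · simp only [(hasDerivAt_periodicState_p _ τ).deriv, (hP' c lam τ).deriv]
      exact h9
    · simp only [(hasDerivAt_periodicState_q _ τ).deriv, (hQ' c lam τ).deriv]
      exact h10
  · have h0 : periodicState τ (F (0, 0)) = 0 := by
      rw [show ((0, 0) : ℂ × ℂ) = 0 from rfl, hF0, map_zero]
    exact ⟨congrArg Prod.fst h0, congrArg (fun x : State => x.2.1) h0⟩
  · refine tendstoUniformly_of_norm_le hFt (K := 1) (hbound.mono fun z hz τ => ?_)
    rw [sub_zero, one_mul]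
    exact (hn1 _).trans (hz τ)
  · refine tendstoUniformly_of_norm_le hFt (K := 1) (hbound.mono fun z hz τ => ?_)
    rw [sub_zero, one_mul]
    exact (hn2 _).trans (hz τ)
  · refine tendstoUniformly_of_norm_le hFt (K := 1) (hbound.mono fun z hz τ => ?_)
    rw [sub_zero, one_mul, (hP' _ _ τ).deriv]
    exact (hn3 _).trans (hz τ)
  · refine tendstoUniformly_of_norm_le hFt (K := 1) (hbound.mono fun z hz τ => ?_)
    rw [sub_zero, one_mul, (hQ' _ _ τ).deriv]
    exact (hn4 _).trans (hz τ)
  · intro lam hl p q hpq hs hp hq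
    have hle := min_le_left ε (δ / 2)
    -- The bound `δ / 2` on `p₀` and `q₀` puts their difference in the parameter range of the
    -- family.
    have hc : ‖p 0 - q 0‖ < δ := by
      have h1 := hs.1.trans_le (min_le_right _ _)
      have h2 := hs.2.1.trans_le (min_le_right _ _)
      linarith [norm_sub_le (p 0) (q 0)]
    have h := huniq lam (hl.trans_le ((min_le_right _ _).trans (half_le_self hδ.le))) p q hpq
      ⟨hs.1.trans_le hle, hs.2.1.trans_le hle, hs.2.2.1.trans_le hle, hs.2.2.2.trans_le hle⟩ hp hq hc
    exact ⟨funext fun t => congrArg Prod.fst (congrFun h t),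
      funext fun t => congrArg (fun x : State => x.2.1) (congrFun h t)⟩
  · obtain ⟨hc, hl', hQP⟩ := hconj lam eta hl he
    have h1 := hsol _ _ hc hl'
    rw [show Q (-2 * Complex.I * eta) lam = _ from funext hQP] at h1
    refine ⟨(isComplexSolOn_iff_isRealSol hb hk lam _ fun τ => h1.norm_p_lt τ trivial).1 h1,
      orbitX_periodic (hperP _) b, orbitY_periodic (hperP _) b, ?_⟩
    -- The imaginary part of `p₀ - conj p₀ = -2iη₀` gives `Im p₀ = -η₀`, while `y(0) = -a Im p₀`.
    have h2 := congrArg Complex.im (hinit _ _ hc hl')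
    rw [hQP 0] at h2
    rw [orbitY, Real.sin_zero, Real.cos_zero]
    generalize P (-2 * Complex.I * eta) lam 0 = w at h2
    simp at h2
    linear_combination (-b / 2) * h2
  · have hpar : Tendsto (fun z : ℝ × ℝ => ((-2 * Complex.I * z.1, z.2) : ℂ × ℂ)) (𝓝 0) (𝓝 0) := by
      have hcont : Continuous fun z : ℝ × ℝ => ((-2 * Complex.I * z.1, z.2) : ℂ × ℂ) := by fun_prop
      exact hcont.tendsto' 0 0 (by simp)
    exact tendstoUniformly_orbit (hFt.comp hpar)
      (fun z τ => hP' (-2 * Complex.I * z.1) z.2 τ) ((hpar.eventually hbound).mono fun z hz τ =>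
      ⟨(hn1 _).trans (hz τ), (hn3 _).trans (hz τ)⟩) hb
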